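/- **Setting.** For each sample size $N$ let $\mathcal D=\mathcal D_N$ be a probability distribution on $\mathbb R^{P}$, $P=P_N$, with finite second moments, let $\Sigma=\mathbb E_{x\sim\mathcal D}[xx^{\mathsf T}]$ with eigenvalues $\lambda_1,\dots,\lambda_P$, let $\beta=\beta_N\in\mathbb R^P$ be deterministic, and let $\lambda=\lambda_N>0$. (All of these may depend on $N$; the dependence is suppressed.) Let $x_1,\dots,x_N$ be independent samples from $\mathcal D$, $y_i=\beta^{\mathsf T}x_i$, let $X\in\mathbb R^{N\times P}$ have rows $x_i$, and let $\widehat\Sigma=\frac1N X^{\mathsf T}X$, with $N$ leading eigenvalues $\hat\lambda_1\ge\dots\ge\hat\lambda_N$ (padded with zeros if $N>P$). Put $$\hat\beta_\lambda=\operatorname*{argmin}_{b}\ \tfrac1N\sum_{i=1}^N(y_i-b^{\mathsf T}x_i)^2+\lambda\|b\|_2^2,\qquad \mathcal R(b)=\mathbb E_{x\sim\mathcal D}\big[(\beta^{\mathsf T}x-b^{\mathsf T}x)^2\big],$$ $$\mathrm{GCV}_\lambda=\Big(\frac1N\sum_{i=1}^N\frac{\lambda}{\lambda+\hat\lambda_i}\Big)^{-2}\cdot\frac1N\sum_{i=1}^N(y_i-\hat\beta_\lambda^{\mathsf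 T}x_i)^2 .$$ For $\ell>0$ let $\kappa=\kappa(\ell,N)$ be the unique positive solution of $1=\frac{\ell}{\kappa}+\frac1N\sum_{i=1}^P\frac{\lambda_i}{\kappa+\lambda_i}$. **Conventions.** Events $A^N$ occur with high probability if for every $D>0$ there is $N_D$ such that $\Pr(A^N)\ge1-N^{-D}$ for all $N\ge N_D$. We write $f\lesssim N^{-1/2+o(1)}g$, uniformly over $z$, if there are a constant $C>0$ and a deterministic sequence $o_N\to0$ such that, with high probability, $f^N(z)\le C N^{-1/2+o_N}g^N(z)$ for all $z$ simultaneously. **Local Marchenko–Pastur law over $S\subseteq\mathbb R_{>0}$** ($S=S_N$ may depend on $N$): for every deterministic $v=v_N\in\mathbb R^P$ with $v^{\mathsf T}\Sigma v\le1$, uniformly over $\ell\in S$ (with $\kappa=\kappa(\ell,N)$), $$\Big|\frac1\kappa-\frac1N\sum_{i=1}^N\frac1{\hat\lambda_i+\ell}\Big|\lesssim N^{-\frac12+o(1)}\frac1\kappa\sqrt{\frac{\partial\kappa}{\partial\ell}},\qquad \big|v^{\mathsf T}\kappa(\kappa I+\Sigma)^{-1}v-v^{\mathsf T}\ell(\ell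 I+\widehat\Sigma)^{-1}v\big|\lesssim N^{-\frac12+o(1)}\frac1\kappa\sqrt{\frac{\partial\kappa}{\partial\ell}} .$$ **Extended local Marchenko–Pastur law over $S$:** the local law over $S$ holds for the distribution of $(I+t\Sigma)^{-1/2}x$, $x\sim\mathcal D$ (with $\Sigma$, $\kappa$, $\widehat\Sigma$, $\hat\lambda_i$ those of the transformed distribution and its samples), uniformly over all real $t$ with $|t|\,\|\Sigma\|_{\mathrm{op}}<\frac12$; that is, $v$ may depend on $t$, while $C$, $o_N$ and $N_D$ may not. **Theorem.** Suppose that the extended local Marchenko–Pastur law holds over $S=(\frac12\lambda,\frac32\lambda)$. Then $$\big|\mathrm{GCV}_\lambda-\mathcal R(\hat\beta_\lambda)\big|\lesssim N^{-\frac12+o(1)}\cdot\beta^{\mathsf T}\Sigma\beta\cdot\Big[1+\frac{\|\Sigma\|_{\mathrm{op}}}{\lambda}+\Big(\frac{\operatorname{Tr}\Sigma}{N\lambda}\Big)^{3/2}\Big].$$ If moreover $\lambda=O(\|\Sigma\|_{\mathrm{op}})$ as $N\to\infty$ (as is the case for $\mathcal D$ with $\Sigma\ne0$ and $\lambda$ independent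 of $N$), then $$\big|\mathrm{GCV}_\lambda-\mathcal R(\hat\beta_\lambda)\big|\lesssim N^{-\frac12+o(1)}\cdot\beta^{\mathsf T}\Sigma\beta\cdot\Big[\frac{\|\Sigma\|_{\mathrm{op}}}{\lambda}+\Big(\frac{\operatorname{Tr}\Sigma}{N\lambda}\Big)^{3/2}\Big].$$ -/

import Mathlib

open Filter Topology MeasureTheory Matrix

noncomputable section

namespace RidgeGCV

/-! ### Probabilistic conventions -/

/-- A family of events `A N i` (with `N` the sample size and `i` an auxiliary parameter, each event
living in its own space with its own law `μ N i`) occurs *with high probability, uniformly in `i`*: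
for every `D > 0` there is a threshold, not depending on `i`, from which on the probability of
failure is at most `N ^ (-D)`. -/
def WithHighProbability {I : ℕ → Type*} {Ω : ℕ → Type*} [∀ N, MeasurableSpace (Ω N)]
    (μ : ∀ N, I N → Measure (Ω N)) (A : ∀ N, I N → Set (Ω N)) : Prop :=
  ∀ D : ℝ, 0 < D → ∃ N₀ : ℕ, ∀ N, N₀ ≤ N → ∀ i : I N,
    μ N i (A N i)ᶜ ≤ ENNReal.ofReal ((N : ℝ) ^ (-D))

/-- Read `E N i r` as the event that some quantities are at most `r` times their reference
quantities. `HasHalfRate μ E` says that they are `≲ N ^ (-1/2 + o(1))` times the reference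
quantities: there are a constant `C > 0` and a deterministic sequence `o N → 0` such that
`E N i (C * N ^ (-1/2 + o N))` occurs with high probability (uniformly in `i`). -/
def HasHalfRate {I : ℕ → Type*} {Ω : ℕ → Type*} [∀ N, MeasurableSpace (Ω N)]
    (μ : ∀ N, I N → Measure (Ω N)) (E : ∀ N, I N → ℝ → Set (Ω N)) : Prop :=
  ∃ C : ℝ, 0 < C ∧ ∃ o : ℕ → ℝ, Tendsto o atTop (𝓝 0) ∧
    WithHighProbability μ (fun N i => E N i (C * (N : ℝ) ^ (-(1 / 2 : ℝ) + o N)))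

/-- The law of `N` independent samples `x₁, …, x_N` from `𝒟`. -/
def sampleLaw {P : ℕ} (𝒟 : Measure (Fin P → ℝ)) (N : ℕ) : Measure (Fin N → Fin P → ℝ) :=
  Measure.pi fun _ : Fin N => 𝒟

/-! ### Population and sample second moments -/

/-- The second moment matrix `Σ = E[x xᵀ]` of `x ∼ 𝒟`. -/
def secondMoment {P : ℕ} (𝒟 : Measure (Fin P → ℝ)) : Matrix (Fin P) (Fin P) ℝ :=
  Matrix.of fun i j => ∫ x, x i * x j ∂𝒟

theorem secondMoment_isHermitian {P : ℕ} (𝒟 : Measure (Fin P → ℝ)) :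
    (secondMoment 𝒟).IsHermitian := by
  ext i j
  simp [secondMoment, Matrix.conjTranspose_apply, mul_comm]

/-- The empirical second moment matrix `Σ̂ = (1/N) Xᵀ X`, where the rows of `X` are the samples. -/
def sampleSecondMoment {N P : ℕ} (X : Fin N → Fin P → ℝ) : Matrix (Fin P) (Fin P) ℝ :=
  (N : ℝ)⁻¹ • ((Matrix.of X)ᵀ * Matrix.of X)

theorem sampleSecondMoment_isHermitian {N P : ℕ} (X : Fin N → Fin P → ℝ) :
    (sampleSecondMoment X).IsHermitian := by
  ext i j
  simp [sampleSecondMoment, Matrix.mul_apply, mul_comm]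

/-- The `N` leading eigenvalues `λ̂₁ ≥ ⋯ ≥ λ̂_N` of `Σ̂`. (`eigenvalues₀` is the list of the `P`
eigenvalues in decreasing order; `Σ̂` has rank at most `N`, and if `N > P` the list is continued
by zeros.) -/
def sampleEigenvalue {N P : ℕ} (X : Fin N → Fin P → ℝ) (i : Fin N) : ℝ :=
  if h : (i : ℕ) < P then
    (sampleSecondMoment_isHermitian X).eigenvalues₀ ⟨i, by simpa using h⟩
  else 0

/-- The `ℓ²` operator norm of a square matrix. -/
def opNorm {P : ℕ} (A : Matrix (Fin P) (Fin P) ℝ) : ℝ :=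
  ‖Matrix.toEuclideanCLM (n := Fin P) (𝕜 := ℝ) A‖

/-- `A ^ (-1/2)` for a positive definite matrix `A`, by the functional calculus. -/
def invSqrt {P : ℕ} (A : Matrix (Fin P) (Fin P) ℝ) : Matrix (Fin P) (Fin P) ℝ :=
  cfc (fun s : ℝ => (√s)⁻¹) A

theorem invSqrt_mul_self_mul {P : ℕ} {A : Matrix (Fin P) (Fin P) ℝ} (hA : A.PosDef) :
    invSqrt A * invSqrt A * A = 1 := by
  have hsa : IsSelfAdjoint A := hA.isHermitian
  have hfin : (spectrum ℝ A).Finite := Matrix.finite_real_spectrum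
  have hco : ∀ f : ℝ → ℝ, ContinuousOn f (spectrum ℝ A) := fun f => hfin.continuousOn f
  have hid : cfc (fun s : ℝ => s) A = A := cfc_id' ℝ A hsa
  have hpos : ∀ s ∈ spectrum ℝ A, 0 < s := by
    intro s hs
    rw [hA.isHermitian.spectrum_real_eq_range_eigenvalues] at hs
    obtain ⟨i, rfl⟩ := hs
    exact hA.eigenvalues_pos i
  calc invSqrt A * invSqrt A * A
      = invSqrt A * invSqrt A * cfc (fun s : ℝ => s) A := by rw [hid]
    _ = cfc (fun s : ℝ => (√s)⁻¹ * (√s)⁻¹ * s) A := by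
        rw [invSqrt, ← cfc_mul _ _ A (hco _) (hco _), ← cfc_mul _ _ A (hco _) (hco _)]
    _ = cfc (fun _ : ℝ => (1 : ℝ)) A := by
        refine cfc_congr fun s hs => ?_
        have h := hpos s hs
        rw [← mul_inv, Real.mul_self_sqrt h.le, inv_mul_cancel₀ h.ne']
    _ = 1 := cfc_const_one ℝ A

/-- The law of `A x` when `x ∼ 𝒟`. -/
def linearImage {P : ℕ} (A : Matrix (Fin P) (Fin P) ℝ) (𝒟 : Measure (Fin P → ℝ)) :
    Measure (Fin P → ℝ) :=
  𝒟.map fun x => A *ᵥ x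

/-! ### The effective regularization -/

/-- `k` is a positive solution of `1 = l / k + (1/N) ∑ᵢ λᵢ / (k + λᵢ)`, where `λᵢ` are the
eigenvalues of the second moment matrix of `𝒟`. -/
def IsEffectiveReg {P : ℕ} (𝒟 : Measure (Fin P → ℝ)) (N : ℕ) (l k : ℝ) : Prop :=
  0 < k ∧ 1 = l / k + (1 / (N : ℝ)) * ∑ i : Fin P,
    (secondMoment_isHermitian 𝒟).eigenvalues i / (k + (secondMoment_isHermitian 𝒟).eigenvalues i)

/-- The effective regularization `κ(l, N)`: the positive solution of the equation above, which
exists and is unique for `l > 0` by `existsUnique_isEffectiveReg`. -/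
def effectiveReg {P : ℕ} (𝒟 : Measure (Fin P → ℝ)) (N : ℕ) (l : ℝ) : ℝ :=
  Classical.epsilon (IsEffectiveReg 𝒟 N l)

/-- `(1 / κ) * √(∂κ/∂l)`, evaluated at `l`. -/
def mpScale {P : ℕ} (𝒟 : Measure (Fin P → ℝ)) (N : ℕ) (l : ℝ) : ℝ :=
  1 / effectiveReg 𝒟 N l * √(deriv (effectiveReg 𝒟 N) l)

theorem secondMoment_posSemidef {P : ℕ} (𝒟 : Measure (Fin P → ℝ))
    (h𝒟 : ∀ j, MemLp (fun x : Fin P → ℝ => x j) 2 𝒟) : (secondMoment 𝒟).PosSemidef := by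
  refine Matrix.PosSemidef.of_dotProduct_mulVec_nonneg (secondMoment_isHermitian 𝒟) fun v => ?_
  have hint : ∀ i j, Integrable (fun x : Fin P → ℝ => x i * x j) 𝒟 := fun i j =>
    (h𝒟 i).integrable_mul (h𝒟 j)
  have : star v ⬝ᵥ (secondMoment 𝒟 *ᵥ v) = ∫ x, (v ⬝ᵥ x) ^ 2 ∂𝒟 := by
    have e : ∀ x : Fin P → ℝ, (v ⬝ᵥ x) ^ 2 = ∑ i, ∑ j, v i * v j * (x i * x j) := by
      intro x
      rw [sq, dotProduct, Finset.sum_mul_sum]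
      exact Finset.sum_congr rfl fun i _ => Finset.sum_congr rfl fun j _ => by ring
    simp_rw [e]
    rw [integral_finsetSum _ fun i _ => integrable_finsetSum _ fun j _ => (hint i j).const_mul _]
    simp only [dotProduct, mulVec, star_trivial, Finset.mul_sum]
    refine Finset.sum_congr rfl fun i _ => ?_
    rw [integral_finsetSum _ fun j _ => (hint i j).const_mul _]
    refine Finset.sum_congr rfl fun j _ => ?_
    rw [integral_const_mul]
    simp only [secondMoment, Matrix.of_apply]
    ring
  rw [this]
  exact integral_nonneg fun x => sq_nonneg _

theorem existsUnique_isEffectiveReg {P : ℕ} (𝒟 : Measure (Fin P → ℝ))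
    (h𝒟 : ∀ j, MemLp (fun x : Fin P → ℝ => x j) 2 𝒟) {N : ℕ} {l : ℝ} (hl : 0 < l) :
    ∃! k, IsEffectiveReg 𝒟 N l k := by
  have hnn : ∀ i, 0 ≤ (secondMoment_isHermitian 𝒟).eigenvalues i :=
    (secondMoment_posSemidef 𝒟 h𝒟).eigenvalues_nonneg
  unfold IsEffectiveReg
  generalize (secondMoment_isHermitian 𝒟).eigenvalues = e at hnn
  set F : ℝ → ℝ := fun k => l / k + (1 / (N : ℝ)) * ∑ i, e i / (k + e i) with hF
  have hanti : StrictAntiOn F (Set.Ioi 0) := by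
    intro a ha b hb hab
    rw [Set.mem_Ioi] at ha hb
    have h1 : l / b < l / a := div_lt_div_of_pos_left hl ha hab
    have h2 : ∑ i, e i / (b + e i) ≤ ∑ i, e i / (a + e i) := by
      refine Finset.sum_le_sum fun i _ => ?_
      have := hnn i
      gcongr
    have h3 : (0 : ℝ) ≤ 1 / (N : ℝ) := by positivity
    have := mul_le_mul_of_nonneg_left h2 h3
    simp only [hF]
    linarith
  have hcont : ContinuousOn F (Set.Ioi 0) := by
    have hk : ∀ k ∈ Set.Ioi (0 : ℝ), k ≠ 0 := fun k hk => ne_of_gt hk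
    refine ContinuousOn.add (continuousOn_const.div continuousOn_id hk) ?_
    refine continuousOn_const.mul (continuousOn_finsetSum _ fun i _ => ?_)
    refine continuousOn_const.div (continuousOn_id.add continuousOn_const) fun k hk => ?_
    have := hnn i
    rw [Set.mem_Ioi] at hk
    change k + e i ≠ 0
    positivity
  set s : ℝ := (1 / (N : ℝ)) * ∑ i, e i with hs
  have hs0 : 0 ≤ s := mul_nonneg (by positivity) (Finset.sum_nonneg fun i _ => hnn i)
  have hlow : 1 ≤ F l := by
    have : 0 ≤ (1 / (N : ℝ)) * ∑ i, e i / (l + e i) :=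
      mul_nonneg (by positivity) (Finset.sum_nonneg fun i _ =>
        div_nonneg (hnn i) (add_nonneg hl.le (hnn i)))
    simp only [hF, div_self hl.ne']
    linarith
  have hpos : 0 < l + s := by linarith
  have hhigh : F (l + s) ≤ 1 := by
    have h1 : ∑ i, e i / (l + s + e i) ≤ (∑ i, e i) / (l + s) := by
      rw [Finset.sum_div]
      refine Finset.sum_le_sum fun i _ => ?_
      exact div_le_div_of_nonneg_left (hnn i) hpos (by linarith [hnn i])
    have h2 := mul_le_mul_of_nonneg_left h1 (show (0 : ℝ) ≤ 1 / (N : ℝ) by positivity)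
    calc F (l + s) ≤ l / (l + s) + (1 / (N : ℝ)) * ((∑ i, e i) / (l + s)) := by
          simp only [hF]
          linarith
      _ = (l + s) / (l + s) := by rw [hs]; ring
      _ = 1 := div_self hpos.ne'
  obtain ⟨k, hk, hk1⟩ := intermediate_value_Icc' (show l ≤ l + s by linarith)
    (hcont.mono fun x hx => lt_of_lt_of_le hl hx.1) ⟨hhigh, hlow⟩
  have hk0 : 0 < k := lt_of_lt_of_le hl hk.1
  refine ⟨k, ⟨hk0, hk1.symm⟩, fun k' hk' => ?_⟩
  exact hanti.injOn hk'.1 hk0 (show F k' = F k by rw [hk1]; exact hk'.2.symm)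

/-! ### Ridge regression -/

/-- The ridge objective at `b`, for the noiseless labels `yᵢ = βᵀ xᵢ`. -/
def ridgeObjective {N P : ℕ} (β : Fin P → ℝ) (l : ℝ) (X : Fin N → Fin P → ℝ) (b : Fin P → ℝ) : ℝ :=
  1 / (N : ℝ) * ∑ i, (β ⬝ᵥ X i - b ⬝ᵥ X i) ^ 2 + l * (b ⬝ᵥ b)

/-- The ridge estimator `β̂_l`: the minimizer of the ridge objective, which for `l > 0` exists and
is unique, see `isMin_ridgeObjective_iff` and `ridgeEstimator_eq`. -/
def ridgeEstimator {N P : ℕ} (β : Fin P → ℝ) (l : ℝ) (X : Fin N → Fin P → ℝ) : Fin P → ℝ :=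
  Classical.epsilon fun b => ∀ b', ridgeObjective β l X b ≤ ridgeObjective β l X b'

theorem sampleSecondMoment_bilin {N P : ℕ} (X : Fin N → Fin P → ℝ) (u w : Fin P → ℝ) :
    u ⬝ᵥ (sampleSecondMoment X *ᵥ w) = 1 / (N : ℝ) * ∑ i, (u ⬝ᵥ X i) * (w ⬝ᵥ X i) := by
  have h1 : ∀ z : Fin P → ℝ, ∀ i, (Matrix.of X *ᵥ z) i = z ⬝ᵥ X i := fun z i => by
    simp [mulVec, dotProduct_comm]
  rw [sampleSecondMoment, smul_mulVec, dotProduct_smul, ← mulVec_mulVec, dotProduct_mulVec,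
    vecMul_transpose, dotProduct]
  simp only [h1, smul_eq_mul, one_div]

/-- For `l > 0` the ridge objective has exactly one minimizer, `(Σ̂ + l I)⁻¹ Σ̂ β`. -/
theorem isMin_ridgeObjective_iff {N P : ℕ} (β : Fin P → ℝ) {l : ℝ} (hl : 0 < l)
    (X : Fin N → Fin P → ℝ) (b : Fin P → ℝ) :
    (∀ b', ridgeObjective β l X b ≤ ridgeObjective β l X b') ↔
      b = (sampleSecondMoment X + l • 1)⁻¹ *ᵥ (sampleSecondMoment X *ᵥ β) := by
  set A : Matrix (Fin P) (Fin P) ℝ := sampleSecondMoment X + l • 1 with hA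
  have hpsd : ∀ d : Fin P → ℝ, 0 ≤ d ⬝ᵥ (sampleSecondMoment X *ᵥ d) := fun d => by
    rw [sampleSecondMoment_bilin]
    exact mul_nonneg (by positivity) (Finset.sum_nonneg fun i _ => mul_self_nonneg _)
  have hAd : ∀ d z : Fin P → ℝ,
      d ⬝ᵥ (A *ᵥ z) = d ⬝ᵥ (sampleSecondMoment X *ᵥ z) + l * (d ⬝ᵥ z) := fun d z => by
    rw [hA, add_mulVec, dotProduct_add, smul_mulVec, one_mulVec, dotProduct_smul, smul_eq_mul]
  have hApos : ∀ d : Fin P → ℝ, d ≠ 0 → 0 < d ⬝ᵥ (A *ᵥ d) := fun d hd => by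
    have : 0 < d ⬝ᵥ d := by simpa using dotProduct_star_self_pos_iff.2 hd
    rw [hAd]
    have := hpsd d
    positivity
  have hdet : IsUnit A.det := by
    rw [isUnit_iff_ne_zero]
    intro h0
    obtain ⟨v, hv, hv0⟩ := Matrix.exists_mulVec_eq_zero_iff.2 h0
    have := hApos v hv
    rw [hv0] at this
    simp at this
  set c := A⁻¹ *ᵥ (sampleSecondMoment X *ᵥ β) with hc
  have hAc : A *ᵥ c = sampleSecondMoment X *ᵥ β := by
    rw [hc, mulVec_mulVec, Matrix.mul_nonsing_inv _ hdet, one_mulVec]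
  have hobj : ∀ z, ridgeObjective β l X z
      = (β - z) ⬝ᵥ (sampleSecondMoment X *ᵥ (β - z)) + l * (z ⬝ᵥ z) := fun z => by
    rw [sampleSecondMoment_bilin, ridgeObjective]
    simp only [sub_dotProduct, sq]
  have hsymm : ∀ u w : Fin P → ℝ,
      u ⬝ᵥ (sampleSecondMoment X *ᵥ w) = w ⬝ᵥ (sampleSecondMoment X *ᵥ u) := fun u w => by
    simp only [sampleSecondMoment_bilin, mul_comm]
  have hkey : ∀ z, ridgeObjective β l X z
      = ridgeObjective β l X c + (z - c) ⬝ᵥ (A *ᵥ (z - c)) := fun z => by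
    have e := congrArg (fun y => (z - c) ⬝ᵥ y) hAc
    simp only [hAd] at e
    rw [hobj, hobj, hAd]
    simp only [mulVec_sub, dotProduct_sub, sub_dotProduct] at e ⊢
    rw [hsymm β z, hsymm β c, hsymm c z, dotProduct_comm c z] at *
    linarith
  constructor
  · intro h
    by_contra hne
    have h1 := hApos (b - c) (sub_ne_zero.2 hne)
    have h2 := hkey b
    have h3 := h c
    linarith
  · rintro rfl b'
    rcases eq_or_ne b' c with rfl | hne
    · exact le_rfl
    · have h1 := hApos (b' - c) (sub_ne_zero.2 hne)
      have h2 := hkey b'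
      linarith

/-- Consistency of `ridgeEstimator` with the closed form. -/
theorem ridgeEstimator_eq {N P : ℕ} (β : Fin P → ℝ) {l : ℝ} (hl : 0 < l)
    (X : Fin N → Fin P → ℝ) :
    ridgeEstimator β l X
      = (sampleSecondMoment X + l • 1)⁻¹ *ᵥ (sampleSecondMoment X *ᵥ β) :=
  (isMin_ridgeObjective_iff β hl X _).1 <| Classical.epsilon_spec
    (p := fun b => ∀ b', ridgeObjective β l X b ≤ ridgeObjective β l X b')
    ⟨_, (isMin_ridgeObjective_iff β hl X _).2 rfl⟩

/-- The generalization risk `E[(βᵀ x - bᵀ x)²]`. -/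
def generalizationRisk {P : ℕ} (𝒟 : Measure (Fin P → ℝ)) (β b : Fin P → ℝ) : ℝ :=
  ∫ x, (β ⬝ᵥ x - b ⬝ᵥ x) ^ 2 ∂𝒟

/-- The empirical risk `(1/N) ∑ᵢ (yᵢ - bᵀ xᵢ)²`. -/
def empiricalRisk {N P : ℕ} (β : Fin P → ℝ) (X : Fin N → Fin P → ℝ) (b : Fin P → ℝ) : ℝ :=
  1 / (N : ℝ) * ∑ i, (β ⬝ᵥ X i - b ⬝ᵥ X i) ^ 2

/-- The generalized cross-validation estimator
`GCV_l = ((1/N) ∑ᵢ l / (l + λ̂ᵢ))⁻² * R_empirical(β̂_l)`. -/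
def gcv {N P : ℕ} (β : Fin P → ℝ) (l : ℝ) (X : Fin N → Fin P → ℝ) : ℝ :=
  ((1 / (N : ℝ) * ∑ i, l / (l + sampleEigenvalue X i)) ^ 2)⁻¹ *
    empiricalRisk β X (ridgeEstimator β l X)

/-! ### The local Marchenko–Pastur law -/

/-- The event that the two estimates of the local Marchenko–Pastur law for the vector `v` hold, with
prefactor `r`, simultaneously for all `l ∈ S`. -/
def localMPEvent {P : ℕ} (𝒟 : Measure (Fin P → ℝ)) (N : ℕ) (S : Set ℝ) (v : Fin P → ℝ) (r : ℝ) :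
    Set (Fin N → Fin P → ℝ) :=
  {X | ∀ l ∈ S,
    |1 / effectiveReg 𝒟 N l - 1 / (N : ℝ) * ∑ i, 1 / (sampleEigenvalue X i + l)|
        ≤ r * mpScale 𝒟 N l ∧
    |v ⬝ᵥ ((effectiveReg 𝒟 N l • (effectiveReg 𝒟 N l • 1 + secondMoment 𝒟)⁻¹) *ᵥ v)
        - v ⬝ᵥ ((l • (l • 1 + sampleSecondMoment X)⁻¹) *ᵥ v)|
        ≤ r * mpScale 𝒟 N l}

/-- The local Marchenko–Pastur law over the sets `S N`, for distributions `𝒟 N i` on `ℝ^(P N)`,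
uniformly over the parameter `i`: for all deterministic vectors `v` with `vᵀ Σ v ≤ 1`, the estimates
hold with prefactor `≲ N ^ (-1/2 + o(1))`, uniformly over `S N`. -/
def LocalMPLaw {P : ℕ → ℕ} {I : ℕ → Type*} (𝒟 : ∀ N, I N → Measure (Fin (P N) → ℝ))
    (S : ℕ → Set ℝ) : Prop :=
  ∀ v : ∀ N, I N → Fin (P N) → ℝ,
    (∀ N i, v N i ⬝ᵥ (secondMoment (𝒟 N i) *ᵥ v N i) ≤ 1) →
    HasHalfRate (fun N i => sampleLaw (𝒟 N i) N)
      (fun N i r => localMPEvent (𝒟 N i) N (S N) (v N i) r)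

/-- The extended local Marchenko–Pastur law: the law holds for `(I + t Σ) ^ (-1/2) x`, `x ∼ 𝒟 N`,
uniformly over all real `t` with `|t| < 1 / (2 ‖Σ‖)`. -/
def ExtendedLocalMPLaw {P : ℕ → ℕ} (𝒟 : ∀ N, Measure (Fin (P N) → ℝ)) (S : ℕ → Set ℝ) : Prop :=
  LocalMPLaw (I := fun N => {t : ℝ // |t| * opNorm (secondMoment (𝒟 N)) < 1 / 2})
    (fun N t => linearImage (invSqrt (1 + (t : ℝ) • secondMoment (𝒟 N))) (𝒟 N)) S

/-- `|GCV - R(β̂)| ≲ N ^ (-1/2 + o(1)) * B N` for samples of size `N` from `𝒟 N`, ground truth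
`β N` and ridge parameter `lam N`. -/
def GCVErrorBound {P : ℕ → ℕ} (𝒟 : ∀ N, Measure (Fin (P N) → ℝ)) (β : ∀ N, Fin (P N) → ℝ)
    (lam : ℕ → ℝ) (B : ℕ → ℝ) : Prop :=
  HasHalfRate (I := fun _ => Unit) (fun N _ => sampleLaw (𝒟 N) N)
    (fun N _ r => {X | |gcv (β N) (lam N) X
      - generalizationRisk (𝒟 N) (β N) (ridgeEstimator (β N) (lam N) X)| ≤ r * B N})

end RidgeGCV

end

/-! Write `Q = Σ`, `R = Σ̂`, and consider three functions of the sample: the perturbed bias `b(t) =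
βᵀ λ (λ(1 + tQ) + R)⁻¹ β`, the empirical Stieltjes transform `m(t)` at `λ` of the whitened samples
`(1 + tQ)^(-1/2) xᵢ`, and the path `f(l) = βᵀ l (l + R)⁻¹ β`. Then `b(0) = f(λ)`, `-b'(0)` is the
generalization risk, and `f'(λ)` is the empirical risk over `λ²`, so that GCV is `f'(λ) / m(0)²`.
The claim is thus that `b(t)` and `f(λ - t / (m(t)(t + m(t))))` have nearly the same derivative at
`t = 0`.

These two functions are close because of the population equation. If `u = 1/κ` belongs to the
whitened distribution, then `1 = u (λ + G(t + u))` with `G(w) = (1/N) tr Q(1 + wQ)⁻¹`, and the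
population bias is `βᵀ(1 + (t + u)Q)⁻¹β`. Both `G` and the bias see `t` only through `t + u`, so
perturbing by `t` at `λ` is the same as not perturbing at `λ - t/(u(t + u))` (`dualReg_zero_eq`).
The local law at `t` and the local law at `0` therefore compare `b(t)` and `f` at the shifted
regularization with one and the same number; replacing `u` by `m(t)` costs little (`lawAt_of_mem`,
`abs_discrepancy_le`).

To pass to derivatives, the discrepancy of the two functions is continued to a complex disc of
radius `ρ` comparable to `min(λu₀², 1/‖Σ‖)`, where `u₀ = u` at `t = 0`; there it is at most `8ρ
(risk + GCV)`. By `exists_norm_deriv_le`, smallness at `K + 1` real nodes at distance of order `ηρ`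
controls the derivative up to a loss `1/η` and a remainder `η^K`. With `η = N^(-ε)` and `K ≥ 1/ε`
both are harmless, and finitely many `t` need only a union bound.

The remainder requires a priori bounds on risk and GCV. The risk is bounded by convexity of `b` and
the law at the extra node `-ρ`. If the relative error `rσ` of the law (`r` its rate, `σ² = κ/λ`) is
small, then `m(0)` is comparable to `u₀` and GCV is under control. Otherwise `1 ≤ 24rσ` and the two
quantities are bounded separately: GCV is at most `N (‖β‖² - f(λ)) / m(0)`, where `1/m(0)` is
bounded with overwhelming probability without any local law, and the resulting `N r³` is again of
order `N^(-1/2 + o(1))`. -/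

namespace RidgeGCV

/-! ### Numerical differentiation of bounded holomorphic functions -/

/-- Differentiation at `0` of polynomials of degree at most `K` is a combination of the values at
`0, …, K`. -/
theorem exists_derivative_weights (K : ℕ) : ∃ w : ℕ → ℂ, ∀ p : Polynomial ℂ, p.natDegree ≤ K →
    p.derivative.eval 0 = ∑ j ∈ Finset.range (K + 1), w j * p.eval (j : ℂ) := by
  refine ⟨fun j => (Lagrange.basis (Finset.range (K + 1)) (fun i : ℕ => (i : ℂ)) j).derivative.eval
    0, fun p hp => ?_⟩
  have hinj : Set.InjOn (fun i : ℕ => (i : ℂ)) (Finset.range (K + 1) : Set ℕ) :=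
    Nat.cast_injective.injOn
  have hdeg : p.degree < (Finset.range (K + 1)).card := by
    rw [Finset.card_range]
    refine lt_of_le_of_lt Polynomial.degree_le_natDegree ?_
    exact_mod_cast Nat.lt_succ_of_le hp
  conv_lhs => rw [Lagrange.eq_interpolate hinj hdeg, Lagrange.interpolate_apply]
  rw [Polynomial.derivative_sum, Polynomial.eval_finsetSum]
  refine Finset.sum_congr rfl fun j _ => ?_
  simp [mul_comm]

/-- A holomorphic function on a disc is close to its Taylor polynomial. -/
theorem norm_sub_taylor_le {H : ℂ → ℂ} {ρ M : ℝ} (hρ : 0 < ρ)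
    (hH : DifferentiableOn ℂ H (Metric.ball 0 ρ)) (hM : ∀ z ∈ Metric.ball (0 : ℂ) ρ, ‖H z‖ ≤ M)
    (K : ℕ) {η : ℝ} (hη : 0 < η) (hη1 : η ≤ 1) {z : ℂ} (hz : ‖z‖ ≤ η * ρ / 4) :
    ‖H z - ∑ k ∈ Finset.range (K + 1), ((k.factorial : ℂ)⁻¹ * iteratedDeriv k H 0) * z ^ k‖
      ≤ M * η ^ (K + 1) := by
  have hM0 : 0 ≤ M := (norm_nonneg _).trans (hM 0 (by simpa using hρ))
  set c : ℕ → ℂ := fun k => (k.factorial : ℂ)⁻¹ * iteratedDeriv k H 0 with hc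
  have hzb : z ∈ Metric.ball (0 : ℂ) ρ := by
    rw [mem_ball_zero_iff]
    nlinarith
  have hsum : HasSum (fun k => c k * z ^ k) (H z) := by
    have := Complex.hasSum_taylorSeries_on_ball hH hzb
    simpa [hc, mul_comm, mul_left_comm] using this
  have hsub : Metric.closedBall (0 : ℂ) (ρ / 2) ⊆ Metric.ball 0 ρ :=
    Metric.closedBall_subset_ball (by linarith)
  -- Cauchy's estimate at radius `ρ / 2`. As `‖z‖` is at most `η / 2` times this radius, the Taylor
  -- terms decay like `(η / 2) ^ k`.
  have hcb : ∀ k, ‖c k‖ ≤ M / (ρ / 2) ^ k := by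
    intro k
    have h1 : ‖iteratedDeriv k H 0‖ ≤ k.factorial * M / (ρ / 2) ^ k := by
      refine Complex.norm_iteratedDeriv_le_of_forall_mem_sphere_norm_le k (by positivity) ?_ ?_
      · refine DifferentiableOn.diffContOnCl (hH.mono ?_)
        rw [closure_ball _ (by positivity)]
        exact hsub
      · exact fun w hw => hM w (hsub (Metric.sphere_subset_closedBall hw))
    have hf : (0 : ℝ) < k.factorial := by exact_mod_cast k.factorial_pos
    rw [hc]
    simp only [norm_mul, norm_inv, Complex.norm_natCast]
    calc (k.factorial : ℝ)⁻¹ * ‖iteratedDeriv k H 0‖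
        ≤ (k.factorial : ℝ)⁻¹ * (k.factorial * M / (ρ / 2) ^ k) := by gcongr
      _ = M / (ρ / 2) ^ k := by field_simp
  have hterm : ∀ k, ‖c k * z ^ k‖ ≤ M * (η / 2) ^ k := by
    intro k
    rw [norm_mul, norm_pow]
    calc ‖c k‖ * ‖z‖ ^ k ≤ M / (ρ / 2) ^ k * (η * ρ / 4) ^ k := by
          gcongr
          exact hcb k
      _ = M * (η / 2) ^ k := by
          rw [div_mul_eq_mul_div, mul_div_assoc, ← div_pow]
          congr 2
          field_simp
          norm_num
  have htail : HasSum (fun k => c (k + (K + 1)) * z ^ (k + (K + 1)))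
      (H z - ∑ k ∈ Finset.range (K + 1), c k * z ^ k) :=
    (hasSum_nat_add_iff' (K + 1)).2 hsum
  have hgeom : HasSum (fun k : ℕ => M * (η / 2) ^ (K + 1) * (1 / 2) ^ k)
      (M * (η / 2) ^ (K + 1) * 2) := by
    have := hasSum_geometric_two.mul_left (M * (η / 2) ^ (K + 1))
    simpa using this
  have hle : ‖H z - ∑ k ∈ Finset.range (K + 1), c k * z ^ k‖ ≤ M * (η / 2) ^ (K + 1) * 2 := by
    rw [← htail.tsum_eq]
    refine tsum_of_norm_bounded hgeom fun k => ?_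
    refine (hterm _).trans ?_
    rw [pow_add, mul_comm ((η / 2) ^ k), ← mul_assoc]
    gcongr
  refine hle.trans ?_
  rw [div_pow, mul_assoc]
  gcongr
  rw [div_mul_eq_mul_div, div_le_iff₀ (by positivity)]
  gcongr
  exact le_self_pow₀ (by norm_num) (by omega)

/-- If a bounded holomorphic function is small at `K + 1` equispaced points near the centre of the
disc, then its derivative there is small. -/
theorem exists_norm_deriv_le (K : ℕ) (hK : 1 ≤ K) : ∃ C : ℝ, 0 < C ∧
    ∀ (H : ℂ → ℂ) (ρ M ε η : ℝ), 0 < ρ → 0 < η → η ≤ 1 →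
      DifferentiableOn ℂ H (Metric.ball 0 ρ) → (∀ z ∈ Metric.ball (0 : ℂ) ρ, ‖H z‖ ≤ M) →
      (∀ j : ℕ, j ≤ K → ‖H ((j * (η * ρ / (4 * (K + 1))) : ℝ) : ℂ)‖ ≤ ε) →
      ‖deriv H 0‖ ≤ C * (ε / (η * ρ) + M * η ^ K / ρ) := by
  obtain ⟨w, hw⟩ := exists_derivative_weights K
  refine ⟨4 * (K + 1) * (∑ j ∈ Finset.range (K + 1), ‖w j‖ + 1), by positivity, ?_⟩
  intro H ρ M ε η hρ hη hη1 hH hM hε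
  have hM0 : 0 ≤ M := (norm_nonneg _).trans (hM 0 (by simpa using hρ))
  have hε0 : 0 ≤ ε := (norm_nonneg _).trans (hε 0 (Nat.zero_le _))
  set s : ℝ := η * ρ / (4 * (K + 1)) with hs
  have hs0 : 0 < s := by positivity
  set c : ℕ → ℂ := fun k => (k.factorial : ℂ)⁻¹ * iteratedDeriv k H 0 with hc
  -- The Taylor polynomial in the variable `z / s`: the nodes become the integers `0, …, K`, so the
  -- weights depend on `K` alone, and its derivative at `0` is `s` times that of `H`.
  set p : Polynomial ℂ := ∑ k ∈ Finset.range (K + 1), Polynomial.C (c k * (s : ℂ) ^ k) *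
    Polynomial.X ^ k with hp
  have hpdeg : p.natDegree ≤ K := by
    refine Polynomial.natDegree_sum_le_of_forall_le _ _ fun k hk => ?_
    refine (Polynomial.natDegree_C_mul_X_pow_le _ _).trans ?_
    exact Nat.lt_succ_iff.1 (Finset.mem_range.1 hk)
  have hpder : p.derivative.eval 0 = c 1 * s := by
    rw [← Polynomial.coeff_zero_eq_eval_zero, Polynomial.coeff_derivative, hp,
      Polynomial.finsetSum_coeff]
    simp only [Polynomial.coeff_C_mul_X_pow]
    rw [Finset.sum_eq_single 1]
    · simp
    · intro b _ hb
      rw [if_neg (by omega)]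
    · intro h
      exact absurd (Finset.mem_range.2 (by omega)) h
  have hpev : ∀ j : ℕ, j ≤ K → ‖p.eval (j : ℂ)‖ ≤ ε + M * η ^ (K + 1) := by
    intro j hj
    have hj' : (j : ℝ) ≤ K + 1 := by exact_mod_cast hj.trans (Nat.le_succ K)
    have hz : ‖((j * s : ℝ) : ℂ)‖ ≤ η * ρ / 4 := by
      rw [Complex.norm_real, Real.norm_of_nonneg (by positivity), hs]
      calc (j : ℝ) * (η * ρ / (4 * (K + 1))) ≤ (K + 1) * (η * ρ / (4 * (K + 1))) := by gcongr
        _ = η * ρ / 4 := by field_simp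
    have h1 := norm_sub_taylor_le hρ hH hM K hη hη1 hz
    have h2 : p.eval (j : ℂ) = ∑ k ∈ Finset.range (K + 1), c k * ((j * s : ℝ) : ℂ) ^ k := by
      rw [hp, Polynomial.eval_finsetSum]
      refine Finset.sum_congr rfl fun k _ => ?_
      simp only [Polynomial.eval_mul, Polynomial.eval_C, Polynomial.eval_pow, Polynomial.eval_X]
      push_cast
      ring
    rw [h2]
    calc _ ≤ ‖H ((j * s : ℝ) : ℂ)‖ + ‖H ((j * s : ℝ) : ℂ)
          - ∑ k ∈ Finset.range (K + 1), c k * ((j * s : ℝ) : ℂ) ^ k‖ := norm_le_norm_add_norm_sub _ _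
      _ ≤ _ := add_le_add (hε j hj) h1
  have hc1 : c 1 = deriv H 0 := by simp [hc]
  have hmain : ‖deriv H 0‖ * s ≤ (∑ j ∈ Finset.range (K + 1), ‖w j‖) * (ε + M * η ^ (K + 1)) := by
    have : ‖deriv H 0‖ * s = ‖p.derivative.eval 0‖ := by
      rw [hpder, hc1, norm_mul, Complex.norm_real, Real.norm_of_nonneg hs0.le]
    rw [this, hw p hpdeg, Finset.sum_mul]
    refine (norm_sum_le _ _).trans (Finset.sum_le_sum fun j hj => ?_)
    rw [norm_mul]
    gcongr
    exact hpev j (Nat.lt_succ_iff.1 (Finset.mem_range.1 hj))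
  have hW : 0 ≤ ∑ j ∈ Finset.range (K + 1), ‖w j‖ := Finset.sum_nonneg fun _ _ => norm_nonneg _
  have hfac : ‖deriv H 0‖ = ‖deriv H 0‖ * s * (4 * (K + 1) / (η * ρ)) := by
    rw [hs]
    field_simp
  rw [hfac]
  calc ‖deriv H 0‖ * s * (4 * (K + 1) / (η * ρ))
      ≤ ((∑ j ∈ Finset.range (K + 1), ‖w j‖ + 1) * (ε + M * η ^ (K + 1))) *
          (4 * (K + 1) / (η * ρ)) := by
        refine mul_le_mul_of_nonneg_right (hmain.trans ?_) (by positivity)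
        exact mul_le_mul_of_nonneg_right (by linarith) (by positivity)
    _ = _ := by
        field_simp
        ring

/-! ### Resolvent sums -/

/-- The function `z ↦ ∑ᵢ qᵢ / (1 + z yᵢ)`. -/
noncomputable def resolventSum {n : ℕ} (q y : Fin n → ℝ) (z : ℂ) : ℂ := ∑ i, (q i : ℂ) / (1 + z * y i)

/-- The function `l ↦ ∑ᵢ rᵢ l / (l + sᵢ)`. -/
noncomputable def shrinkageSum {n : ℕ} (r s : Fin n → ℝ) (l : ℂ) : ℂ := ∑ i, (r i : ℂ) * l / (l + s i)

theorem resolventSum_ofReal {n : ℕ} (q y : Fin n → ℝ) (t : ℝ) :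
    resolventSum q y t = ((∑ i, q i / (1 + t * y i) : ℝ) : ℂ) := by
  simp [resolventSum]

theorem shrinkageSum_ofReal {n : ℕ} (r s : Fin n → ℝ) (l : ℝ) :
    shrinkageSum r s l = ((∑ i, r i * l / (l + s i) : ℝ) : ℂ) := by
  simp [shrinkageSum]

section resolvent

variable {n : ℕ} {q y : Fin n → ℝ} {a : ℝ} {z : ℂ}

theorem norm_one_add_mul_ge {x : ℝ} (hx : 0 ≤ x) (hxa : x ≤ a) (hz : ‖z‖ * a ≤ 1 / 16) :
    15 / 16 ≤ ‖1 + z * x‖ := by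
  have h1 : ‖z * (x : ℂ)‖ ≤ 1 / 16 := by
    rw [norm_mul, Complex.norm_real, Real.norm_of_nonneg hx]
    exact (mul_le_mul_of_nonneg_left hxa (norm_nonneg _)).trans hz
  have h2 := norm_sub_norm_le (1 : ℂ) (-(z * x))
  rw [norm_neg, norm_one, sub_neg_eq_add] at h2
  linarith

theorem norm_resolventSum_sub_le (hq : ∀ i, 0 ≤ q i) (hy : ∀ i, 0 ≤ y i) (hya : ∀ i, y i ≤ a)
    (hz : ‖z‖ * a ≤ 1 / 16) :
    ‖resolventSum q y z - resolventSum q y 0‖ ≤ 16 / 15 * ‖z‖ * ∑ i, q i * y i := by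
  rw [resolventSum, resolventSum, ← Finset.sum_sub_distrib, Finset.mul_sum]
  refine (norm_sum_le _ _).trans (Finset.sum_le_sum fun i _ => ?_)
  have h1 := norm_one_add_mul_ge (hy i) (hya i) hz
  have h0 : (1 + z * (y i : ℂ)) ≠ 0 := by
    rw [← norm_pos_iff]
    linarith
  have e : (q i : ℂ) / (1 + z * y i) - (q i : ℂ) / (1 + 0 * y i)
      = -(z * ((q i * y i : ℝ) : ℂ)) / (1 + z * y i) := by
    push_cast
    field_simp
    ring
  rw [e, norm_div, norm_neg, norm_mul, Complex.norm_real,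
    Real.norm_of_nonneg (mul_nonneg (hq i) (hy i)), div_le_iff₀ (by linarith)]
  have h2 : 0 ≤ ‖z‖ * (q i * y i) := mul_nonneg (norm_nonneg _) (mul_nonneg (hq i) (hy i))
  nlinarith

theorem hasDerivAt_resolventSum (hy : ∀ i, 0 ≤ y i) (hya : ∀ i, y i ≤ a)
    (hz : ‖z‖ * a ≤ 1 / 16) :
    HasDerivAt (resolventSum q y) (∑ i, -((q i : ℂ) * y i) / (1 + z * y i) ^ 2) z := by
  unfold resolventSum
  refine HasDerivAt.fun_sum fun i _ => ?_
  have h1 := norm_one_add_mul_ge (hy i) (hya i) hz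
  have h0 : (1 + z * (y i : ℂ)) ≠ 0 := by
    rw [← norm_pos_iff]
    linarith
  have h2 : HasDerivAt (fun z : ℂ => 1 + z * y i) (y i : ℂ) z := by
    simpa using ((hasDerivAt_id z).mul_const (y i : ℂ)).const_add 1
  exact ((hasDerivAt_const z (q i : ℂ)).fun_div h2 h0).congr_deriv (by ring)

end resolvent

section shrinkage

variable {n : ℕ} {r s : Fin n → ℝ} {lam : ℝ} {l l' : ℂ}

theorem norm_add_ge_half {x : ℝ} (hlam : 0 < lam) (hx : 0 ≤ x) (hl : ‖l - lam‖ ≤ lam / 2) :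
    (lam + x) / 2 ≤ ‖l + x‖ := by
  have h2 := norm_sub_norm_le ((lam : ℂ) + x) (lam - l)
  have h3 : ‖(lam : ℂ) + x‖ = lam + x := by
    rw [← Complex.ofReal_add, Complex.norm_real, Real.norm_of_nonneg (by linarith)]
  have h4 : (lam : ℂ) + x - (lam - l) = l + x := by ring
  rw [h3, h4, norm_sub_rev] at h2
  linarith

/-- Each difference equals `(l - l') r s / ((l + s)(l' + s))`, and both denominators have modulus at
least `(lam + s) / 2`. The sum on the right is the derivative at `lam`, so the slope at the centre
controls the path on the whole disc. -/
theorem norm_shrinkageSum_sub_le (hlam : 0 < lam) (hr : ∀ i, 0 ≤ r i) (hs : ∀ i, 0 ≤ s i)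
    (hl : ‖l - lam‖ ≤ lam / 2) (hl' : ‖l' - lam‖ ≤ lam / 2) :
    ‖shrinkageSum r s l - shrinkageSum r s l'‖
      ≤ 4 * ‖l - l'‖ * ∑ i, r i * s i / (lam + s i) ^ 2 := by
  rw [shrinkageSum, shrinkageSum, ← Finset.sum_sub_distrib, Finset.mul_sum]
  refine (norm_sum_le _ _).trans (Finset.sum_le_sum fun i _ => ?_)
  have h1 := norm_add_ge_half hlam (hs i) hl
  have h1' := norm_add_ge_half hlam (hs i) hl'
  have hsi := hs i
  have hp : 0 < (lam + s i) / 2 := by linarith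
  have h0 : l + (s i : ℂ) ≠ 0 := by
    rw [← norm_pos_iff]
    linarith
  have h0' : l' + (s i : ℂ) ≠ 0 := by
    rw [← norm_pos_iff]
    linarith
  have e : (r i : ℂ) * l / (l + s i) - (r i : ℂ) * l' / (l' + s i)
      = (l - l') * ((r i * s i : ℝ) : ℂ) / ((l + s i) * (l' + s i)) := by
    push_cast
    field_simp
    ring
  have h2 : 0 ≤ r i * s i := mul_nonneg (hr i) (hs i)
  rw [e, norm_div, norm_mul, norm_mul, Complex.norm_real, Real.norm_of_nonneg h2]
  calc ‖l - l'‖ * (r i * s i) / (‖l + s i‖ * ‖l' + s i‖)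
      ≤ ‖l - l'‖ * (r i * s i) / ((lam + s i) / 2 * ((lam + s i) / 2)) := by gcongr
    _ = _ := by
      field_simp
      norm_num

theorem hasDerivAt_shrinkageSum (hlam : 0 < lam) (hs : ∀ i, 0 ≤ s i) (hl : ‖l - lam‖ ≤ lam / 2) :
    HasDerivAt (shrinkageSum r s) (∑ i, (r i : ℂ) * s i / (l + s i) ^ 2) l := by
  unfold shrinkageSum
  refine HasDerivAt.fun_sum fun i _ => ?_
  have h1 := norm_add_ge_half hlam (hs i) hl
  have hsi := hs i
  have h0 : l + (s i : ℂ) ≠ 0 := by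
    rw [← norm_pos_iff]
    linarith
  have h2 : HasDerivAt (fun z : ℂ => z + s i) 1 l := (hasDerivAt_id l).add_const _
  have h3 : HasDerivAt (fun z : ℂ => (r i : ℂ) * z) (r i) l := by
    simpa using (hasDerivAt_id l).const_mul (r i : ℂ)
  exact (h3.fun_div h2 h0).congr_deriv (by ring)

end shrinkage

/-! ### Ridge profiles -/

/-- The scalar functions of a ridge regression problem with regularization `lam` on one sample:
`q, y` describe the perturbed bias `t ↦ ∑ qᵢ / (1 + t yᵢ)`, `c₀, d, y` the perturbed Stieltjes
transform `t ↦ c₀ - ∑ dᵢ / (1 + t yᵢ)`, and `r, s` the regularization path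
`l ↦ ∑ rᵢ l / (l + sᵢ)`. -/
structure RidgeProfile (n : ℕ) where
  (q y d r s : Fin n → ℝ)
  (c₀ a lam : ℝ)
  a_pos : 0 < a
  lam_pos : 0 < lam
  q_nonneg : ∀ i, 0 ≤ q i
  y_nonneg : ∀ i, 0 ≤ y i
  y_le : ∀ i, y i ≤ a
  d_nonneg : ∀ i, 0 ≤ d i
  r_nonneg : ∀ i, 0 ≤ r i
  s_nonneg : ∀ i, 0 ≤ s i
  -- Positivity on a whole interval of `t`, not only at `0`, is what bounds the derivative of the
  -- Stieltjes transform in `sum_d_mul_y_le`.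
  stieltjes_pos' : ∀ t : ℝ, |t| * a < 1 / 2 → 0 < c₀ - ∑ i, d i / (1 + t * y i)
  lam_mul_stieltjes_le' : lam * (c₀ - ∑ i, d i / (1 + 0 * y i)) ≤ 1
  bias_zero' : ∑ i, q i / (1 + 0 * y i) = ∑ i, r i * lam / (lam + s i)

namespace RidgeProfile

variable {n : ℕ} (p : RidgeProfile n)

/-- The perturbed bias. -/
noncomputable def bias (t : ℝ) : ℝ := ∑ i, p.q i / (1 + t * p.y i)

/-- The perturbed Stieltjes transform. -/
noncomputable def stieltjes (t : ℝ) : ℝ := p.c₀ - ∑ i, p.d i / (1 + t * p.y i)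

/-- The regularization path. -/
noncomputable def path (l : ℝ) : ℝ := ∑ i, p.r i * l / (l + p.s i)

/-- The derivative of the regularization path at `lam`. -/
noncomputable def slope : ℝ := ∑ i, p.r i * p.s i / (p.lam + p.s i) ^ 2

/-- The generalization risk. -/
noncomputable def risk : ℝ := ∑ i, p.q i * p.y i

/-- The generalized cross-validation estimator. -/
noncomputable def gcv : ℝ := p.slope / p.stieltjes 0 ^ 2

theorem stieltjes_pos {t : ℝ} (ht : |t| * p.a < 1 / 2) : 0 < p.stieltjes t :=
  p.stieltjes_pos' t ht

theorem stieltjes_zero_pos : 0 < p.stieltjes 0 := p.stieltjes_pos (by simp)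

theorem lam_mul_stieltjes_le : p.lam * p.stieltjes 0 ≤ 1 := p.lam_mul_stieltjes_le'

theorem bias_zero : p.bias 0 = p.path p.lam := p.bias_zero'

theorem slope_nonneg : 0 ≤ p.slope :=
  Finset.sum_nonneg fun i _ => div_nonneg (mul_nonneg (p.r_nonneg i) (p.s_nonneg i)) (sq_nonneg _)

theorem risk_nonneg : 0 ≤ p.risk :=
  Finset.sum_nonneg fun i _ => mul_nonneg (p.q_nonneg i) (p.y_nonneg i)

/-- Write `m` for `stieltjes`. Since `1 / (1 - x y) - 1 ≥ x y`, one has `x ∑ d y ≤ m(0) - m(-x) <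
m(0)` for `0 < x < 1 / (2a)`, and `x` may tend to the endpoint. Thus the derivative of `m` at `0` is
controlled by its value there. -/
theorem sum_d_mul_y_le : ∑ i, p.d i * p.y i ≤ 2 * p.a * p.stieltjes 0 := by
  have ha := p.a_pos
  have key : ∀ x : ℝ, 0 < x → x * p.a < 1 / 2 → x * ∑ i, p.d i * p.y i ≤ p.stieltjes 0 := by
    intro x hx hxa
    have h := p.stieltjes_pos (t := -x) (by rwa [abs_neg, abs_of_pos hx])
    have h2 : x * ∑ i, p.d i * p.y i ≤ p.stieltjes 0 - p.stieltjes (-x) := by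
      simp only [stieltjes, sub_sub_sub_cancel_left]
      rw [← Finset.sum_sub_distrib, Finset.mul_sum]
      refine Finset.sum_le_sum fun i _ => ?_
      have hxy : x * p.y i ≤ 1 / 2 := (mul_le_mul_of_nonneg_left (p.y_le i) hx.le).trans hxa.le
      have hxy0 : 0 ≤ x * p.y i := mul_nonneg hx.le (p.y_nonneg i)
      have hpos : 0 < 1 - x * p.y i := by linarith
      have hd := p.d_nonneg i
      have e : p.d i / (1 + -x * p.y i) - p.d i / (1 + 0 * p.y i)
          = p.d i * (x * p.y i) / (1 - x * p.y i) := by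
        have : (1 + -x * p.y i) = 1 - x * p.y i := by ring
        rw [this]
        field_simp
        ring
      rw [e, le_div_iff₀ hpos]
      have : 0 ≤ p.d i * (x * p.y i) := mul_nonneg hd hxy0
      nlinarith
    linarith
  have hlim : Tendsto (fun x : ℝ => x * ∑ i, p.d i * p.y i) (𝓝[<] (1 / (2 * p.a)))
      (𝓝 (1 / (2 * p.a) * ∑ i, p.d i * p.y i)) :=
    ((continuous_id.mul continuous_const).tendsto _).mono_left nhdsWithin_le_nhds
  have hle : 1 / (2 * p.a) * ∑ i, p.d i * p.y i ≤ p.stieltjes 0 := by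
    refine le_of_tendsto hlim ?_
    filter_upwards [Ioo_mem_nhdsLT (show (0 : ℝ) < 1 / (2 * p.a) by positivity)] with x hx
    refine key x hx.1 ?_
    have := hx.2
    rw [lt_div_iff₀ (by positivity)] at this
    linarith
  rw [div_mul_eq_mul_div, one_mul, div_le_iff₀ (by positivity)] at hle
  linarith

/-- The perturbed Stieltjes transform at complex arguments. -/
noncomputable def cStieltjes (z : ℂ) : ℂ := p.c₀ - resolventSum p.d p.y z

theorem cStieltjes_ofReal (t : ℝ) : p.cStieltjes t = p.stieltjes t := by
  simp [cStieltjes, stieltjes, resolventSum_ofReal]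

theorem norm_cStieltjes_sub_le {z : ℂ} (hz : ‖z‖ * p.a ≤ 1 / 16) :
    ‖p.cStieltjes z - p.stieltjes 0‖ ≤ 2 / 15 * p.stieltjes 0 := by
  have h1 := norm_resolventSum_sub_le p.d_nonneg p.y_nonneg p.y_le hz
  have h2 := p.sum_d_mul_y_le
  have h3 := p.stieltjes_zero_pos
  have e : p.cStieltjes z - p.stieltjes 0 = -(resolventSum p.d p.y z - resolventSum p.d p.y 0) := by
    rw [← cStieltjes_ofReal]
    simp only [cStieltjes, Complex.ofReal_zero]
    ring
  rw [e, norm_neg]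
  calc _ ≤ 16 / 15 * ‖z‖ * (2 * p.a * p.stieltjes 0) := h1.trans (by gcongr)
    _ = 32 / 15 * (‖z‖ * p.a) * p.stieltjes 0 := by ring
    _ ≤ 32 / 15 * (1 / 16) * p.stieltjes 0 := by gcongr
    _ = _ := by ring

/-- The regularization that corresponds to the perturbation `z`. -/
noncomputable def cShift (z : ℂ) : ℂ := p.lam - z / (p.cStieltjes z * (z + p.cStieltjes z))

/-- The discrepancy between the perturbed bias and the regularization path. -/
noncomputable def discrepancy (z : ℂ) : ℂ :=
  resolventSum p.q p.y z - shrinkageSum p.r p.s (p.cShift z)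

/-! ### The holomorphic discrepancy on a complex disc. -/

section disc

variable {p} {ρ : ℝ} {z : ℂ}

/-- Keeps both factors in the denominator of `cShift` away from zero. The first has modulus at least
`13/15` of `stieltjes 0`; as `lam * stieltjes 0 ≤ 1`, adding `z` costs at most a further `1/16`. -/
theorem cStieltjes_bounds (hρa : ρ * p.a ≤ 1 / 16) (hρl : ρ ≤ p.lam * p.stieltjes 0 ^ 2 / 16)
    (hz : ‖z‖ ≤ ρ) :
    4 / 5 * p.stieltjes 0 ≤ ‖p.cStieltjes z‖ ∧ 4 / 5 * p.stieltjes 0 ≤ ‖z + p.cStieltjes z‖ := by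
  have h3 := p.stieltjes_zero_pos
  have h1 := p.norm_cStieltjes_sub_le ((mul_le_mul_of_nonneg_right hz p.a_pos.le).trans hρa)
  have h4 : ‖z‖ ≤ p.stieltjes 0 / 16 := by
    have := p.lam_mul_stieltjes_le
    nlinarith
  have h5 : ‖(p.stieltjes 0 : ℂ)‖ = p.stieltjes 0 := by
    rw [Complex.norm_real, Real.norm_of_nonneg h3.le]
  have h6 : 13 / 15 * p.stieltjes 0 ≤ ‖p.cStieltjes z‖ := by
    have := norm_sub_norm_le (p.stieltjes 0 : ℂ) (p.cStieltjes z)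
    rw [norm_sub_rev, h5] at this
    linarith
  refine ⟨by linarith, ?_⟩
  have := norm_sub_norm_le (p.cStieltjes z) (-z)
  rw [norm_neg, sub_neg_eq_add, add_comm (p.cStieltjes z)] at this
  linarith

theorem norm_cShift_sub_le (hρa : ρ * p.a ≤ 1 / 16) (hρl : ρ ≤ p.lam * p.stieltjes 0 ^ 2 / 16)
    (hz : ‖z‖ ≤ ρ) :
    ‖p.cShift z - p.lam‖ ≤ 2 * ρ / p.stieltjes 0 ^ 2 ∧ ‖p.cShift z - p.lam‖ ≤ p.lam / 2 := by
  obtain ⟨h1, h2⟩ := cStieltjes_bounds hρa hρl hz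
  have h3 := p.stieltjes_zero_pos
  have h0 : ‖p.cShift z - p.lam‖ ≤ 2 * ρ / p.stieltjes 0 ^ 2 := by
    have e : p.cShift z - p.lam = -(z / (p.cStieltjes z * (z + p.cStieltjes z))) := by
      rw [cShift]
      ring
    rw [e, norm_neg, norm_div, norm_mul]
    have hρ : 0 ≤ ρ := (norm_nonneg _).trans hz
    calc ‖z‖ / (‖p.cStieltjes z‖ * ‖z + p.cStieltjes z‖)
        ≤ ρ / (4 / 5 * p.stieltjes 0 * (4 / 5 * p.stieltjes 0)) := by gcongr
      _ = 25 / 16 * (ρ / p.stieltjes 0 ^ 2) := by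
        field_simp
        ring
      _ ≤ 2 * (ρ / p.stieltjes 0 ^ 2) := by
        gcongr
        norm_num
      _ = _ := by ring
  refine ⟨h0, h0.trans ?_⟩
  rw [div_le_iff₀ (by positivity)]
  have := p.lam_pos
  have : 0 < p.lam * p.stieltjes 0 ^ 2 := by positivity
  linarith

theorem differentiableAt_cShift (hρa : ρ * p.a ≤ 1 / 16)
    (hρl : ρ ≤ p.lam * p.stieltjes 0 ^ 2 / 16) (hz : ‖z‖ ≤ ρ) :
    DifferentiableAt ℂ p.cStieltjes z ∧ DifferentiableAt ℂ p.cShift z := by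
  obtain ⟨h1, h2⟩ := cStieltjes_bounds hρa hρl hz
  have h3 := p.stieltjes_zero_pos
  have hd : DifferentiableAt ℂ p.cStieltjes z :=
    (hasDerivAt_resolventSum p.y_nonneg p.y_le
      ((mul_le_mul_of_nonneg_right hz p.a_pos.le).trans hρa)).differentiableAt.const_sub _
  refine ⟨hd, ?_⟩
  have h0 : p.cStieltjes z * (z + p.cStieltjes z) ≠ 0 := by
    refine mul_ne_zero ?_ ?_ <;> rw [← norm_pos_iff] <;> linarith
  exact (differentiableAt_id.div (hd.mul (differentiableAt_id.add hd)) h0).const_sub _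

theorem differentiableOn_discrepancy (hρa : ρ * p.a ≤ 1 / 16)
    (hρl : ρ ≤ p.lam * p.stieltjes 0 ^ 2 / 16) :
    DifferentiableOn ℂ p.discrepancy (Metric.ball 0 ρ) := by
  intro z hz
  rw [mem_ball_zero_iff] at hz
  refine DifferentiableAt.differentiableWithinAt (DifferentiableAt.sub ?_ ?_)
  · exact (hasDerivAt_resolventSum p.y_nonneg p.y_le
      ((mul_le_mul_of_nonneg_right hz.le p.a_pos.le).trans hρa)).differentiableAt
  · exact DifferentiableAt.comp (g := shrinkageSum p.r p.s) z (hasDerivAt_shrinkageSum p.lam_pos p.s_nonneg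
      (norm_cShift_sub_le hρa hρl hz.le).2).differentiableAt
      (differentiableAt_cShift hρa hρl hz.le).2

/-- The discrepancy vanishes at `0` by `bias_zero`, so Lipschitz bounds produce a factor `ρ`. It
cancels the `1 / ρ` of numerical differentiation. -/
theorem norm_discrepancy_le (hρa : ρ * p.a ≤ 1 / 16)
    (hρl : ρ ≤ p.lam * p.stieltjes 0 ^ 2 / 16) (hz : ‖z‖ ≤ ρ) :
    ‖p.discrepancy z‖ ≤ 8 * ρ * (p.risk + p.gcv) := by
  have hlam := p.lam_pos
  have hρ : 0 ≤ ρ := (norm_nonneg _).trans hz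
  obtain ⟨h1, h2⟩ := norm_cShift_sub_le hρa hρl hz
  have h3 := norm_resolventSum_sub_le p.q_nonneg p.y_nonneg p.y_le
    ((mul_le_mul_of_nonneg_right hz p.a_pos.le).trans hρa)
  have h4 := norm_shrinkageSum_sub_le hlam p.r_nonneg p.s_nonneg h2
    (show ‖(p.lam : ℂ) - p.lam‖ ≤ p.lam / 2 by simpa using (half_pos hlam).le)
  have h5 : resolventSum p.q p.y 0 = shrinkageSum p.r p.s p.lam := by
    have := p.bias_zero
    rw [bias, path] at this
    rw [shrinkageSum_ofReal, ← this, ← resolventSum_ofReal, Complex.ofReal_zero]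
  have e : p.discrepancy z = (resolventSum p.q p.y z - resolventSum p.q p.y 0)
      - (shrinkageSum p.r p.s (p.cShift z) - shrinkageSum p.r p.s p.lam) := by
    rw [discrepancy, h5]
    ring
  have hr := p.risk_nonneg
  have hsl := p.slope_nonneg
  have hst := p.stieltjes_zero_pos
  rw [e]
  refine (norm_sub_le _ _).trans ?_
  have h6 : 16 / 15 * ‖z‖ * ∑ i, p.q i * p.y i ≤ 8 * ρ * p.risk := by
    change 16 / 15 * ‖z‖ * p.risk ≤ _
    gcongr
    norm_num
  have h7 : 4 * ‖p.cShift z - p.lam‖ * ∑ i, p.r i * p.s i / (p.lam + p.s i) ^ 2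
      ≤ 8 * ρ * p.gcv := by
    change 4 * ‖p.cShift z - p.lam‖ * p.slope ≤ _
    calc _ ≤ 4 * (2 * ρ / p.stieltjes 0 ^ 2) * p.slope := by gcongr
      _ = _ := by
        rw [gcv]
        ring
  linarith

end disc

/-- The resolvent sum contributes `-risk`. The shift has derivative `-1 / stieltjes 0 ^ 2`, so by
the chain rule the path contributes `+gcv`: this is the origin of the factor in the definition of
GCV. -/
theorem deriv_discrepancy_zero : deriv p.discrepancy 0 = ((p.gcv - p.risk : ℝ) : ℂ) := by
  have h3 := p.stieltjes_zero_pos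
  have hlam := p.lam_pos
  have h0 : ‖(0 : ℂ)‖ * p.a ≤ 1 / 16 := by simp
  have hc0 : p.cStieltjes 0 = p.stieltjes 0 := by
    rw [← cStieltjes_ofReal, Complex.ofReal_zero]
  have hne : (p.stieltjes 0 : ℂ) ≠ 0 := by exact_mod_cast h3.ne'
  have hs0 : p.cShift 0 = p.lam := by simp [cShift]
  have h1 := hasDerivAt_resolventSum (q := p.q) p.y_nonneg p.y_le h0
  have h2 : HasDerivAt p.cStieltjes _ 0 :=
    (hasDerivAt_resolventSum (q := p.d) p.y_nonneg p.y_le h0).const_sub (p.c₀ : ℂ)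
  have h4 := h2.mul ((hasDerivAt_id (0 : ℂ)).add h2)
  have h5 : HasDerivAt p.cShift (-(1 / (p.stieltjes 0 : ℂ) ^ 2)) 0 := by
    have h6 : HasDerivAt p.cShift _ 0 :=
      ((hasDerivAt_id (0 : ℂ)).div h4 (by simpa [hc0] using hne)).const_sub (p.lam : ℂ)
    convert h6 using 1
    simp [hc0]
    field_simp
  have h7 := hasDerivAt_shrinkageSum (r := p.r) (l := p.cShift 0) hlam p.s_nonneg
    (by simpa [hs0] using (half_pos hlam).le)
  have h8 : HasDerivAt p.discrepancy _ 0 := h1.sub (h7.comp (0 : ℂ) h5)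
  rw [h8.deriv, hs0, gcv, risk, slope]
  push_cast
  simp
  ring

theorem bias_sub_path_eq_discrepancy {t : ℝ} :
    p.discrepancy t = ((p.bias t -
      p.path (p.lam - t / (p.stieltjes t * (t + p.stieltjes t))) : ℝ) : ℂ) := by
  have : p.cShift t = ((p.lam - t / (p.stieltjes t * (t + p.stieltjes t)) : ℝ) : ℂ) := by
    rw [cShift, cStieltjes_ofReal]
    push_cast
    rfl
  rw [discrepancy, this, resolventSum_ofReal, shrinkageSum_ofReal, bias, path]
  push_cast
  rfl

end RidgeProfile

/-! ### Deterministic error bounds from the local law. -/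

namespace RidgeProfile

variable {n : ℕ} (p : RidgeProfile n)

/-- The estimates provided by a local law at the perturbation `t`: `u` is the population
counterpart of the Stieltjes transform, of the order of `u₀`, and `g` that of the bias; `B` is the
signal strength. -/
def LawAt (u₀ e₁ e₂ B t : ℝ) : Prop :=
  ∃ u g : ℝ, u₀ / 2 ≤ u ∧ u ≤ 2 * u₀ ∧ |u - p.stieltjes t| ≤ e₁ ∧ |g - p.bias t| ≤ e₂ ∧
    |g - p.path (p.lam - t / (u * (t + u)))| ≤ e₂ ∧
    ∑ i, p.r i - (t + u) * B ≤ g ∧ g ≤ ∑ i, p.r i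

variable {p} {u₀ e₁ e₂ B ρ t : ℝ}

theorem abs_path_sub_path_le {l l' : ℝ} (hl : |l - p.lam| ≤ p.lam / 2)
    (hl' : |l' - p.lam| ≤ p.lam / 2) : |p.path l - p.path l'| ≤ 4 * |l - l'| * p.slope := by
  have := norm_shrinkageSum_sub_le (r := p.r) (l := (l : ℂ)) (l' := (l' : ℂ)) p.lam_pos p.r_nonneg
    p.s_nonneg (by rwa [← Complex.ofReal_sub, Complex.norm_real])
    (by rwa [← Complex.ofReal_sub, Complex.norm_real])
  rw [shrinkageSum_ofReal, shrinkageSum_ofReal, ← Complex.ofReal_sub, ← Complex.ofReal_sub,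
    Complex.norm_real, Complex.norm_real] at this
  exact this

/-- The bias and the path at the shift built from `u` are both close to `g`. It remains to exchange
`u` for `stieltjes t` in the shift, which moves it by at most `150 * ρ * e₁ / u₀ ^ 3`, and to apply
the Lipschitz bound for the path. -/
theorem abs_discrepancy_le (hu₀ : 0 < u₀) (hlu : p.lam * u₀ ≤ 1) (he : e₁ ≤ u₀ / 8)
    (h0 : |u₀ - p.stieltjes 0| ≤ e₁) (hρl : ρ ≤ p.lam * u₀ ^ 2 / 32)
    (ht : |t| ≤ ρ) (hlaw : p.LawAt u₀ e₁ e₂ B t) :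
    ‖p.discrepancy t‖ ≤ 2 * e₂ + 600 * ρ * (p.slope * e₁ / u₀ ^ 3) := by
  obtain ⟨u, g, hu1, hu2, hs, hf, hh, -, -⟩ := hlaw
  have hlam := p.lam_pos
  have hρ : 0 ≤ ρ := (abs_nonneg t).trans ht
  have he0 : 0 ≤ e₁ := (abs_nonneg _).trans hs
  have hsl := p.slope_nonneg
  set v := p.stieltjes t with hv
  have h00 := abs_le.1 h0
  have htu : |t| ≤ u₀ / 32 := by nlinarith
  have htt := abs_le.1 htu
  have hss := abs_le.1 hs
  have hv1 : 3 / 8 * u₀ ≤ v := by linarith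
  have hv2 : 11 / 32 * u₀ ≤ t + v := by linarith
  have hv3 : 15 / 32 * u₀ ≤ t + u := by linarith
  have hvp : 0 < v := by linarith
  have htv : 0 < t + v := by linarith
  have hup : 0 < u := by linarith
  have htup : 0 < t + u := by linarith
  have hlt : |p.lam - t / (u * (t + u)) - p.lam| ≤ p.lam / 2 := by
    rw [sub_sub_cancel_left, abs_neg, abs_div, abs_of_pos (mul_pos hup htup)]
    rw [div_le_iff₀ (by positivity)]
    have : u₀ / 2 * (15 / 32 * u₀) ≤ u * (t + u) := by gcongr
    nlinarith
  have hlt' : |p.lam - t / (v * (t + v)) - p.lam| ≤ p.lam / 2 := by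
    rw [sub_sub_cancel_left, abs_neg, abs_div, abs_of_pos (mul_pos hvp htv)]
    rw [div_le_iff₀ (by positivity)]
    have : 3 / 8 * u₀ * (11 / 32 * u₀) ≤ v * (t + v) := by gcongr
    nlinarith
  have hdiff : |p.lam - t / (u * (t + u)) - (p.lam - t / (v * (t + v)))| ≤
      150 * ρ * (e₁ / u₀ ^ 3) := by
    have e : p.lam - t / (u * (t + u)) - (p.lam - t / (v * (t + v)))
        = t * ((u - v) * (t + u + v)) / (u * (t + u) * (v * (t + v))) := by
      field_simp
      ring
    rw [e, abs_div, abs_mul, abs_mul, abs_of_pos (show 0 < t + u + v by linarith),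
      abs_of_pos (show 0 < u * (t + u) * (v * (t + v)) by positivity)]
    have hnum : t + u + v ≤ 9 / 2 * u₀ := by linarith
    calc |t| * (|u - v| * (t + u + v)) / (u * (t + u) * (v * (t + v)))
        ≤ ρ * (e₁ * (9 / 2 * u₀)) /
          (u₀ / 2 * (15 / 32 * u₀) * (3 / 8 * u₀ * (11 / 32 * u₀))) := by gcongr
      _ = 9 / 2 * 32 * 32 * 8 * 2 / (15 * 3 * 11) * (ρ * (e₁ / u₀ ^ 3)) := by
        field_simp
      _ ≤ 150 * (ρ * (e₁ / u₀ ^ 3)) := by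
        gcongr
        norm_num
      _ = _ := by ring
  rw [bias_sub_path_eq_discrepancy, Complex.norm_real, Real.norm_eq_abs, ← hv]
  have h1 := abs_path_sub_path_le hlt hlt'
  have h2 : 4 * |p.lam - t / (u * (t + u)) - (p.lam - t / (v * (t + v)))| * p.slope
      ≤ 600 * ρ * (p.slope * e₁ / u₀ ^ 3) := by
    calc _ ≤ 4 * (150 * ρ * (e₁ / u₀ ^ 3)) * p.slope := by gcongr
      _ = _ := by ring
  have h3 := abs_le.1 (h1.trans h2)
  have h4 := abs_le.1 hf
  have h5 := abs_le.1 hh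
  exact abs_le.2 ⟨by linarith, by linarith⟩

/-- When the relative error of the local law is small, the estimates at `K + 1` perturbations
control the difference between the generalized cross-validation estimator and the risk. -/
theorem exists_abs_gcv_sub_risk_le (K : ℕ) (hK : 1 ≤ K) : ∃ C : ℝ, 0 < C ∧
    ∀ {n : ℕ} (p : RidgeProfile n) (u₀ e₁ e₂ B ρ η : ℝ), 0 < u₀ → p.lam * u₀ ≤ 1 → e₁ ≤ u₀ / 8 →
      |u₀ - p.stieltjes 0| ≤ e₁ → 0 < ρ → ρ * p.a ≤ 1 / 32 → ρ ≤ p.lam * u₀ ^ 2 / 32 →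
      0 < η → η ≤ 1 →
      (∀ j : ℕ, j ≤ K → p.LawAt u₀ e₁ e₂ B (j * (η * ρ / (4 * (K + 1))))) →
      |p.gcv - p.risk| ≤
        C * ((e₂ / ρ + p.slope * e₁ / u₀ ^ 3) / η + η ^ K * (p.risk + p.gcv)) := by
  obtain ⟨C, hC, h⟩ := exists_norm_deriv_le K hK
  refine ⟨600 * C, by positivity, ?_⟩
  intro n p u₀ e₁ e₂ B ρ η hu₀ hlu he h0 hρ hρa hρl hη hη1 hlaw
  have hlam := p.lam_pos
  have he0 : 0 ≤ e₁ := (abs_nonneg _).trans h0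
  have he2 : 0 ≤ e₂ := by
    obtain ⟨u, g, -, -, -, hf, -⟩ := hlaw 0 (Nat.zero_le _)
    exact (abs_nonneg _).trans hf
  have h00 := abs_le.1 h0
  -- Since `stieltjes 0 ≥ 7/8 * u₀` and `(7/8)² / 16 ≥ 1/32`.
  have hρl' : ρ ≤ p.lam * p.stieltjes 0 ^ 2 / 16 := by
    refine hρl.trans ?_
    have h1 : 7 / 8 * u₀ ≤ p.stieltjes 0 := by linarith
    have h2 : (7 / 8 * u₀) ^ 2 ≤ p.stieltjes 0 ^ 2 := by gcongr
    nlinarith [mul_le_mul_of_nonneg_left h2 hlam.le, mul_pos hlam (sq_pos_of_pos hu₀)]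
  have hρa' : ρ * p.a ≤ 1 / 16 := by linarith
  have hrisk := p.risk_nonneg
  have hsl := p.slope_nonneg
  have hgcv : 0 ≤ p.gcv := div_nonneg hsl (sq_nonneg _)
  have key := h p.discrepancy ρ (8 * ρ * (p.risk + p.gcv))
    (2 * e₂ + 600 * ρ * (p.slope * e₁ / u₀ ^ 3)) η hρ hη hη1
    (differentiableOn_discrepancy hρa' hρl')
    (fun z hz => norm_discrepancy_le hρa' hρl' (by rw [mem_ball_zero_iff] at hz; exact hz.le))
    (fun j hj => abs_discrepancy_le hu₀ hlu he h0 hρl ?_ (hlaw j hj))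
  · rw [deriv_discrepancy_zero, Complex.norm_real, Real.norm_eq_abs] at key
    refine key.trans ?_
    rw [mul_comm 600 C, mul_assoc C 600]
    refine mul_le_mul_of_nonneg_left ?_ hC.le
    have e : (2 * e₂ + 600 * ρ * (p.slope * e₁ / u₀ ^ 3)) / (η * ρ)
        + 8 * ρ * (p.risk + p.gcv) * η ^ K / ρ
        = 2 * (e₂ / ρ / η) + 600 * (p.slope * e₁ / u₀ ^ 3 / η)
          + 8 * (η ^ K * (p.risk + p.gcv)) := by
      field_simp
    rw [e, mul_add 600, add_div, mul_add 600]
    have h1 : 0 ≤ e₂ / ρ / η := by positivity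
    have h2 : 0 ≤ η ^ K * (p.risk + p.gcv) := by positivity
    linarith
  · have hj' : (j : ℝ) ≤ K + 1 := by exact_mod_cast hj.trans (Nat.le_succ K)
    rw [abs_of_nonneg (by positivity)]
    calc (j : ℝ) * (η * ρ / (4 * (K + 1))) ≤ (K + 1) * (1 * ρ / (4 * (K + 1))) := by gcongr
      _ = ρ / 4 := by field_simp
      _ ≤ ρ := by linarith

/-- The part of the squared norm of the ground truth that the path has not shrunk. -/
theorem slope_le (p : RidgeProfile n) : p.slope ≤ (∑ i, p.r i - p.path p.lam) / p.lam := by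
  have hlam := p.lam_pos
  rw [slope, path, ← Finset.sum_sub_distrib, Finset.sum_div]
  refine Finset.sum_le_sum fun i _ => ?_
  have hr := p.r_nonneg i
  have hs := p.s_nonneg i
  have h1 : 0 < p.lam + p.s i := by linarith
  have e : (p.r i - p.r i * p.lam / (p.lam + p.s i)) / p.lam
      = p.r i * p.s i / ((p.lam + p.s i) * p.lam) := by
    field_simp
    ring
  rw [e, sq]
  have : 0 ≤ p.r i * p.s i := mul_nonneg hr hs
  gcongr
  linarith

/-- The bias is convex in `t`, so `risk = -bias'(0)` is at most the slope of the secant from `-ρ` to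
`0`. The law bounds `bias (-ρ)` above by `∑ r + e₂`, and `h0` bounds `bias 0` below. -/
theorem risk_mul_le (hρ : 0 < ρ) (hρa : ρ * p.a ≤ 1 / 32) (h1 : p.LawAt u₀ e₁ e₂ B (-ρ))
    (h0 : ∑ i, p.r i - p.path p.lam ≤ u₀ * B + e₂) : p.risk * ρ ≤ u₀ * B + 2 * e₂ := by
  obtain ⟨u, g, -, -, -, hf, -, -, hg⟩ := h1
  have h2 : p.risk * ρ ≤ p.bias (-ρ) - p.bias 0 := by
    simp only [risk, bias]
    rw [← Finset.sum_sub_distrib, Finset.sum_mul]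
    refine Finset.sum_le_sum fun i _ => ?_
    have hq := p.q_nonneg i
    have hy := p.y_nonneg i
    have hρy : ρ * p.y i ≤ 1 / 32 := (mul_le_mul_of_nonneg_left (p.y_le i) hρ.le).trans hρa
    have hρy0 : 0 ≤ ρ * p.y i := mul_nonneg hρ.le hy
    have hpos : 0 < 1 - ρ * p.y i := by linarith
    have e : p.q i / (1 + -ρ * p.y i) - p.q i / (1 + 0 * p.y i)
        = p.q i * (ρ * p.y i) / (1 - ρ * p.y i) := by
      have : (1 + -ρ * p.y i) = 1 - ρ * p.y i := by ring
      rw [this]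
      field_simp
      ring
    rw [e, le_div_iff₀ hpos]
    have : 0 ≤ p.q i * (ρ * p.y i) := mul_nonneg hq hρy0
    nlinarith
  have h3 := abs_le.1 hf
  have h4 := p.bias_zero
  linarith

/-- The scale `ρ` of the perturbations in units of `u₀`. -/
theorem div_scale_le {a lam σ X : ℝ} (ha : 0 < a) (hlam : 0 < lam) (hu₀ : 0 < u₀)
    (hlu : lam * u₀ ≤ 1) (hσ : 0 < σ) (hσ2 : σ ^ 2 * (lam * u₀) = 1) (hσX : σ ≤ X)
    (hρdef : ρ = min (lam * u₀ ^ 2) (1 / a) / 32) :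
    1 ≤ σ ∧ 0 < ρ ∧ ρ * a ≤ 1 / 32 ∧ ρ ≤ lam * u₀ ^ 2 / 32 ∧ σ ^ 2 ≤ a / lam + X ^ 3 ∧
      σ ^ 3 ≤ a / lam + X ^ 3 ∧ u₀ / ρ ≤ 32 * (a / lam + X ^ 3) ∧
      u₀ / ρ * σ ≤ 32 * (a / lam + X ^ 3) := by
  have hlup : 0 < lam * u₀ := by positivity
  have hσ1 : 1 ≤ σ := by
    by_contra hcon
    push Not at hcon
    have h1 : σ ^ 2 < 1 := pow_lt_one₀ hσ.le hcon (by norm_num)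
    have h2 : σ ^ 2 * (lam * u₀) < 1 * (lam * u₀) := mul_lt_mul_of_pos_right h1 hlup
    linarith
  have hρ : 0 < ρ := by
    rw [hρdef]
    have : 0 < min (lam * u₀ ^ 2) (1 / a) := lt_min (by positivity) (by positivity)
    positivity
  have hρa : ρ * a ≤ 1 / 32 := by
    have : min (lam * u₀ ^ 2) (1 / a) * a ≤ 1 := by
      calc _ ≤ 1 / a * a := by
            gcongr
            exact min_le_right _ _
        _ = 1 := by field_simp
    rw [hρdef]
    linarith
  have hρl : ρ ≤ lam * u₀ ^ 2 / 32 := by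
    rw [hρdef]
    gcongr
    exact min_le_left _ _
  have hal : 0 < a / lam := by positivity
  have hσ3 : σ ^ 3 ≤ X ^ 3 := by gcongr
  have hσ23 : σ ^ 2 ≤ σ ^ 3 := pow_le_pow_right₀ hσ1 (by norm_num)
  -- The two branches of the minimum give `1 / (lam * u₀) = σ ^ 2` and `a * u₀`.
  have huρ : u₀ / ρ ≤ 32 * (σ ^ 2 + a * u₀) := by
    rw [div_le_iff₀ hρ, hρdef]
    rcases min_choice (lam * u₀ ^ 2) (1 / a) with hmin | hmin <;> rw [hmin]
    · have e : 32 * (σ ^ 2 + a * u₀) * (lam * u₀ ^ 2 / 32)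
        = u₀ * (σ ^ 2 * (lam * u₀)) + a * u₀ * (lam * u₀ ^ 2) := by ring
      rw [e, hσ2]
      have : 0 < a * u₀ * (lam * u₀ ^ 2) := by positivity
      linarith
    · have e : 32 * (σ ^ 2 + a * u₀) * (1 / a / 32) = u₀ + σ ^ 2 / a := by
        field_simp
        ring
      rw [e]
      have : 0 < σ ^ 2 / a := by positivity
      linarith
  have hauσ : a * u₀ * σ ≤ a / lam := by
    have h1 : lam * u₀ * σ ≤ 1 := by
      calc lam * u₀ * σ ≤ lam * u₀ * σ ^ 2 := by
            gcongr
            exact le_self_pow₀ hσ1 (by norm_num)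
        _ = 1 := by rw [← hσ2, mul_comm]
    rw [le_div_iff₀ hlam]
    calc a * u₀ * σ * lam = a * (lam * u₀ * σ) := by ring
      _ ≤ a * 1 := by gcongr
      _ = a := mul_one a
  have huρσ : u₀ / ρ * σ ≤ 32 * (a / lam + X ^ 3) := by
    calc _ ≤ 32 * (σ ^ 2 + a * u₀) * σ := by gcongr
      _ = 32 * (σ ^ 3 + a * u₀ * σ) := by ring
      _ ≤ _ := by linarith
  refine ⟨hσ1, hρ, hρa, hρl, by linarith, by linarith, ?_, huρσ⟩
  exact (le_mul_of_one_le_right (by positivity) hσ1).trans huρσ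

/-- The deterministic estimate of the cross-validation error: `r` is the rate of the local law and
`σ ^ 2 = κ / lam`, where `κ = 1 / u₀` is the effective regularization. -/
theorem exists_abs_gcv_sub_risk_le_of_lawAt (K : ℕ) (hK : 1 ≤ K) : ∃ C : ℝ, 0 < C ∧
    ∀ {n : ℕ} (p : RidgeProfile n) (u₀ B ρ η σ X r m : ℝ), 0 < u₀ → p.lam * u₀ ≤ 1 → 0 < B →
      0 < σ → σ ^ 2 * (p.lam * u₀) = 1 → σ ≤ X → 0 < r → 0 ≤ m →
      ρ = min (p.lam * u₀ ^ 2) (1 / p.a) / 32 → 0 < η → η ≤ 1 →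
      (∀ j : ℕ, j ≤ K → p.LawAt u₀ (3 * r * u₀ * σ) (12 * B * r * u₀ * σ) B
        (j * (η * ρ / (4 * (K + 1))))) →
      p.LawAt u₀ (3 * r * u₀ * σ) (12 * B * r * u₀ * σ) B (-ρ) →
      |u₀ - p.stieltjes 0| ≤ 3 * r * u₀ * σ →
      ∑ i, p.r i - p.path p.lam ≤ u₀ * B + 12 * B * r * u₀ * σ →
      p.gcv ≤ m * (∑ i, p.r i - p.path p.lam) / p.stieltjes 0 →
      1 / p.stieltjes 0 ≤ 32 * (p.lam * X ^ 2) →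
      |p.gcv - p.risk| ≤ C * B * (r / η + η ^ K + m * r ^ 3) * (p.a / p.lam + X ^ 3) := by
  obtain ⟨C, hC, h⟩ := exists_abs_gcv_sub_risk_le K hK
  refine ⟨2000 * C + 1000000, by positivity, ?_⟩
  intro n p u₀ B ρ η σ X r m hu₀ hlu hB hσ hσ2 hσX hr hm hρdef hη hη1 hlaw hlaw' h0 hθ hgθ hst
  set e₁ := 3 * r * u₀ * σ with he₁
  set e₂ := 12 * B * r * u₀ * σ with he₂
  have ha := p.a_pos
  have hlam := p.lam_pos
  have hstp := p.stieltjes_zero_pos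
  have hsl := p.slope_nonneg
  have hrisk := p.risk_nonneg
  have hgcv : 0 ≤ p.gcv := div_nonneg hsl (sq_nonneg _)
  have he₁0 : 0 < e₁ := by positivity
  have he₂e : e₂ = 4 * B * e₁ := by
    rw [he₁, he₂]
    ring
  have hX : 0 < X := hσ.trans_le hσX
  have hlup : 0 < p.lam * u₀ := by positivity
  obtain ⟨hσ1, hρ, hρa, hρl, hσT2, hσT3, huρ1, huρσ⟩ :=
    div_scale_le ha hlam hu₀ hlu hσ hσ2 hσX hρdef
  have hal : 0 < p.a / p.lam := by positivity
  have hX3 : X ^ 3 ≤ p.a / p.lam + X ^ 3 := by linarith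
  set T := p.a / p.lam + X ^ 3 with hT
  have hT0 : 0 < T := by positivity
  have hrisk1 : p.risk ≤ (u₀ * B + 2 * e₂) / ρ :=
    (le_div_iff₀ hρ).2 (risk_mul_le hρ hρa hlaw' hθ)
  have hBT : 0 < B * T := by positivity
  have hη' : r ≤ r / η := by
    rw [le_div_iff₀ hη]
    exact mul_le_of_le_one_right hr.le hη1
  have hηK : 0 < η ^ K := by positivity
  have hmr : 0 ≤ m * r ^ 3 := by positivity
  have hrη : 0 < r / η := by positivity
  -- If `e₁ ≤ u₀ / 8`, then `stieltjes 0` is comparable to `u₀` and numerical differentiation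
  -- applies. Otherwise `1 ≤ 24 * r * σ`; then `gcv` and `risk` are bounded separately, their
  -- difference being no smaller in order.
  rcases le_or_gt e₁ (u₀ / 8) with hgood | hbad
  · have he₂B : e₂ ≤ u₀ * B / 2 := by
      rw [he₂e]
      have := mul_le_mul_of_nonneg_left hgood hB.le
      linarith
    have hslope : p.slope ≤ 3 / 2 * (u₀ * B / p.lam) := by
      refine p.slope_le.trans ?_
      rw [div_le_iff₀ hlam]
      have : 3 / 2 * (u₀ * B / p.lam) * p.lam = 3 / 2 * (u₀ * B) := by field_simp
      linarith
    have hrisk2 : p.risk ≤ 64 * (B * T) := by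
      calc p.risk ≤ (u₀ * B + 2 * e₂) / ρ := hrisk1
        _ ≤ (2 * B * u₀) / ρ := by
          gcongr
          linarith
        _ = 2 * B * (u₀ / ρ) := by ring
        _ ≤ 2 * B * (32 * T) := by gcongr
        _ = _ := by ring
    have hBX : B * σ ^ 2 ≤ B * T := by gcongr
    have hulσ : B / (p.lam * u₀) = B * σ ^ 2 := by
      rw [div_eq_iff hlup.ne', mul_assoc, hσ2, mul_one]
    have hgcv2 : p.gcv ≤ 2 * (B * T) := by
      have h00 := abs_le.1 h0
      have h1 : 7 / 8 * u₀ ≤ p.stieltjes 0 := by linarith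
      calc p.gcv ≤ 3 / 2 * (u₀ * B / p.lam) / (7 / 8 * u₀) ^ 2 := by
            rw [gcv]
            gcongr
        _ = 96 / 49 * (B / (p.lam * u₀)) := by
          field_simp
          norm_num
        _ ≤ 2 * (B * T) := by
          rw [hulσ]
          have : 0 < B * σ ^ 2 := by positivity
          linarith
    have hA : e₂ / ρ ≤ 384 * (B * T) * r := by
      calc e₂ / ρ = 12 * B * r * (u₀ / ρ * σ) := by
            rw [he₂]
            ring
        _ ≤ 12 * B * r * (32 * T) := by gcongr
        _ = _ := by ring
    have hA' : p.slope * e₁ / u₀ ^ 3 ≤ 5 * (B * T) * r := by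
      calc p.slope * e₁ / u₀ ^ 3 ≤ 3 / 2 * (u₀ * B / p.lam) * e₁ / u₀ ^ 3 := by gcongr
        _ = 9 / 2 * (B / (p.lam * u₀)) * r * σ := by
          rw [he₁]
          field_simp
          norm_num
        _ = 9 / 2 * (B * σ ^ 3) * r := by
          rw [hulσ]
          ring
        _ ≤ 5 * (B * T) * r := by
          gcongr
          norm_num
    have key := h p u₀ e₁ e₂ B ρ η hu₀ hlu hgood h0 hρ hρa hρl hη hη1 hlaw
    calc |p.gcv - p.risk|
        ≤ C * ((384 * (B * T) * r + 5 * (B * T) * r) / η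
            + η ^ K * (64 * (B * T) + 2 * (B * T))) := by
          refine key.trans ?_
          gcongr
      _ = C * (B * T) * (389 * (r / η) + 66 * η ^ K) := by ring
      _ ≤ (2000 * C + 1000000) * (B * T) * (r / η + η ^ K + m * r ^ 3) := by
          have h1 : 389 * (r / η) + 66 * η ^ K ≤ 2000 * (r / η + η ^ K + m * r ^ 3) := by linarith
          calc C * (B * T) * (389 * (r / η) + 66 * η ^ K)
              ≤ C * (B * T) * (2000 * (r / η + η ^ K + m * r ^ 3)) := by gcongr
            _ = (2000 * C) * ((B * T) * (r / η + η ^ K + m * r ^ 3)) := by ring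
            _ ≤ (2000 * C + 1000000) * ((B * T) * (r / η + η ^ K + m * r ^ 3)) := by
              gcongr
              linarith
            _ = _ := by ring
      _ = _ := by ring
  · have hrσ : 1 ≤ 24 * r * σ := by
      rw [he₁] at hbad
      have h1 : u₀ * 1 < u₀ * (24 * r * σ) := by linarith
      exact (lt_of_mul_lt_mul_left h1 hu₀.le).le
    have hBu : u₀ * B ≤ 8 * B * e₁ := by
      have := mul_le_mul_of_nonneg_left hbad.le hB.le
      linarith
    have hrisk2 : p.risk ≤ 2000 * (B * T) * r := by
      calc p.risk ≤ (u₀ * B + 2 * e₂) / ρ := hrisk1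
        _ ≤ (16 * B * e₁) / ρ := by
          gcongr
          linarith
        _ = 48 * B * r * (u₀ / ρ * σ) := by
          rw [he₁]
          ring
        _ ≤ 48 * B * r * (32 * T) := by gcongr
        _ = 1536 * ((B * T) * r) := by ring
        _ ≤ 2000 * ((B * T) * r) := by
          gcongr
          norm_num
        _ = _ := by ring
    have hσX2 : σ * X ^ 2 ≤ T := by
      calc σ * X ^ 2 ≤ X * X ^ 2 := by gcongr
        _ = X ^ 3 := by ring
        _ ≤ T := hX3
    have hgcv2 : p.gcv ≤ 1000000 * (B * T) * (m * r ^ 3) := by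
      have h1 : ∑ i, p.r i - p.path p.lam ≤ 12 * B * e₁ := by linarith
      calc p.gcv ≤ m * (∑ i, p.r i - p.path p.lam) / p.stieltjes 0 := hgθ
        _ = m * (∑ i, p.r i - p.path p.lam) * (1 / p.stieltjes 0) := by ring
        _ ≤ m * (12 * B * e₁) * (32 * (p.lam * X ^ 2)) := by gcongr
        _ = 1152 * m * B * r * σ * (p.lam * u₀) * X ^ 2 * 1 ^ 2 := by
          rw [he₁]
          ring
        -- Inserting `(24 * r * σ) ^ 2 ≥ 1` supplies the `σ ^ 2` that cancels `lam * u₀` and turns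
        -- `r` into `r ^ 3`.
        _ ≤ 1152 * m * B * r * σ * (p.lam * u₀) * X ^ 2 * (24 * r * σ) ^ 2 := by
          gcongr
        _ = 663552 * m * B * r ^ 3 * (σ ^ 2 * (p.lam * u₀)) * (σ * X ^ 2) := by ring
        _ ≤ 663552 * m * B * r ^ 3 * (σ ^ 2 * (p.lam * u₀)) * T := by gcongr
        _ = 663552 * (B * T * (m * r ^ 3)) := by
          rw [hσ2]
          ring
        _ ≤ 1000000 * (B * T * (m * r ^ 3)) := by
          gcongr
          norm_num
        _ = _ := by ring
    calc |p.gcv - p.risk| ≤ p.gcv + p.risk := by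
          rw [abs_le]
          constructor <;> linarith
      _ ≤ 1000000 * (B * T) * (m * r ^ 3) + 2000 * (B * T) * r := add_le_add hgcv2 hrisk2
      _ ≤ 1000000 * (B * T) * (r / η + η ^ K + m * r ^ 3) := by
          have h1 := mul_le_mul_of_nonneg_left hη' hBT.le
          have h2 := mul_pos hBT hηK
          have h3 := mul_pos hBT hrη
          have e : 1000000 * (B * T) * (r / η + η ^ K + m * r ^ 3)
            = 1000000 * (B * T * (r / η)) + 1000000 * (B * T * η ^ K)
              + 1000000 * (B * T) * (m * r ^ 3) := by ring
          rw [e]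
          linarith
      _ ≤ (2000 * C + 1000000) * (B * T) * (r / η + η ^ K + m * r ^ 3) := by
          gcongr
          linarith
      _ = _ := by ring

end RidgeProfile

/-! ### Simultaneous diagonalization and resolvents -/

section diagonalization

variable {n : ℕ} {M Q T : Matrix (Fin n) (Fin n) ℝ} {y : Fin n → ℝ}

theorem exists_orthogonal_diagonalization (hQ : Q.IsHermitian) :
    ∃ T : Matrix (Fin n) (Fin n) ℝ, Tᵀ * T = 1 ∧ Tᵀ * Q * T = diagonal hQ.eigenvalues := by
  have hstar : star (hQ.eigenvectorUnitary : Matrix (Fin n) (Fin n) ℝ)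
      = (hQ.eigenvectorUnitary : Matrix (Fin n) (Fin n) ℝ)ᵀ := by
    rw [star_eq_conjTranspose, conjTranspose_eq_transpose_of_trivial]
  have h1 : (hQ.eigenvectorUnitary : Matrix (Fin n) (Fin n) ℝ)ᵀ
      * (hQ.eigenvectorUnitary : Matrix (Fin n) (Fin n) ℝ) = 1 := by
    rw [← hstar]
    exact Unitary.coe_star_mul_self _
  refine ⟨hQ.eigenvectorUnitary, h1, ?_⟩
  have h2 := hQ.conjStarAlgAut_star_eigenvectorUnitary
  rw [Unitary.conjStarAlgAut_apply] at h2
  rw [Unitary.coe_star, star_star] at h2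
  simpa [hstar] using h2

/-- Conjugation by `M ^ (-1/2)` reduces the pair to the identity and one symmetric matrix, which is
diagonalized orthogonally. A single `T` then diagonalizes `m • M + t • Q` for all `m` and `t`. -/
theorem exists_simultaneous_diagonalization (hM : M.PosDef) (hQ : Q.IsHermitian) :
    ∃ (T : Matrix (Fin n) (Fin n) ℝ) (y : Fin n → ℝ), Tᵀ * M * T = 1 ∧
      Tᵀ * Q * T = diagonal y := by
  set S := invSqrt M with hS
  have hSt : Sᵀ = S := by
    have : IsSelfAdjoint S := cfc_predicate _ _
    rw [← conjTranspose_eq_transpose_of_trivial]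
    exact this
  have hSM : S * S * M = 1 := invSqrt_mul_self_mul hM
  have hSMS : S * M * S = 1 := by
    rw [mul_assoc] at hSM
    exact mul_eq_one_comm.1 hSM
  have hQt : Qᵀ = Q := by
    rw [← conjTranspose_eq_transpose_of_trivial]
    exact hQ
  have hY : (S * Q * S).IsHermitian := by
    rw [IsHermitian, conjTranspose_eq_transpose_of_trivial, transpose_mul, transpose_mul, hSt, hQt,
      mul_assoc]
  obtain ⟨U, hU1, hU2⟩ := exists_orthogonal_diagonalization hY
  refine ⟨S * U, hY.eigenvalues, ?_, ?_⟩
  · calc (S * U)ᵀ * M * (S * U) = Uᵀ * (S * M * S) * U := by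
          rw [transpose_mul, hSt]
          simp only [mul_assoc]
      _ = 1 := by rw [hSMS, mul_one, hU1]
  · rw [← hU2, transpose_mul, hSt]
    simp only [mul_assoc]

theorem inv_add_smul_eq (hM : Tᵀ * M * T = 1) (hQ : Tᵀ * Q * T = diagonal y) {m t : ℝ}
    (h : ∀ i, m + t * y i ≠ 0) :
    (m • M + t • Q)⁻¹ = T * diagonal (fun i => 1 / (m + t * y i)) * Tᵀ := by
  refine inv_eq_right_inv ?_
  rw [← mul_assoc]
  refine mul_eq_one_comm.1 ?_
  have h1 : Tᵀ * (m • M + t • Q) * T = diagonal (fun i => m + t * y i) := by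
    rw [mul_add, add_mul, Matrix.mul_smul, Matrix.mul_smul, Matrix.smul_mul, Matrix.smul_mul, hM,
      hQ, ← diagonal_one, ← diagonal_smul, ← diagonal_smul, diagonal_add]
    simp
  rw [← mul_assoc, ← mul_assoc, h1, diagonal_mul_diagonal, ← diagonal_one]
  congr 1
  funext i
  exact mul_one_div_cancel (h i)

theorem dotProduct_conj_diagonal_mulVec (w v : Fin n → ℝ) :
    v ⬝ᵥ ((T * diagonal w * Tᵀ) *ᵥ v) = ∑ i, (Tᵀ *ᵥ v) i ^ 2 * w i := by
  rw [mul_assoc, ← mulVec_mulVec, ← mulVec_mulVec, dotProduct_mulVec, ← mulVec_transpose,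
    dotProduct]
  refine Finset.sum_congr rfl fun i _ => ?_
  rw [mulVec_diagonal]
  ring

theorem trace_mul_conj_diagonal (w : Fin n → ℝ) (R : Matrix (Fin n) (Fin n) ℝ) :
    (R * (T * diagonal w * Tᵀ)).trace = ∑ i, (Tᵀ * R * T) i i * w i := by
  rw [← mul_assoc, ← mul_assoc, trace_mul_comm, ← mul_assoc, ← mul_assoc, trace]
  refine Finset.sum_congr rfl fun i _ => ?_
  rw [diag_apply, mul_diagonal]

theorem conj_apply_diag (R : Matrix (Fin n) (Fin n) ℝ) (i : Fin n) :
    (Tᵀ * R * T) i i = (fun k => T k i) ⬝ᵥ (R *ᵥ fun k => T k i) := by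
  rw [mul_assoc, mul_apply, dotProduct]
  rfl

theorem conj_inv_eq (hM : Tᵀ * M * T = 1) : M⁻¹ = T * Tᵀ := by
  refine inv_eq_right_inv ?_
  rw [← mul_assoc]
  exact mul_eq_one_comm.1 (by rw [← mul_assoc, hM])

end diagonalization

/-- Resolvents of congruent matrices. -/
theorem conj_smul_inv_conj {n : ℕ} {A S Q : Matrix (Fin n) (Fin n) ℝ} (hS : S * S * A = 1) (l : ℝ) :
    S * (l • 1 + S * Q * S)⁻¹ * S = (l • A + Q)⁻¹ := by
  have h1 : S * (S * A) = 1 := by rw [← mul_assoc, hS]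
  have hSAS : S * A * S = 1 := mul_eq_one_comm.1 h1
  have hu : IsUnit S.det := (isUnit_iff_isUnit_det S).1 (IsUnit.of_mul_eq_one _ h1)
  have e : l • 1 + S * Q * S = S * (l • A + Q) * S := by
    rw [mul_add, add_mul, Matrix.mul_smul, Matrix.smul_mul, hSAS]
  rw [e, Matrix.mul_inv_rev, Matrix.mul_inv_rev, mul_assoc, mul_assoc, mul_assoc, nonsing_inv_mul _ hu, mul_one,
    ← mul_assoc, mul_nonsing_inv _ hu, one_mul]

theorem invSqrt_transpose {n : ℕ} (A : Matrix (Fin n) (Fin n) ℝ) : (invSqrt A)ᵀ = invSqrt A := by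
  have : IsSelfAdjoint (invSqrt A) := cfc_predicate _ _
  rw [← conjTranspose_eq_transpose_of_trivial]
  exact this

/-! ### The operator norm -/

theorem opNorm_nonneg {n : ℕ} (A : Matrix (Fin n) (Fin n) ℝ) : 0 ≤ opNorm A := norm_nonneg _

theorem dotProduct_mulVec_le_opNorm {n : ℕ} (A : Matrix (Fin n) (Fin n) ℝ) (v : Fin n → ℝ) :
    v ⬝ᵥ (A *ᵥ v) ≤ opNorm A * (v ⬝ᵥ v) := by
  have h1 : v ⬝ᵥ (A *ᵥ v) = inner ℝ (WithLp.toLp 2 v)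
      (toEuclideanCLM (n := Fin n) (𝕜 := ℝ) A (WithLp.toLp 2 v)) := by
    rw [toEuclideanCLM_toLp, EuclideanSpace.inner_toLp_toLp, dotProduct_comm]
    simp
  have h2 : v ⬝ᵥ v = ‖WithLp.toLp 2 v‖ ^ 2 := by
    rw [← real_inner_self_eq_norm_sq, EuclideanSpace.inner_toLp_toLp]
    simp
  rw [h1, h2]
  refine (real_inner_le_norm _ _).trans ?_
  have h3 := (toEuclideanCLM (n := Fin n) (𝕜 := ℝ) A).le_opNorm (WithLp.toLp 2 v)
  calc _ ≤ ‖WithLp.toLp 2 v‖ * (opNorm A * ‖WithLp.toLp 2 v‖) := by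
        gcongr
        exact h3
    _ = _ := by ring

/-- A column `x` of `T` has `xᵀ M x = 1`, hence `xᵀ x ≤ 1` because `M ≥ 1`, and `y i = xᵀ Q x`. -/
theorem diag_le_opNorm {n : ℕ} {M Q T : Matrix (Fin n) (Fin n) ℝ} {y : Fin n → ℝ}
    (h1 : ∀ v : Fin n → ℝ, v ⬝ᵥ v ≤ v ⬝ᵥ (M *ᵥ v)) (hM : Tᵀ * M * T = 1)
    (hQ : Tᵀ * Q * T = diagonal y) (i : Fin n) : y i ≤ opNorm Q := by
  have e1 : y i = (Tᵀ * Q * T) i i := by rw [hQ, diagonal_apply_eq]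
  have e2 : (1 : ℝ) = (Tᵀ * M * T) i i := by rw [hM, one_apply_eq]
  rw [conj_apply_diag] at e1 e2
  rw [e1]
  refine (dotProduct_mulVec_le_opNorm _ _).trans ?_
  have := h1 fun k => T k i
  rw [← e2] at this
  exact mul_le_of_le_one_right (opNorm_nonneg _) this

theorem eigenvalues_le_opNorm {n : ℕ} {Q : Matrix (Fin n) (Fin n) ℝ} (hQ : Q.IsHermitian)
    (i : Fin n) : hQ.eigenvalues i ≤ opNorm Q := by
  obtain ⟨T, h1, h2⟩ := exists_orthogonal_diagonalization hQ
  exact diag_le_opNorm (M := 1) (T := T) (fun v => by rw [one_mulVec]) (by rw [mul_one, h1]) h2 i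

theorem diag_nonneg_of_posSemidef {n : ℕ} {Q T : Matrix (Fin n) (Fin n) ℝ}
    (hQ : Q.PosSemidef) (i : Fin n) : 0 ≤ (Tᵀ * Q * T) i i := by
  rw [conj_apply_diag]
  simpa using hQ.dotProduct_mulVec_nonneg fun k => T k i

/-! ### Sample eigenvalues -/

section sample

variable {N P : ℕ} (X : Fin N → Fin P → ℝ)

theorem sampleSecondMoment_posSemidef : (sampleSecondMoment X).PosSemidef := by
  refine Matrix.PosSemidef.of_dotProduct_mulVec_nonneg (sampleSecondMoment_isHermitian X) fun v => ?_
  rw [star_trivial, sampleSecondMoment_bilin]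
  exact mul_nonneg (by positivity) (Finset.sum_nonneg fun i _ => mul_self_nonneg _)

theorem sampleSecondMoment_rank_le : (sampleSecondMoment X).rank ≤ N := by
  rw [sampleSecondMoment, ← Matrix.smul_mul]
  refine (rank_mul_le_right _ _).trans ?_
  simpa using rank_le_card_height (Matrix.of X)

theorem sample_eigenvalues₀_nonneg (i : Fin (Fintype.card (Fin P))) :
    0 ≤ (sampleSecondMoment_isHermitian X).eigenvalues₀ i := by
  have := (sampleSecondMoment_posSemidef X).eigenvalues_nonneg
    (Fintype.equivOfCardEq (Fintype.card_fin _) i)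
  simpa [IsHermitian.eigenvalues] using this

/-- A positive eigenvalue at position `i` would make the `i + 1` largest ones nonzero, against rank
at most `N ≤ i`. -/
theorem sample_eigenvalues₀_eq_zero {i : Fin (Fintype.card (Fin P))} (hi : N ≤ i) :
    (sampleSecondMoment_isHermitian X).eigenvalues₀ i = 0 := by
  by_contra hne
  set hA := sampleSecondMoment_isHermitian X with hAdef
  have hpos : 0 < hA.eigenvalues₀ i := lt_of_le_of_ne (sample_eigenvalues₀_nonneg X i) (Ne.symm hne)
  set e : Fin (Fintype.card (Fin P)) ≃ Fin P := Fintype.equivOfCardEq (Fintype.card_fin _) with he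
  have hev : ∀ j, hA.eigenvalues (e j) = hA.eigenvalues₀ j := fun j => by
    simp [IsHermitian.eigenvalues, he]
  have hcard : Fintype.card {j : Fin (Fintype.card (Fin P)) // j ≤ i}
      ≤ Fintype.card {j // hA.eigenvalues j ≠ 0} := by
    refine Fintype.card_le_of_injective (fun j => ⟨e j.1, ?_⟩) ?_
    · rw [hev]
      exact (hpos.trans_le (hA.eigenvalues₀_antitone j.2)).ne'
    · intro a b hab
      simpa [Subtype.ext_iff] using hab
  rw [← hA.rank_eq_card_non_zero_eigs] at hcard
  have h1 : Fintype.card {j : Fin (Fintype.card (Fin P)) // j ≤ i} = i + 1 := by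
    rw [Fintype.card_subtype]
    have : (Finset.univ.filter fun j => j ≤ i) = Finset.Iic i := by
      ext j
      simp
    rw [this, Fin.card_Iic]
  have := sampleSecondMoment_rank_le X
  omega

theorem sampleEigenvalue_nonneg (i : Fin N) : 0 ≤ sampleEigenvalue X i := by
  rw [sampleEigenvalue]
  split_ifs
  · exact sample_eigenvalues₀_nonneg X _
  · exact le_rfl

/-- Sums over the leading eigenvalues are sums over all eigenvalues. -/
theorem sum_sampleEigenvalue {φ : ℝ → ℝ} (hφ : φ 0 = 0) :
    ∑ i, φ (sampleEigenvalue X i)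
      = ∑ i, φ ((sampleSecondMoment_isHermitian X).eigenvalues i) := by
  set hA := sampleSecondMoment_isHermitian X with hAdef
  -- Both lists are initial segments of one sequence extended by zero; as `φ 0 = 0`, the length of
  -- the segment is irrelevant once it passes `N` or `P`.
  set ev : ℕ → ℝ := fun j => if h : j < Fintype.card (Fin P) then hA.eigenvalues₀ ⟨j, h⟩ else 0
    with hev
  have h1 : ∀ i : Fin N, sampleEigenvalue X i = ev i := fun i => by
    simp only [sampleEigenvalue, hev, Fintype.card_fin]
  have h2 : ∑ i, φ (hA.eigenvalues i) = ∑ i : Fin (Fintype.card (Fin P)), φ (ev i) := by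
    rw [← (Fintype.equivOfCardEq (Fintype.card_fin (Fintype.card (Fin P)))).sum_comp
      (fun i => φ (hA.eigenvalues i))]
    refine Finset.sum_congr rfl fun i _ => ?_
    have hi : (i : ℕ) < Fintype.card (Fin P) := i.2
    simp only [IsHermitian.eigenvalues, hev, dif_pos hi, Equiv.symm_apply_apply]
  have hzero : ∀ j, N ≤ j ∨ Fintype.card (Fin P) ≤ j → ev j = 0 := by
    intro j hj
    simp only [hev]
    split_ifs with h
    · exact sample_eigenvalues₀_eq_zero X (by rcases hj with hj | hj <;> simp <;> omega)
    · rfl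
  rw [h2, Fin.sum_univ_eq_sum_range (fun j => φ (ev j))]
  simp only [h1]
  rw [Fin.sum_univ_eq_sum_range (fun j => φ (ev j))]
  have h3 : ∀ m, (∀ j, m ≤ j → ev j = 0) → ∀ m', m ≤ m' →
      ∑ j ∈ Finset.range m, φ (ev j) = ∑ j ∈ Finset.range m', φ (ev j) := by
    intro m hm m' hmm
    refine Finset.sum_subset (by simpa using hmm) fun j _ hj => ?_
    rw [hm j (by simpa using hj), hφ]
  rw [h3 N (fun j hj => hzero j (Or.inl hj)) _ (le_max_left N (Fintype.card (Fin P))),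
    h3 _ (fun j hj => hzero j (Or.inr hj)) _ (le_max_right N (Fintype.card (Fin P)))]

/-- The empirical Stieltjes transform. -/
noncomputable def sampleStieltjes (l : ℝ) : ℝ := 1 / (N : ℝ) * ∑ i, 1 / (sampleEigenvalue X i + l)

theorem sampleStieltjes_pos (hN : 0 < N) {l : ℝ} (hl : 0 < l) : 0 < sampleStieltjes X l := by
  have : Nonempty (Fin N) := ⟨⟨0, hN⟩⟩
  have hN' : (0 : ℝ) < N := by exact_mod_cast hN
  refine mul_pos (by positivity) (Finset.sum_pos (fun i _ => ?_) Finset.univ_nonempty)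
  have := sampleEigenvalue_nonneg X i
  positivity

theorem mul_sampleStieltjes_le {l : ℝ} (hl : 0 < l) : l * sampleStieltjes X l ≤ 1 := by
  have h1 : ∀ i, 1 / (sampleEigenvalue X i + l) ≤ 1 / l := fun i => by
    have := sampleEigenvalue_nonneg X i
    gcongr
    linarith
  have h2 : ∑ i, 1 / (sampleEigenvalue X i + l) ≤ N * (1 / l) := by
    refine (Finset.sum_le_sum fun i _ => h1 i).trans ?_
    simp
  rw [sampleStieltjes]
  rcases Nat.eq_zero_or_pos N with rfl | hN
  · simp
  have hN' : (0 : ℝ) < N := by exact_mod_cast hN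
  calc _ ≤ l * (1 / (N : ℝ) * (N * (1 / l))) := by gcongr
    _ = 1 := by field_simp

/-- From `1 / (s + l) = 1 / l - s / (l (l + s))`: the second part vanishes at `s = 0`, so its sum
over the `N` padded eigenvalues is a trace on `ℝ^P`. -/
theorem sampleStieltjes_eq (hN : 0 < N) {l : ℝ} (hl : 0 < l) :
    sampleStieltjes X l = 1 / l - 1 / (N * l) *
      (sampleSecondMoment X * (l • 1 + sampleSecondMoment X)⁻¹).trace := by
  have hN' : (0 : ℝ) < N := by exact_mod_cast hN
  set hA := sampleSecondMoment_isHermitian X with hAdef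
  obtain ⟨T, h1, h2⟩ := exists_orthogonal_diagonalization hA
  have hnn : ∀ i, 0 ≤ hA.eigenvalues i := (sampleSecondMoment_posSemidef X).eigenvalues_nonneg
  have h3 : (l • (1 : Matrix (Fin P) (Fin P) ℝ) + sampleSecondMoment X)⁻¹
      = T * diagonal (fun i => 1 / (l + 1 * hA.eigenvalues i)) * Tᵀ := by
    have := inv_add_smul_eq (M := 1) (T := T) (m := l) (t := 1) (by rw [mul_one, h1]) h2
      (fun i => by have := hnn i; positivity)
    rwa [one_smul] at this
  rw [h3, trace_mul_conj_diagonal, h2]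
  simp only [diagonal_apply_eq, one_mul]
  have h4 := sum_sampleEigenvalue X (φ := fun x => x * (1 / (l + x))) (by simp)
  rw [← h4, sampleStieltjes]
  have h5 : ∀ i, 1 / (sampleEigenvalue X i + l)
      = 1 / l - 1 / l * (sampleEigenvalue X i * (1 / (l + sampleEigenvalue X i))) := fun i => by
    have := sampleEigenvalue_nonneg X i
    have h6 : 0 < sampleEigenvalue X i + l := by linarith
    have h7 : 0 < l + sampleEigenvalue X i := by linarith
    field_simp
    ring
  simp only [h5]
  rw [Finset.sum_sub_distrib, ← Finset.mul_sum, Finset.sum_const, Finset.card_univ, Fintype.card_fin,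
    nsmul_eq_mul]
  field_simp

/-- Each nonzero eigenvalue of the empirical second moment matrix contributes to the Stieltjes
transform. -/
theorem one_div_le_sampleStieltjes (hN : 0 < N) {l : ℝ} (hl : 0 < l) {i : Fin P}
    (hi : (sampleSecondMoment_isHermitian X).eigenvalues i ≠ 0) :
    1 / (l + (sampleSecondMoment_isHermitian X).eigenvalues i) ≤ N * sampleStieltjes X l := by
  have hN' : (0 : ℝ) < N := by exact_mod_cast hN
  set hA := sampleSecondMoment_isHermitian X with hAdef
  set j := (Fintype.equivOfCardEq (Fintype.card_fin (Fintype.card (Fin P)))).symm i with hj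
  have hji : hA.eigenvalues i = hA.eigenvalues₀ j := rfl
  have hjN : (j : ℕ) < N := by
    by_contra hcon
    push Not at hcon
    exact hi (by rw [hji]; exact sample_eigenvalues₀_eq_zero X hcon)
  have hse : sampleEigenvalue X ⟨j, hjN⟩ = hA.eigenvalues i := by
    have : (j : ℕ) < P := by simpa using j.2
    rw [sampleEigenvalue, dif_pos this, hji]
  have e : N * sampleStieltjes X l = ∑ i, 1 / (sampleEigenvalue X i + l) := by
    rw [sampleStieltjes]
    field_simp
  rw [e, ← hse, add_comm]
  refine Finset.single_le_sum (f := fun i => 1 / (sampleEigenvalue X i + l)) (fun i _ => ?_)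
    (Finset.mem_univ _)
  have := sampleEigenvalue_nonneg X i
  positivity

end sample

/-! ### The profile of a ridge regression problem -/

section profile

variable {P : ℕ} {Q : Matrix (Fin P) (Fin P) ℝ}

theorem abs_smul_quadratic_le (hQ : Q.PosSemidef) {t : ℝ} (ht : |t| * opNorm Q < 1 / 2)
    (v : Fin P → ℝ) : |t * (v ⬝ᵥ (Q *ᵥ v))| ≤ 1 / 2 * (v ⬝ᵥ v) := by
  have h1 : 0 ≤ v ⬝ᵥ (Q *ᵥ v) := by simpa using hQ.dotProduct_mulVec_nonneg v
  have h2 : 0 ≤ v ⬝ᵥ v := by simpa using dotProduct_star_self_nonneg v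
  rw [abs_mul, abs_of_nonneg h1]
  calc |t| * (v ⬝ᵥ (Q *ᵥ v)) ≤ |t| * (opNorm Q * (v ⬝ᵥ v)) := by
        gcongr
        exact dotProduct_mulVec_le_opNorm _ _
    _ = |t| * opNorm Q * (v ⬝ᵥ v) := by ring
    _ ≤ _ := by gcongr

theorem posDef_one_add_smul (hQ : Q.PosSemidef) {t : ℝ} (ht : |t| * opNorm Q < 1 / 2) :
    (1 + t • Q).PosDef := by
  refine Matrix.PosDef.of_dotProduct_mulVec_pos ?_ fun v hv => ?_
  · rw [IsHermitian, conjTranspose_add, conjTranspose_one, conjTranspose_smul, hQ.isHermitian]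
    simp
  · have h1 := (abs_le.1 (abs_smul_quadratic_le hQ ht v)).1
    have h2 : 0 < v ⬝ᵥ v := by simpa using dotProduct_star_self_pos_iff.2 hv
    rw [star_trivial, add_mulVec, one_mulVec, smul_mulVec, dotProduct_add, dotProduct_smul,
      smul_eq_mul]
    linarith

theorem one_add_mul_pos {a t y : ℝ} (ht : |t| * a < 1 / 2) (hy : 0 ≤ y) (hya : y ≤ a) :
    0 < 1 + t * y := by
  have h1 : |t * y| < 1 / 2 := by
    rw [abs_mul, abs_of_nonneg hy]
    exact (mul_le_mul_of_nonneg_left hya (abs_nonneg t)).trans_lt ht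
  linarith [(abs_lt.1 h1).1]

theorem sampleSecondMoment_mulVec {N : ℕ} (S : Matrix (Fin P) (Fin P) ℝ) (X : Fin N → Fin P → ℝ) :
    sampleSecondMoment (fun i => S *ᵥ X i) = S * sampleSecondMoment X * Sᵀ := by
  have h : Matrix.of (fun i => S *ᵥ X i) = Matrix.of X * Sᵀ := by
    ext i j
    simp [mul_apply, mulVec, dotProduct, mul_comm]
  rw [sampleSecondMoment, sampleSecondMoment, h, transpose_mul, transpose_transpose,
    Matrix.mul_smul, Matrix.smul_mul]
  simp only [Matrix.mul_assoc]

/-- Cyclicity of the trace removes the square root `S` and leaves the resolvent of the pencil `l • A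
+ R`. -/
theorem trace_conj_resolvent {A S R : Matrix (Fin P) (Fin P) ℝ} (hS : S * S * A = 1) (l : ℝ) :
    (S * R * S * (l • 1 + S * R * S)⁻¹).trace = (R * (l • A + R)⁻¹).trace := by
  rw [← conj_smul_inv_conj hS, mul_assoc, mul_assoc, trace_mul_comm, ← mul_assoc, ← mul_assoc]
  simp only [mul_assoc]

variable {N : ℕ} (X : Fin N → Fin P → ℝ) (β : Fin P → ℝ) {lam : ℝ}

theorem empiricalRisk_eq (b : Fin P → ℝ) :
    empiricalRisk β X b = (β - b) ⬝ᵥ (sampleSecondMoment X *ᵥ (β - b)) := by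
  rw [sampleSecondMoment_bilin, empiricalRisk]
  simp only [sub_dotProduct, sq]

theorem gcv_eq : gcv β lam X = empiricalRisk β X (ridgeEstimator β lam X) /
    (lam * sampleStieltjes X lam) ^ 2 := by
  have : 1 / (N : ℝ) * ∑ i, lam / (lam + sampleEigenvalue X i) = lam * sampleStieltjes X lam := by
    have e : ∀ i, lam / (lam + sampleEigenvalue X i) = lam * (1 / (sampleEigenvalue X i + lam)) :=
      fun i => by rw [mul_one_div, add_comm]
    simp only [e, sampleStieltjes]
    rw [← Finset.mul_sum]
    ring
  rw [gcv, this, mul_comm, div_eq_mul_inv]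

theorem posDef_one_add_inv_smul_sample (hlam : 0 < lam) :
    (1 + lam⁻¹ • sampleSecondMoment X).PosDef :=
  Matrix.PosDef.one.add_posSemidef ((sampleSecondMoment_posSemidef X).smul (inv_nonneg.2 hlam.le))

/-- The error of the estimator is the shrunk ground truth `λ (λ + R)⁻¹ β`, written with the matrix
`1 + λ⁻¹ R` that the simultaneous diagonalization normalizes to `1`. -/
theorem sub_ridgeEstimator_eq (hlam : 0 < lam) :
    β - ridgeEstimator β lam X = (1 + lam⁻¹ • sampleSecondMoment X)⁻¹ *ᵥ β := by
  set R := sampleSecondMoment X with hR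
  have hM := posDef_one_add_inv_smul_sample X hlam
  rw [← hR] at hM
  have hu : IsUnit (1 + lam⁻¹ • R).det := hM.det_pos.ne'.isUnit
  have e : R + lam • 1 = lam • (1 + lam⁻¹ • R) := by
    rw [smul_add, smul_smul, mul_inv_cancel₀ hlam.ne', one_smul, add_comm]
  have hinv : (R + lam • 1)⁻¹ = lam⁻¹ • (1 + lam⁻¹ • R)⁻¹ := by
    rw [e]
    refine inv_eq_right_inv ?_
    rw [Matrix.smul_mul, Matrix.mul_smul, smul_smul, mul_inv_cancel₀ hlam.ne', one_smul,
      mul_nonsing_inv _ hu]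
  rw [ridgeEstimator_eq β hlam, ← hR, hinv, smul_mulVec, ← mulVec_smul, ← smul_mulVec]
  have h1 : (1 + lam⁻¹ • R)⁻¹ *ᵥ ((1 + lam⁻¹ • R) *ᵥ β) = β := by
    rw [mulVec_mulVec, nonsing_inv_mul _ hu, one_mulVec]
  rw [add_mulVec, one_mulVec, mulVec_add] at h1
  exact sub_eq_of_eq_add h1.symm

/-- The scalar functions that describe a ridge regression problem. -/
theorem exists_ridgeProfile (hQ : Q.PosSemidef) (ha : 0 < opNorm Q) (hN : 0 < N)
    (hlam : 0 < lam) : ∃ p : RidgeProfile P, p.a = opNorm Q ∧ p.lam = lam ∧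
      (∀ t : ℝ, |t| * opNorm Q < 1 / 2 →
        p.stieltjes t = sampleStieltjes (fun i => invSqrt (1 + t • Q) *ᵥ X i) lam) ∧
      p.stieltjes 0 = sampleStieltjes X lam ∧
      (∀ t : ℝ, |t| * opNorm Q < 1 / 2 → p.bias t =
        β ⬝ᵥ ((lam • (lam • (1 + t • Q) + sampleSecondMoment X)⁻¹) *ᵥ β)) ∧
      (∀ l : ℝ, 0 < l → p.path l = β ⬝ᵥ ((l • (l • 1 + sampleSecondMoment X)⁻¹) *ᵥ β)) ∧
      ∑ i, p.r i = β ⬝ᵥ β ∧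
      p.risk = (β - ridgeEstimator β lam X) ⬝ᵥ (Q *ᵥ (β - ridgeEstimator β lam X)) ∧
      p.gcv = gcv β lam X ∧
      p.gcv ≤ N * (∑ i, p.r i - p.path p.lam) / p.stieltjes 0 := by
  have hN' : (0 : ℝ) < N := by exact_mod_cast hN
  set R := sampleSecondMoment X with hR
  have hRpsd : R.PosSemidef := sampleSecondMoment_posSemidef X
  set M : Matrix (Fin P) (Fin P) ℝ := 1 + lam⁻¹ • R with hM
  have hMpd : M.PosDef := posDef_one_add_inv_smul_sample X hlam
  -- As `λ(1 + tQ) + R = λM + λtQ`, this basis serves for all perturbations at once, and `M ≥ 1`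
  -- gives `y i ≤ ‖Q‖`.
  obtain ⟨T, y, hTM, hTQ⟩ := exists_simultaneous_diagonalization hMpd hQ.isHermitian
  have hy0 : ∀ i, 0 ≤ y i := fun i => by
    have := diag_nonneg_of_posSemidef (T := T) hQ i
    rwa [hTQ, diagonal_apply_eq] at this
  have hya : ∀ i, y i ≤ opNorm Q := diag_le_opNorm (fun v => by
    have := (hRpsd.smul (inv_nonneg.2 hlam.le)).dotProduct_mulVec_nonneg v
    rw [hM, add_mulVec, one_mulVec, dotProduct_add]
    rw [star_trivial] at this
    linarith) hTM hTQ
  have hpos : ∀ t : ℝ, |t| * opNorm Q < 1 / 2 → ∀ i, 0 < 1 + t * y i := fun t ht i =>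
    one_add_mul_pos ht (hy0 i) (hya i)
  have hres : ∀ t : ℝ, |t| * opNorm Q < 1 / 2 → (lam • (1 + t • Q) + R)⁻¹
      = T * diagonal (fun i => 1 / (lam + lam * t * y i)) * Tᵀ := by
    intro t ht
    have e : lam • (1 + t • Q) + R = lam • M + (lam * t) • Q := by
      rw [hM, smul_add, smul_add, smul_smul, smul_smul, mul_inv_cancel₀ hlam.ne', one_smul]
      abel
    rw [e]
    refine inv_add_smul_eq hTM hTQ fun i => ?_
    have : lam + lam * t * y i = lam * (1 + t * y i) := by ring
    rw [this]
    exact (mul_pos hlam (hpos t ht i)).ne'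
  -- The regularization path is diagonal in another basis, the orthogonal eigenbasis of `R`.
  obtain ⟨U, hU1, hU2⟩ := exists_orthogonal_diagonalization hRpsd.isHermitian
  set s := hRpsd.isHermitian.eigenvalues with hs
  have hs0 : ∀ i, 0 ≤ s i := hRpsd.eigenvalues_nonneg
  have hresU : ∀ l : ℝ, 0 < l → (l • (1 : Matrix (Fin P) (Fin P) ℝ) + R)⁻¹
      = U * diagonal (fun i => 1 / (l + 1 * s i)) * Uᵀ := by
    intro l hl
    have := inv_add_smul_eq (M := 1) (T := U) (m := l) (t := 1) (by rw [mul_one, hU1]) hU2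
      (fun i => by have := hs0 i; positivity)
    rwa [one_smul] at this
  have h00 : |(0 : ℝ)| * opNorm Q < 1 / 2 := by simp
  -- Chosen so that the trace term in `sampleStieltjes_eq` becomes `∑ d i / (1 + t * y i)`, with `c₀
  -- = 1 / lam`.
  set d : Fin P → ℝ := fun i => (Tᵀ * R * T) i i / (N * lam ^ 2) with hd
  have hst : ∀ t : ℝ, |t| * opNorm Q < 1 / 2 → 1 / lam - ∑ i, d i / (1 + t * y i)
      = 1 / lam - 1 / (N * lam) * (R * (lam • (1 + t • Q) + R)⁻¹).trace := by
    intro t ht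
    rw [hres t ht, trace_mul_conj_diagonal, Finset.mul_sum]
    congr 1
    refine Finset.sum_congr rfl fun i _ => ?_
    have h1 := hpos t ht i
    have h2 : lam + lam * t * y i = lam * (1 + t * y i) := by ring
    rw [h2, hd]
    field_simp
  have hst' : ∀ t : ℝ, |t| * opNorm Q < 1 / 2 → 1 / lam - ∑ i, d i / (1 + t * y i)
      = sampleStieltjes (fun i => invSqrt (1 + t • Q) *ᵥ X i) lam := by
    intro t ht
    rw [hst t ht, sampleStieltjes_eq _ hN hlam, sampleSecondMoment_mulVec, invSqrt_transpose,
      trace_conj_resolvent (invSqrt_mul_self_mul (posDef_one_add_smul hQ ht))]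
  have hst0 : 1 / lam - ∑ i, d i / (1 + 0 * y i) = sampleStieltjes X lam := by
    rw [hst 0 h00, sampleStieltjes_eq _ hN hlam, zero_smul, add_zero]
  have hbias : ∀ t : ℝ, |t| * opNorm Q < 1 / 2 → ∑ i, (Tᵀ *ᵥ β) i ^ 2 / (1 + t * y i)
      = β ⬝ᵥ ((lam • (lam • (1 + t • Q) + R)⁻¹) *ᵥ β) := by
    intro t ht
    rw [hres t ht, smul_mulVec, dotProduct_smul, dotProduct_conj_diagonal_mulVec, smul_eq_mul,
      Finset.mul_sum]
    refine Finset.sum_congr rfl fun i _ => ?_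
    have h1 := hpos t ht i
    have h2 : lam + lam * t * y i = lam * (1 + t * y i) := by ring
    rw [h2]
    field_simp
  have hpath : ∀ l : ℝ, 0 < l → ∑ i, (Uᵀ *ᵥ β) i ^ 2 * l / (l + s i)
      = β ⬝ᵥ ((l • (l • 1 + R)⁻¹) *ᵥ β) := by
    intro l hl
    rw [hresU l hl, smul_mulVec, dotProduct_smul, dotProduct_conj_diagonal_mulVec, smul_eq_mul,
      Finset.mul_sum]
    refine Finset.sum_congr rfl fun i _ => ?_
    rw [one_mul]
    ring
  let p : RidgeProfile P :=
    { q := fun i => (Tᵀ *ᵥ β) i ^ 2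
      y := y
      d := d
      r := fun i => (Uᵀ *ᵥ β) i ^ 2
      s := s
      c₀ := 1 / lam
      a := opNorm Q
      lam := lam
      a_pos := ha
      lam_pos := hlam
      q_nonneg := fun i => sq_nonneg _
      y_nonneg := hy0
      y_le := hya
      d_nonneg := fun i => div_nonneg (diag_nonneg_of_posSemidef hRpsd i) (by positivity)
      r_nonneg := fun i => sq_nonneg _
      s_nonneg := hs0
      stieltjes_pos' := fun t ht => by
        rw [hst' t ht]
        exact sampleStieltjes_pos _ hN hlam
      lam_mul_stieltjes_le' := by
        rw [hst0]
        exact mul_sampleStieltjes_le X hlam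
      bias_zero' := by rw [hbias 0 h00, hpath lam hlam, zero_smul, add_zero] }
  have hgcv : p.gcv = gcv β lam X := by
    have h1 : p.stieltjes 0 = sampleStieltjes X lam := hst0
    have h2 : β - ridgeEstimator β lam X
        = U *ᵥ (fun i => lam / (lam + s i) * (Uᵀ *ᵥ β) i) := by
      have e : M⁻¹ = lam • (lam • 1 + R)⁻¹ := by
        refine inv_eq_right_inv ?_
        have hu : IsUnit (lam • (1 : Matrix (Fin P) (Fin P) ℝ) + R).det :=
          ((PosDef.one.smul hlam).add_posSemidef hRpsd).det_pos.ne'.isUnit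
        have e2 : M = lam⁻¹ • (lam • 1 + R) := by
          rw [hM, smul_add, smul_smul, inv_mul_cancel₀ hlam.ne', one_smul]
        rw [e2, Matrix.smul_mul, Matrix.mul_smul, smul_smul, inv_mul_cancel₀ hlam.ne', one_smul,
          mul_nonsing_inv _ hu]
      rw [sub_ridgeEstimator_eq X β hlam, ← hR, ← hM, e, hresU lam hlam, smul_mulVec, mul_assoc,
        ← mulVec_mulVec, ← mulVec_smul, ← mulVec_mulVec]
      congr 1
      funext i
      rw [Pi.smul_apply, mulVec_diagonal, smul_eq_mul, one_mul]
      ring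
    have h3 : empiricalRisk β X (ridgeEstimator β lam X) = lam ^ 2 * p.slope := by
      rw [empiricalRisk_eq, h2, ← hR, dotProduct_mulVec, vecMul_mulVec, ← dotProduct_mulVec,
        dotProduct_comm, mulVec_mulVec, hU2, RidgeProfile.slope, Finset.mul_sum, dotProduct]
      refine Finset.sum_congr rfl fun i _ => ?_
      rw [mulVec_diagonal]
      change s i * (lam / (lam + s i) * (Uᵀ *ᵥ β) i) * (lam / (lam + s i) * (Uᵀ *ᵥ β) i)
        = lam ^ 2 * ((Uᵀ *ᵥ β) i ^ 2 * s i / (lam + s i) ^ 2)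
      have h6 := hs0 i
      have h7 : 0 < lam + s i := by linarith
      field_simp
    have h4 := sampleStieltjes_pos X hN hlam
    rw [gcv_eq X β, h3, RidgeProfile.gcv, h1]
    field_simp
  refine ⟨p, rfl, rfl, hst', hst0, hbias, hpath, ?_, ?_, hgcv, ?_⟩
  · have h1 : U * Uᵀ = 1 := mul_eq_one_comm.1 hU1
    calc ∑ i, (Uᵀ *ᵥ β) i ^ 2 = (Uᵀ *ᵥ β) ⬝ᵥ (Uᵀ *ᵥ β) := by
          rw [dotProduct]
          exact Finset.sum_congr rfl fun i _ => sq _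
      _ = β ⬝ᵥ β := by
          rw [dotProduct_mulVec, vecMul_transpose, mulVec_mulVec, h1, one_mulVec]
  · rw [sub_ridgeEstimator_eq X β hlam, ← hR, ← hM, conj_inv_eq hTM, ← mulVec_mulVec,
      dotProduct_mulVec, vecMul_mulVec, ← dotProduct_mulVec, dotProduct_comm, mulVec_mulVec, hTQ,
      dotProduct, RidgeProfile.risk]
    refine Finset.sum_congr rfl fun i _ => ?_
    rw [mulVec_diagonal]
    change (Tᵀ *ᵥ β) i ^ 2 * y i = _
    ring
  · have h1 : p.stieltjes 0 = sampleStieltjes X lam := hst0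
    have h4 := sampleStieltjes_pos X hN hlam
    rw [RidgeProfile.gcv, h1, sq, ← div_div]
    gcongr
    rw [div_le_iff₀ h4]
    simp only [RidgeProfile.slope, RidgeProfile.path]
    rw [← Finset.sum_sub_distrib, Finset.mul_sum, Finset.sum_mul]
    refine Finset.sum_le_sum fun i _ => ?_
    change (Uᵀ *ᵥ β) i ^ 2 * s i / (lam + s i) ^ 2
      ≤ N * ((Uᵀ *ᵥ β) i ^ 2 - (Uᵀ *ᵥ β) i ^ 2 * lam / (lam + s i)) * sampleStieltjes X lam
    -- A zero eigenvalue contributes to neither side. For a nonzero one, one of the two factors `1 /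
    -- (lam + s i)` is a single term of the sum defining `N * sampleStieltjes X lam`.
    by_cases hsi : s i = 0
    · simp [hsi, hlam.ne']
    · have h5 := one_div_le_sampleStieltjes X hN hlam hsi
      have h6 := hs0 i
      have h7 : 0 < lam + s i := by linarith
      calc (Uᵀ *ᵥ β) i ^ 2 * s i / (lam + s i) ^ 2
          = (Uᵀ *ᵥ β) i ^ 2 * s i / (lam + s i) * (1 / (lam + s i)) := by
            rw [sq (lam + s i), ← div_div]
            ring
        _ ≤ (Uᵀ *ᵥ β) i ^ 2 * s i / (lam + s i) * (N * sampleStieltjes X lam) := by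
            gcongr
        _ = _ := by
            field_simp
            ring

end profile

/-! ### Linear images of distributions -/

section linearImage

variable {P : ℕ} {𝒟 : Measure (Fin P → ℝ)}

theorem measurable_mulVec (A : Matrix (Fin P) (Fin P) ℝ) :
    Measurable fun x : Fin P → ℝ => A *ᵥ x :=
  (Continuous.matrix_mulVec continuous_const continuous_id).measurable

theorem memLp_linearImage (h𝒟 : ∀ j, MemLp (fun x : Fin P → ℝ => x j) 2 𝒟)
    (A : Matrix (Fin P) (Fin P) ℝ) (j : Fin P) :
    MemLp (fun x : Fin P → ℝ => x j) 2 (linearImage A 𝒟) := by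
  rw [linearImage, memLp_map_measure_iff (measurable_pi_apply j).aestronglyMeasurable
    (measurable_mulVec A).aemeasurable]
  have e : (fun x : Fin P → ℝ => x j) ∘ (fun x => A *ᵥ x) = fun x => ∑ k, A j k * x k := by
    funext x
    rfl
  rw [e]
  exact memLp_finsetSum _ fun k _ => (h𝒟 k).const_mul (A j k)

theorem secondMoment_linearImage (h𝒟 : ∀ j, MemLp (fun x : Fin P → ℝ => x j) 2 𝒟)
    (A : Matrix (Fin P) (Fin P) ℝ) :
    secondMoment (linearImage A 𝒟) = A * secondMoment 𝒟 * Aᵀ := by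
  ext i j
  have hint : ∀ i j, Integrable (fun x : Fin P → ℝ => x i * x j) 𝒟 := fun i j =>
    (h𝒟 i).integrable_mul (h𝒟 j)
  have h1 : secondMoment (linearImage A 𝒟) i j = ∫ x, (A *ᵥ x) i * (A *ᵥ x) j ∂𝒟 := by
    rw [secondMoment, of_apply, linearImage, integral_map (measurable_mulVec A).aemeasurable]
    exact ((measurable_pi_apply i).mul (measurable_pi_apply j)).aestronglyMeasurable
  have e : ∀ x : Fin P → ℝ, (A *ᵥ x) i * (A *ᵥ x) j
      = ∑ k, ∑ l, A i l * A j k * (x l * x k) := by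
    intro x
    rw [mulVec, mulVec, dotProduct, dotProduct, Finset.sum_mul_sum, Finset.sum_comm]
    exact Finset.sum_congr rfl fun k _ => Finset.sum_congr rfl fun l _ => by ring
  rw [h1]
  simp_rw [e]
  rw [integral_finsetSum _ fun k _ => integrable_finsetSum _ fun l _ => (hint l k).const_mul _,
    mul_apply]
  refine Finset.sum_congr rfl fun k _ => ?_
  rw [integral_finsetSum _ fun l _ => (hint l k).const_mul _, mul_apply, Finset.sum_mul]
  refine Finset.sum_congr rfl fun l _ => ?_
  rw [integral_const_mul, transpose_apply, secondMoment, of_apply]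
  ring

theorem generalizationRisk_eq (h𝒟 : ∀ j, MemLp (fun x : Fin P → ℝ => x j) 2 𝒟)
    (β b : Fin P → ℝ) :
    generalizationRisk 𝒟 β b = (β - b) ⬝ᵥ (secondMoment 𝒟 *ᵥ (β - b)) := by
  have hint : ∀ i j, Integrable (fun x : Fin P → ℝ => x i * x j) 𝒟 := fun i j =>
    (h𝒟 i).integrable_mul (h𝒟 j)
  have e : ∀ x : Fin P → ℝ, (β ⬝ᵥ x - b ⬝ᵥ x) ^ 2
      = ∑ i, ∑ j, (β - b) i * (β - b) j * (x i * x j) := by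
    intro x
    rw [← sub_dotProduct, sq, dotProduct, Finset.sum_mul_sum]
    exact Finset.sum_congr rfl fun i _ => Finset.sum_congr rfl fun j _ => by ring
  rw [generalizationRisk]
  simp_rw [e]
  rw [integral_finsetSum _ fun i _ => integrable_finsetSum _ fun j _ => (hint i j).const_mul _]
  simp only [dotProduct, mulVec, Finset.mul_sum]
  refine Finset.sum_congr rfl fun i _ => ?_
  rw [integral_finsetSum _ fun j _ => (hint i j).const_mul _]
  refine Finset.sum_congr rfl fun j _ => ?_
  rw [integral_const_mul]
  simp only [secondMoment, Matrix.of_apply]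
  ring

end linearImage

/-! ### The effective regularization -/

section effectiveReg

variable {P : ℕ} {𝒟 : Measure (Fin P → ℝ)}

theorem isEffectiveReg_effectiveReg (h𝒟 : ∀ j, MemLp (fun x : Fin P → ℝ => x j) 2 𝒟) {N : ℕ}
    {l : ℝ} (hl : 0 < l) : IsEffectiveReg 𝒟 N l (effectiveReg 𝒟 N l) :=
  Classical.epsilon_spec (existsUnique_isEffectiveReg 𝒟 h𝒟 hl).exists

theorem effectiveReg_eq (h𝒟 : ∀ j, MemLp (fun x : Fin P → ℝ => x j) 2 𝒟) {N : ℕ}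
    {l k : ℝ} (hl : 0 < l) (hk : IsEffectiveReg 𝒟 N l k) : effectiveReg 𝒟 N l = k :=
  (existsUnique_isEffectiveReg 𝒟 h𝒟 hl).unique (isEffectiveReg_effectiveReg h𝒟 hl) hk

/-- `κ(l) / l` is decreasing in `l`. -/
theorem effectiveReg_le_mul (h𝒟 : ∀ j, MemLp (fun x : Fin P → ℝ => x j) 2 𝒟) {N : ℕ}
    {l l' : ℝ} (hl : 0 < l) (hll : l ≤ l') :
    effectiveReg 𝒟 N l' ≤ effectiveReg 𝒟 N l * (l' / l) := by
  obtain ⟨hk, hk1⟩ := isEffectiveReg_effectiveReg h𝒟 (N := N) hl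
  obtain ⟨hk', hk1'⟩ := isEffectiveReg_effectiveReg h𝒟 (N := N) (hl.trans_le hll)
  set k := effectiveReg 𝒟 N l
  set k' := effectiveReg 𝒟 N l'
  have hnn : ∀ i, 0 ≤ (secondMoment_isHermitian 𝒟).eigenvalues i :=
    (secondMoment_posSemidef 𝒟 h𝒟).eigenvalues_nonneg
  by_contra hcon
  push Not at hcon
  have hl' : 0 < l' := hl.trans_le hll
  have h1 : l' / k' < l / k := by
    rw [div_lt_div_iff₀ hk' hk]
    rw [mul_div_assoc', div_lt_iff₀ hl] at hcon
    linarith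
  have hkk : k ≤ k' := by
    refine le_trans ?_ hcon.le
    exact le_mul_of_one_le_right hk.le ((one_le_div hl).2 hll)
  have h2 : ∑ i, (secondMoment_isHermitian 𝒟).eigenvalues i /
      (k' + (secondMoment_isHermitian 𝒟).eigenvalues i) ≤
      ∑ i, (secondMoment_isHermitian 𝒟).eigenvalues i /
      (k + (secondMoment_isHermitian 𝒟).eigenvalues i) := by
    refine Finset.sum_le_sum fun i _ => ?_
    have := hnn i
    gcongr
  have h3 := mul_le_mul_of_nonneg_left h2 (show (0 : ℝ) ≤ 1 / (N : ℝ) by positivity)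
  linarith

/-- Monotonicity of `κ(l) / l` bounds the right difference quotients. Differentiability of `κ` need
not be established: where it fails, `deriv` is `0` and the bound is trivial. -/
theorem deriv_effectiveReg_le (h𝒟 : ∀ j, MemLp (fun x : Fin P → ℝ => x j) 2 𝒟) {N : ℕ}
    {l : ℝ} (hl : 0 < l) : deriv (effectiveReg 𝒟 N) l ≤ effectiveReg 𝒟 N l / l := by
  have hk := (isEffectiveReg_effectiveReg h𝒟 (N := N) hl).1
  by_cases hd : DifferentiableAt ℝ (effectiveReg 𝒟 N) l
  · have h1 := hd.hasDerivAt.hasDerivWithinAt (s := Set.Ioi l)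
    rw [hasDerivWithinAt_iff_tendsto_slope' (by simp)] at h1
    refine le_of_tendsto h1 ?_
    filter_upwards [self_mem_nhdsWithin] with x hx
    rw [Set.mem_Ioi] at hx
    rw [slope_def_field, div_le_iff₀ (by linarith)]
    have h2 := effectiveReg_le_mul h𝒟 (N := N) hl hx.le
    have e : effectiveReg 𝒟 N l / l * (x - l) = effectiveReg 𝒟 N l * (x / l) - effectiveReg 𝒟 N l := by
      field_simp
    linarith
  · rw [deriv_zero_of_not_differentiableAt hd]
    positivity

/-- Replaces the derivative in the error of the local law by the explicit `κ / l`. No sign of the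
derivative is needed, as the root of a negative number is `0`. -/
theorem mpScale_le (h𝒟 : ∀ j, MemLp (fun x : Fin P → ℝ => x j) 2 𝒟) {N : ℕ}
    {l : ℝ} (hl : 0 < l) : mpScale 𝒟 N l ≤ √(1 / effectiveReg 𝒟 N l / l) := by
  have hk := (isEffectiveReg_effectiveReg h𝒟 (N := N) hl).1
  refine Real.le_sqrt_of_sq_le ?_
  have h1 : √(deriv (effectiveReg 𝒟 N) l) ^ 2 ≤ effectiveReg 𝒟 N l / l := by
    rcases le_or_gt 0 (deriv (effectiveReg 𝒟 N) l) with h | h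
    · rw [Real.sq_sqrt h]
      exact deriv_effectiveReg_le h𝒟 hl
    · rw [Real.sqrt_eq_zero_of_nonpos h.le, zero_pow two_ne_zero]
      positivity
  rw [mpScale, mul_pow]
  calc _ ≤ (1 / effectiveReg 𝒟 N l) ^ 2 * (effectiveReg 𝒟 N l / l) := by gcongr
    _ = _ := by field_simp

end effectiveReg

/-! ### The population equation -/

section population

variable {P : ℕ} {Q : Matrix (Fin P) (Fin P) ℝ}

theorem smul_inv_smul {A : Matrix (Fin P) (Fin P) ℝ} (hA : IsUnit A.det) {c : ℝ} (hc : c ≠ 0) :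
    c • (c • A)⁻¹ = A⁻¹ := by
  have : (c • A)⁻¹ = c⁻¹ • A⁻¹ := by
    refine inv_eq_right_inv ?_
    rw [Matrix.smul_mul, Matrix.mul_smul, smul_smul, mul_inv_cancel₀ hc, one_smul,
      mul_nonsing_inv _ hA]
  rw [this, smul_smul, mul_inv_cancel₀ hc, one_smul]

theorem trace_mul_inv_add_smul (hQ : Q.PosSemidef) {m w : ℝ}
    (hw : ∀ i, 0 < m + w * hQ.isHermitian.eigenvalues i) :
    (Q * (m • 1 + w • Q)⁻¹).trace = ∑ i, hQ.isHermitian.eigenvalues i /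
      (m + w * hQ.isHermitian.eigenvalues i) := by
  obtain ⟨U, hU1, hU2⟩ := exists_orthogonal_diagonalization hQ.isHermitian
  rw [inv_add_smul_eq (M := 1) (T := U) (by rw [mul_one, hU1]) hU2 fun i => (hw i).ne',
    trace_mul_conj_diagonal, hU2]
  refine Finset.sum_congr rfl fun i _ => ?_
  rw [diagonal_apply_eq, mul_one_div]

/-- The averaged resolvent `(1/N) tr(Q (1 + w Q)⁻¹)`. -/
noncomputable def meanResolvent (hQ : Q.PosSemidef) (N : ℕ) (w : ℝ) : ℝ :=
  1 / (N : ℝ) * ∑ i, hQ.isHermitian.eigenvalues i / (1 + w * hQ.isHermitian.eigenvalues i)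

theorem one_add_smul_add_smul_pos (hQ : Q.PosSemidef) {t u : ℝ} (ht : |t| * opNorm Q < 1 / 2)
    (hu : 0 ≤ u) (i : Fin P) : 0 < 1 + (t + u) * hQ.isHermitian.eigenvalues i := by
  have h1 := hQ.eigenvalues_nonneg i
  have h2 := one_add_mul_pos ht h1 (eigenvalues_le_opNorm hQ.isHermitian i)
  have h3 := mul_nonneg hu h1
  have e : 1 + (t + u) * hQ.isHermitian.eigenvalues i
    = 1 + t * hQ.isHermitian.eigenvalues i + u * hQ.isHermitian.eigenvalues i := by ring
  rw [e]
  exact add_pos_of_pos_of_nonneg h2 h3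

variable {𝒟 : Measure (Fin P → ℝ)}

/-- The distribution of `(1 + t Σ) ^ (-1/2) x`. -/
noncomputable def whitened (𝒟 : Measure (Fin P → ℝ)) (t : ℝ) : Measure (Fin P → ℝ) :=
  linearImage (invSqrt (1 + t • secondMoment 𝒟)) 𝒟

theorem memLp_whitened (h𝒟 : ∀ j, MemLp (fun x : Fin P → ℝ => x j) 2 𝒟) (t : ℝ) (j : Fin P) :
    MemLp (fun x : Fin P → ℝ => x j) 2 (whitened 𝒟 t) := memLp_linearImage h𝒟 _ j

theorem secondMoment_whitened (h𝒟 : ∀ j, MemLp (fun x : Fin P → ℝ => x j) 2 𝒟) (t : ℝ) :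
    secondMoment (whitened 𝒟 t) = invSqrt (1 + t • secondMoment 𝒟) * secondMoment 𝒟 *
      invSqrt (1 + t • secondMoment 𝒟) := by
  rw [whitened, secondMoment_linearImage h𝒟, invSqrt_transpose]

/-- The eigenvalues of the whitened second moment enter only through a trace, which
`trace_conj_resolvent` rewrites in terms of `Σ`. In the variable `u = 1 / κ` the perturbation then
appears only in the combination `t + u`. -/
theorem isEffectiveReg_whitened_iff (h𝒟 : ∀ j, MemLp (fun x : Fin P → ℝ => x j) 2 𝒟) {N : ℕ}
    {t l u : ℝ} (ht : |t| * opNorm (secondMoment 𝒟) < 1 / 2) (hu : 0 < u) :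
    IsEffectiveReg (whitened 𝒟 t) N l (1 / u) ↔
      1 = u * (l + meanResolvent (secondMoment_posSemidef 𝒟 h𝒟) N (t + u)) := by
  set hQ := secondMoment_posSemidef 𝒟 h𝒟 with hQdef
  have hQt := secondMoment_posSemidef _ (memLp_whitened h𝒟 t)
  have hk : 0 < 1 / u := by positivity
  have h1 : ∑ i, hQt.isHermitian.eigenvalues i / (1 / u + hQt.isHermitian.eigenvalues i)
      = u * ∑ i, hQ.isHermitian.eigenvalues i / (1 + (t + u) * hQ.isHermitian.eigenvalues i) := by
    have h2 := trace_mul_inv_add_smul hQt (m := 1 / u) (w := 1) (fun i => by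
      have := hQt.eigenvalues_nonneg i
      positivity)
    simp only [one_mul] at h2
    rw [one_smul] at h2
    rw [← h2, secondMoment_whitened h𝒟,
      trace_conj_resolvent (invSqrt_mul_self_mul (posDef_one_add_smul hQ ht))]
    have e : (1 / u) • (1 + t • secondMoment 𝒟) + secondMoment 𝒟
        = (1 / u) • (1 : Matrix (Fin P) (Fin P) ℝ) + ((1 / u) * (t + u)) • secondMoment 𝒟 := by
      rw [smul_add, smul_smul, mul_add, one_div_mul_cancel hu.ne', add_smul, one_smul]
      abel
    have e2 : ∀ i, 1 / u + 1 / u * (t + u) * hQ.isHermitian.eigenvalues i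
        = 1 / u * (1 + (t + u) * hQ.isHermitian.eigenvalues i) := fun i => by ring
    rw [e, trace_mul_inv_add_smul hQ (fun i => by
      rw [e2]
      exact mul_pos hk (one_add_smul_add_smul_pos hQ ht hu.le i)), Finset.mul_sum]
    refine Finset.sum_congr rfl fun i _ => ?_
    have := one_add_smul_add_smul_pos hQ ht hu.le i
    rw [e2]
    field_simp
  change 0 < 1 / u ∧ 1 = l / (1 / u) + (1 / (N : ℝ)) * ∑ i, hQt.isHermitian.eigenvalues i /
    (1 / u + hQt.isHermitian.eigenvalues i) ↔ _
  rw [h1, meanResolvent]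
  have e : l / (1 / u) + (1 / (N : ℝ)) * (u * ∑ i, hQ.isHermitian.eigenvalues i /
      (1 + (t + u) * hQ.isHermitian.eigenvalues i)) = u * (l + 1 / (N : ℝ) *
        ∑ i, hQ.isHermitian.eigenvalues i / (1 + (t + u) * hQ.isHermitian.eigenvalues i)) := by
    rw [div_div_eq_mul_div, div_one]
    ring
  rw [e]
  exact ⟨fun h => h.2, fun h => ⟨hk, h⟩⟩

/-- The inverse of the effective regularization of `(1 + t Σ) ^ (-1/2) x`. -/
noncomputable def dualReg (𝒟 : Measure (Fin P → ℝ)) (N : ℕ) (t l : ℝ) : ℝ :=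
  1 / effectiveReg (whitened 𝒟 t) N l

theorem dualReg_pos (h𝒟 : ∀ j, MemLp (fun x : Fin P → ℝ => x j) 2 𝒟) (N : ℕ) (t : ℝ) {l : ℝ}
    (hl : 0 < l) : 0 < dualReg 𝒟 N t l :=
  one_div_pos.2 (isEffectiveReg_effectiveReg (memLp_whitened h𝒟 t) hl).1

theorem dualReg_spec (h𝒟 : ∀ j, MemLp (fun x : Fin P → ℝ => x j) 2 𝒟) {N : ℕ} {t l : ℝ}
    (ht : |t| * opNorm (secondMoment 𝒟) < 1 / 2) (hl : 0 < l) :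
    1 = dualReg 𝒟 N t l *
      (l + meanResolvent (secondMoment_posSemidef 𝒟 h𝒟) N (t + dualReg 𝒟 N t l)) := by
  rw [← isEffectiveReg_whitened_iff h𝒟 ht (dualReg_pos h𝒟 N t hl), dualReg, one_div_one_div]
  exact isEffectiveReg_effectiveReg (memLp_whitened h𝒟 t) hl

theorem dualReg_eq (h𝒟 : ∀ j, MemLp (fun x : Fin P → ℝ => x j) 2 𝒟) {N : ℕ} {t l u : ℝ}
    (ht : |t| * opNorm (secondMoment 𝒟) < 1 / 2) (hl : 0 < l) (hu : 0 < u)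
    (h : 1 = u * (l + meanResolvent (secondMoment_posSemidef 𝒟 h𝒟) N (t + u))) :
    dualReg 𝒟 N t l = u := by
  rw [dualReg, effectiveReg_eq (memLp_whitened h𝒟 t) hl
    ((isEffectiveReg_whitened_iff h𝒟 ht hu).2 h), one_div_one_div]

theorem mpScale_whitened_le (h𝒟 : ∀ j, MemLp (fun x : Fin P → ℝ => x j) 2 𝒟) {N : ℕ} {t l c : ℝ}
    (hl : 0 < l) (hc : 0 ≤ c) (h : dualReg 𝒟 N t l ≤ c ^ 2 * l) :
    mpScale (whitened 𝒟 t) N l ≤ c := by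
  refine (mpScale_le (memLp_whitened h𝒟 t) hl).trans ?_
  rw [Real.sqrt_le_left hc, div_le_iff₀ hl]
  exact h

/-- Monotonicity of the fixed-point equation. If `u < u₀ / 2`, then `u ≤ u₀ (1 + t λᵢ)`, since `1 +
t λᵢ ≥ 1/2`, so every term `u λᵢ / (1 + (t + u) λᵢ)` is at most `u₀ λᵢ / (1 + u₀ λᵢ)`; as also `u l
< u₀ l`, the two sides cannot both equal `1`. The upper bound is symmetric. -/
theorem dualReg_bounds (h𝒟 : ∀ j, MemLp (fun x : Fin P → ℝ => x j) 2 𝒟) {N : ℕ} {t l : ℝ}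
    (ht : |t| * opNorm (secondMoment 𝒟) < 1 / 2) (hl : 0 < l) :
    dualReg 𝒟 N 0 l / 2 ≤ dualReg 𝒟 N t l ∧ dualReg 𝒟 N t l ≤ 2 * dualReg 𝒟 N 0 l := by
  set hQ := secondMoment_posSemidef 𝒟 h𝒟 with hQdef
  have h0 : |(0 : ℝ)| * opNorm (secondMoment 𝒟) < 1 / 2 := by simp
  have hu0 := dualReg_pos h𝒟 N 0 hl
  have hu := dualReg_pos h𝒟 N t hl
  have e0 := dualReg_spec h𝒟 (N := N) h0 hl
  have e := dualReg_spec h𝒟 (N := N) ht hl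
  set u := dualReg 𝒟 N t l
  set u₀ := dualReg 𝒟 N 0 l
  rw [zero_add] at e0
  have hev := hQ.eigenvalues_nonneg
  have hty : ∀ i, |t * hQ.isHermitian.eigenvalues i| ≤ 1 / 2 := fun i => by
    rw [abs_mul, abs_of_nonneg (hev i)]
    exact (mul_le_mul_of_nonneg_left (eigenvalues_le_opNorm hQ.isHermitian i)
      (abs_nonneg t)).trans ht.le
  have hpos0 : ∀ i, 0 < 1 + u₀ * hQ.isHermitian.eigenvalues i := fun i => by
    have := hev i
    positivity
  have hpos := one_add_smul_add_smul_pos hQ ht hu.le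
  have hN : (0 : ℝ) ≤ 1 / (N : ℝ) := by positivity
  constructor
  · by_contra hcon
    push Not at hcon
    have h1 : u * meanResolvent hQ N (t + u) ≤ u₀ * meanResolvent hQ N u₀ := by
      rw [meanResolvent, meanResolvent, mul_left_comm, mul_left_comm u₀,
        Finset.mul_sum _ _ u, Finset.mul_sum _ _ u₀]
      refine mul_le_mul_of_nonneg_left (Finset.sum_le_sum fun i _ => ?_) hN
      have h2 := (abs_le.1 (hty i)).1
      have h3 := hev i
      rw [mul_div_assoc', mul_div_assoc', div_le_div_iff₀ (hpos i) (hpos0 i)]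
      have h4 : u ≤ u₀ * (1 + t * hQ.isHermitian.eigenvalues i) := by nlinarith
      have h5 := mul_le_mul_of_nonneg_right h4 h3
      linear_combination h5
    have h2 : u * l < u₀ * l := by
      refine mul_lt_mul_of_pos_right ?_ hl
      linarith
    linarith
  · by_contra hcon
    push Not at hcon
    have h1 : u₀ * meanResolvent hQ N u₀ ≤ u * meanResolvent hQ N (t + u) := by
      rw [meanResolvent, meanResolvent, mul_left_comm, mul_left_comm u,
        Finset.mul_sum _ _ u, Finset.mul_sum _ _ u₀]
      refine mul_le_mul_of_nonneg_left (Finset.sum_le_sum fun i _ => ?_) hN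
      have h2 := (abs_le.1 (hty i)).2
      have h3 := hev i
      rw [mul_div_assoc', mul_div_assoc', div_le_div_iff₀ (hpos0 i) (hpos i)]
      have h4 : u₀ * (1 + t * hQ.isHermitian.eigenvalues i) ≤ u := by nlinarith
      have h5 := mul_le_mul_of_nonneg_right h4 h3
      linear_combination h5
    have h2 : u₀ * l < u * l := by
      refine mul_lt_mul_of_pos_right ?_ hl
      linarith
    linarith

/-- The characteristics: shifting the perturbation to `0` amounts to changing the
regularization. -/
theorem dualReg_zero_eq (h𝒟 : ∀ j, MemLp (fun x : Fin P → ℝ => x j) 2 𝒟) {N : ℕ} {t l : ℝ}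
    (ht : |t| * opNorm (secondMoment 𝒟) < 1 / 2) (hl : 0 < l) (hw : 0 < t + dualReg 𝒟 N t l)
    (hl' : 0 < l - t / (dualReg 𝒟 N t l * (t + dualReg 𝒟 N t l))) :
    dualReg 𝒟 N 0 (l - t / (dualReg 𝒟 N t l * (t + dualReg 𝒟 N t l))) = t + dualReg 𝒟 N t l := by
  refine dualReg_eq h𝒟 (by simp) hl' hw ?_
  have hu := dualReg_pos h𝒟 N t hl
  have e := dualReg_spec h𝒟 (N := N) ht hl
  set u := dualReg 𝒟 N t l
  rw [zero_add]
  -- The equation at `(t, l)` determines the mean resolvent at `w = t + u`. Inserted into the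
  -- equation at `(0, l')` it asks for `l' = l + 1/w - 1/u`, which is the stated shift.
  have h1 : meanResolvent (secondMoment_posSemidef 𝒟 h𝒟) N (t + u) = 1 / u - l := by
    rw [eq_sub_iff_add_eq, eq_div_iff hu.ne']
    linarith
  rw [h1]
  field_simp
  ring

/-- In terms of `κ = 1 / u` this is `l ≤ κ ≤ l + tr Σ / N`, because the mean resolvent lies between
`0` and `tr Σ / N`. -/
theorem mul_dualReg_le (h𝒟 : ∀ j, MemLp (fun x : Fin P → ℝ => x j) 2 𝒟) {N : ℕ} {l : ℝ}
    (hl : 0 < l) : l * dualReg 𝒟 N 0 l ≤ 1 ∧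
      1 ≤ dualReg 𝒟 N 0 l * (l + (secondMoment 𝒟).trace / N) := by
  set hQ := secondMoment_posSemidef 𝒟 h𝒟 with hQdef
  have hu := dualReg_pos h𝒟 N 0 hl
  have e := dualReg_spec h𝒟 (N := N) (t := 0) (by simp) hl
  set u := dualReg 𝒟 N 0 l
  rw [zero_add] at e
  have hev := hQ.eigenvalues_nonneg
  have h1 : 0 ≤ meanResolvent hQ N u := by
    refine mul_nonneg (by positivity) (Finset.sum_nonneg fun i _ => ?_)
    have := hev i
    positivity
  have h2 : meanResolvent hQ N u ≤ (secondMoment 𝒟).trace / N := by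
    rw [meanResolvent, hQ.isHermitian.trace_eq_sum_eigenvalues, one_div, div_eq_inv_mul]
    refine mul_le_mul_of_nonneg_left (Finset.sum_le_sum fun i _ => ?_)
      (inv_nonneg.2 (Nat.cast_nonneg N))
    have h3 := hev i
    refine div_le_self h3 ?_
    have := mul_nonneg hu.le h3
    linarith
  constructor
  · nlinarith
  · rw [e]
    exact mul_le_mul_of_nonneg_left (by linarith) hu.le

/-- The population bias `βᵀ (1 + w Q)⁻¹ β`. -/
noncomputable def popBias (Q : Matrix (Fin P) (Fin P) ℝ) (β : Fin P → ℝ) (w : ℝ) : ℝ :=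
  β ⬝ᵥ ((1 + w • Q)⁻¹ *ᵥ β)

/-- `1 - x ≤ 1 / (1 + x) ≤ 1` in the eigenbasis. The lower bound is how the signal strength `βᵀ Σ β`
enters the a priori estimates. -/
theorem popBias_bounds (hQ : Q.PosSemidef) (β : Fin P → ℝ) {w : ℝ} (hw : 0 ≤ w) :
    β ⬝ᵥ β - w * (β ⬝ᵥ (Q *ᵥ β)) ≤ popBias Q β w ∧ popBias Q β w ≤ β ⬝ᵥ β := by
  obtain ⟨U, hU1, hU2⟩ := exists_orthogonal_diagonalization hQ.isHermitian
  have hU3 : U * Uᵀ = 1 := mul_eq_one_comm.1 hU1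
  have hev := hQ.eigenvalues_nonneg
  have h1 : popBias Q β w = ∑ i, (Uᵀ *ᵥ β) i ^ 2 *
      (1 / (1 + w * hQ.isHermitian.eigenvalues i)) := by
    have := inv_add_smul_eq (M := 1) (T := U) (m := 1) (t := w) (by rw [mul_one, hU1]) hU2
      (fun i => by have := hev i; positivity)
    rw [one_smul] at this
    rw [popBias, this, dotProduct_conj_diagonal_mulVec]
  have h2 : β ⬝ᵥ β = ∑ i, (Uᵀ *ᵥ β) i ^ 2 := by
    have := dotProduct_conj_diagonal_mulVec (T := U) (fun _ => (1 : ℝ)) β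
    rw [diagonal_one, mul_one, hU3, one_mulVec] at this
    simpa using this
  have h3 : β ⬝ᵥ (Q *ᵥ β) = ∑ i, (Uᵀ *ᵥ β) i ^ 2 * hQ.isHermitian.eigenvalues i := by
    have e : Q = U * diagonal hQ.isHermitian.eigenvalues * Uᵀ := by
      rw [← hU2]
      calc Q = U * Uᵀ * Q * (U * Uᵀ) := by rw [hU3, one_mul, mul_one]
        _ = _ := by simp only [mul_assoc]
    rw [← dotProduct_conj_diagonal_mulVec, ← e]
  rw [h1, h2, h3, Finset.mul_sum, ← Finset.sum_sub_distrib]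
  constructor <;> refine Finset.sum_le_sum fun i _ => ?_
  · have h4 := mul_nonneg hw (hev i)
    have h5 : 1 - w * hQ.isHermitian.eigenvalues i ≤ 1 / (1 + w * hQ.isHermitian.eigenvalues i) := by
      rw [le_div_iff₀ (by linarith)]
      nlinarith
    have := mul_le_mul_of_nonneg_left h5 (sq_nonneg ((Uᵀ *ᵥ β) i))
    linarith
  · have h4 := mul_nonneg hw (hev i)
    refine mul_le_of_le_one_right (sq_nonneg _) ?_
    rw [div_le_one (by linarith)]
    linarith

end population

section deterministic

variable {P : ℕ} {𝒟 : Measure (Fin P → ℝ)}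

/-! ### A lower bound for the empirical Stieltjes transform -/

/-- With `x = X i`, `z = (l + Σ̂)⁻¹ x` and `y = zᵀ x`, one has `y = l |z|² + zᵀ Σ̂ z`.
Cauchy–Schwarz bounds `|z|²` below by `y² / |x|²`, and keeping only the `i`-th sample in `Σ̂` bounds
the last term below by `y² / N`. -/
theorem mul_quadratic_resolvent_le {N : ℕ} (X : Fin N → Fin P → ℝ) {l : ℝ} (hl : 0 < l) (i : Fin N) :
    (X i ⬝ᵥ ((l • 1 + sampleSecondMoment X)⁻¹ *ᵥ X i)) * (l + (X i ⬝ᵥ X i) / N)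
      ≤ X i ⬝ᵥ X i := by
  set R := sampleSecondMoment X with hR
  have hRpsd : R.PosSemidef := sampleSecondMoment_posSemidef X
  have hu : IsUnit (l • (1 : Matrix (Fin P) (Fin P) ℝ) + R).det :=
    ((PosDef.one.smul hl).add_posSemidef hRpsd).det_pos.ne'.isUnit
  set z := (l • 1 + R)⁻¹ *ᵥ X i with hz
  have hz1 : (l • 1 + R) *ᵥ z = X i := by
    rw [hz, mulVec_mulVec, mul_nonsing_inv _ hu, one_mulVec]
  have hy : z ⬝ᵥ X i = l * (z ⬝ᵥ z) + z ⬝ᵥ (R *ᵥ z) := by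
    conv_lhs => rw [← hz1]
    rw [add_mulVec, smul_mulVec, one_mulVec, dotProduct_add, dotProduct_smul, smul_eq_mul]
  have h1 : (z ⬝ᵥ X i) ^ 2 / N ≤ z ⬝ᵥ (R *ᵥ z) := by
    rw [hR, sampleSecondMoment_bilin, div_eq_inv_mul, ← one_div]
    refine mul_le_mul_of_nonneg_left ?_ (one_div_nonneg.2 (Nat.cast_nonneg N))
    have := Finset.single_le_sum (f := fun j => (z ⬝ᵥ X j) * (z ⬝ᵥ X j))
      (fun j _ => mul_self_nonneg _) (Finset.mem_univ i)
    simpa [sq] using this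
  have h2 : (z ⬝ᵥ X i) ^ 2 ≤ (z ⬝ᵥ z) * (X i ⬝ᵥ X i) := by
    have := Finset.sum_mul_sq_le_sq_mul_sq Finset.univ z (X i)
    simpa [dotProduct, sq] using this
  have h3 : 0 ≤ X i ⬝ᵥ X i := by simpa using dotProduct_star_self_nonneg (X i)
  have h4 : 0 ≤ z ⬝ᵥ z := by simpa using dotProduct_star_self_nonneg z
  have h5 : 0 ≤ (z ⬝ᵥ X i) ^ 2 / N := by positivity
  rw [dotProduct_comm]
  set y := z ⬝ᵥ X i
  set m := X i ⬝ᵥ X i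
  have hy0 : 0 ≤ y := by
    have := mul_nonneg hl.le h4
    linarith
  rcases hy0.eq_or_lt with h0 | hpos
  · rw [← h0, zero_mul]
    exact h3
  · refine le_of_mul_le_mul_left ?_ hpos
    have h6 : y * m ≥ (l * (z ⬝ᵥ z) + y ^ 2 / N) * m :=
      mul_le_mul_of_nonneg_right (by linarith) h3
    have h7 := mul_le_mul_of_nonneg_left h2 hl.le
    calc y * (y * (l + m / N)) = l * y ^ 2 + y ^ 2 / N * m := by ring
      _ ≤ _ := by linarith

/-- The trace in `sampleStieltjes_eq` is the average of the quadratic forms of the previous lemma.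
The bound holds for every sample and involves no local law. -/
theorem sum_one_div_le_sampleStieltjes {N : ℕ} (X : Fin N → Fin P → ℝ) (hN : 0 < N) {l : ℝ}
    (hl : 0 < l) :
    1 / (N : ℝ) * ∑ i, 1 / (l + (X i ⬝ᵥ X i) / N) ≤ sampleStieltjes X l := by
  have hN' : (0 : ℝ) < N := by exact_mod_cast hN
  set W := (l • 1 + sampleSecondMoment X)⁻¹ with hW
  have htr : (sampleSecondMoment X * W).trace = 1 / (N : ℝ) * ∑ i, X i ⬝ᵥ (W *ᵥ X i) := by
    rw [sampleSecondMoment, Matrix.smul_mul, trace_smul, Matrix.mul_assoc, trace_mul_comm,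
      smul_eq_mul, one_div, trace]
    congr 1
    refine Finset.sum_congr rfl fun i _ => ?_
    rw [dotProduct_mulVec]
    rfl
  rw [sampleStieltjes_eq X hN hl, ← hW, htr]
  have e : 1 / l - 1 / (N * l) * (1 / (N : ℝ) * ∑ i, X i ⬝ᵥ (W *ᵥ X i))
      = 1 / (N : ℝ) * ∑ i, (1 / l - 1 / (N * l) * (X i ⬝ᵥ (W *ᵥ X i))) := by
    rw [Finset.sum_sub_distrib, ← Finset.mul_sum, Finset.sum_const, Finset.card_univ,
      Fintype.card_fin, nsmul_eq_mul]
    field_simp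
  rw [e]
  refine mul_le_mul_of_nonneg_left (Finset.sum_le_sum fun i _ => ?_) (by positivity)
  have h1 := mul_quadratic_resolvent_le X hl i
  rw [← hW] at h1
  have h3 : 0 ≤ X i ⬝ᵥ X i := by simpa using dotProduct_star_self_nonneg (X i)
  set m := X i ⬝ᵥ X i
  set y := X i ⬝ᵥ (W *ᵥ X i)
  have hm : 0 < l + m / N := by positivity
  have e2 : 1 / l - 1 / (N * l) * y = (N - y) / (N * l) := by field_simp
  rw [e2, div_le_div_iff₀ hm (by positivity)]
  have e3 : (N - y) * (l + m / N) = N * l + m - y * (l + m / N) := by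
    field_simp
  rw [e3]
  linarith

theorem one_div_sampleStieltjes_le {N : ℕ} (X : Fin N → Fin P → ℝ) (hN : 0 < N) {l m : ℝ}
    (hl : 0 < l) (hm : 0 ≤ m)
    (h : (N : ℝ) / 2 ≤ (Finset.univ.filter fun i => X i ⬝ᵥ X i ≤ m).card) :
    1 / sampleStieltjes X l ≤ 2 * (l + m / N) := by
  have hN' : (0 : ℝ) < N := by exact_mod_cast hN
  have hp : 0 < l + m / N := by positivity
  have h1 : 1 / (2 * (l + m / N)) ≤ sampleStieltjes X l := by
    refine le_trans ?_ (sum_one_div_le_sampleStieltjes X hN hl)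
    have h2 : (N : ℝ) / 2 * (1 / (l + m / N)) ≤ ∑ i, 1 / (l + (X i ⬝ᵥ X i) / N) := by
      have hnn : ∀ i, 0 ≤ X i ⬝ᵥ X i := fun i => by simpa using dotProduct_star_self_nonneg (X i)
      calc (N : ℝ) / 2 * (1 / (l + m / N))
          ≤ (Finset.univ.filter fun i => X i ⬝ᵥ X i ≤ m).card * (1 / (l + m / N)) := by gcongr
        _ = ∑ i ∈ Finset.univ.filter fun i => X i ⬝ᵥ X i ≤ m, 1 / (l + m / N) := by
            rw [Finset.sum_const, nsmul_eq_mul]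
        _ ≤ ∑ i ∈ Finset.univ.filter fun i => X i ⬝ᵥ X i ≤ m, 1 / (l + (X i ⬝ᵥ X i) / N) := by
            refine Finset.sum_le_sum fun i hi => ?_
            have h3 := hnn i
            have h4 := (Finset.mem_filter.1 hi).2
            gcongr
        _ ≤ _ := by
            refine Finset.sum_le_sum_of_subset_of_nonneg (Finset.subset_univ _) fun i _ _ => ?_
            have h3 := hnn i
            positivity
    calc 1 / (2 * (l + m / N)) = 1 / (N : ℝ) * ((N : ℝ) / 2 * (1 / (l + m / N))) := by
          field_simp
      _ ≤ _ := by gcongr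
  have h5 := sampleStieltjes_pos X hN hl
  rw [div_le_iff₀ h5]
  rw [div_le_iff₀ (by positivity)] at h1
  linarith

/-! ### From the local law to the profile -/

/-- The normalized ground truth of the perturbed problem. -/
noncomputable def lawVector (𝒟 : Measure (Fin P → ℝ)) (β : Fin P → ℝ) (t : ℝ) : Fin P → ℝ :=
  (2 * √(β ⬝ᵥ (secondMoment 𝒟 *ᵥ β)))⁻¹ • (invSqrt (1 + t • secondMoment 𝒟) *ᵥ β)

theorem smul_mulVec_quadratic {S : Matrix (Fin P) (Fin P) ℝ} (hS : Sᵀ = S) (c : ℝ)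
    (W : Matrix (Fin P) (Fin P) ℝ) (β : Fin P → ℝ) :
    (c • (S *ᵥ β)) ⬝ᵥ (W *ᵥ (c • (S *ᵥ β))) = c ^ 2 * (β ⬝ᵥ ((S * W * S) *ᵥ β)) := by
  rw [mulVec_smul, smul_dotProduct, dotProduct_smul, smul_eq_mul, smul_eq_mul, ← mul_assoc, ← sq,
    ← mulVec_mulVec, ← mulVec_mulVec, dotProduct_mulVec β, ← mulVec_transpose, hS]

/-- The factor `2` in `lawVector` pays for `1 + t λᵢ ≥ 1/2`, which enters squared. If `βᵀ Σ β = 0`,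
the vector is zero, since `0⁻¹ = 0`. -/
theorem lawVector_quadratic_le (h𝒟 : ∀ j, MemLp (fun x : Fin P → ℝ => x j) 2 𝒟) (β : Fin P → ℝ)
    {t : ℝ} (ht : |t| * opNorm (secondMoment 𝒟) < 1 / 2) :
    lawVector 𝒟 β t ⬝ᵥ (secondMoment (whitened 𝒟 t) *ᵥ lawVector 𝒟 β t) ≤ 1 := by
  have hQ := secondMoment_posSemidef 𝒟 h𝒟
  set Q := secondMoment 𝒟 with hQdef
  set S := invSqrt (1 + t • Q) with hS
  have hSt : Sᵀ = S := invSqrt_transpose _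
  have hSA : S * S * (1 + t • Q) = 1 := invSqrt_mul_self_mul (posDef_one_add_smul hQ ht)
  obtain ⟨U, hU1, hU2⟩ := exists_orthogonal_diagonalization hQ.isHermitian
  have hU3 : U * Uᵀ = 1 := mul_eq_one_comm.1 hU1
  have hev := hQ.eigenvalues_nonneg
  have hpos : ∀ i, 0 < 1 + t * hQ.isHermitian.eigenvalues i := fun i =>
    one_add_mul_pos ht (hev i) (eigenvalues_le_opNorm hQ.isHermitian i)
  have hSS : S * S = U * diagonal (fun i => 1 / (1 + t * hQ.isHermitian.eigenvalues i)) * Uᵀ := by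
    have := inv_add_smul_eq (M := 1) (T := U) (m := 1) (t := t) (by rw [mul_one, hU1]) hU2
      (fun i => (hpos i).ne')
    rw [one_smul] at this
    rw [← this]
    exact (inv_eq_left_inv hSA).symm
  have hQe : Q = U * diagonal hQ.isHermitian.eigenvalues * Uᵀ := by
    rw [← hU2]
    calc Q = U * Uᵀ * Q * (U * Uᵀ) := by rw [hU3, one_mul, mul_one]
      _ = _ := by simp only [mul_assoc]
  have hmid : S * (S * Q * S) * S = U * diagonal (fun i => hQ.isHermitian.eigenvalues i /
      (1 + t * hQ.isHermitian.eigenvalues i) ^ 2) * Uᵀ := by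
    calc S * (S * Q * S) * S = (S * S) * Q * (S * S) := by simp only [mul_assoc]
      _ = U * diagonal (fun i => 1 / (1 + t * hQ.isHermitian.eigenvalues i)) * (Uᵀ * Q * U) *
          diagonal (fun i => 1 / (1 + t * hQ.isHermitian.eigenvalues i)) * Uᵀ := by
        rw [hSS]
        simp only [mul_assoc]
      _ = _ := by
        rw [hU2, mul_assoc U, mul_assoc U, diagonal_mul_diagonal, diagonal_mul_diagonal]
        congr 3
        funext i
        have := hpos i
        field_simp
  have hB : β ⬝ᵥ (Q *ᵥ β) = ∑ i, (Uᵀ *ᵥ β) i ^ 2 * hQ.isHermitian.eigenvalues i := by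
    rw [← dotProduct_conj_diagonal_mulVec, ← hQe]
  have hB0 : 0 ≤ β ⬝ᵥ (Q *ᵥ β) := by simpa using hQ.dotProduct_mulVec_nonneg β
  rw [secondMoment_whitened h𝒟, lawVector, ← hQdef, ← hS, smul_mulVec_quadratic hSt, hmid,
    dotProduct_conj_diagonal_mulVec]
  have hle : ∑ i, (Uᵀ *ᵥ β) i ^ 2 * (hQ.isHermitian.eigenvalues i /
      (1 + t * hQ.isHermitian.eigenvalues i) ^ 2) ≤ 4 * (β ⬝ᵥ (Q *ᵥ β)) := by
    rw [hB, Finset.mul_sum]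
    refine Finset.sum_le_sum fun i _ => ?_
    have h1 := hev i
    have h2 : |t * hQ.isHermitian.eigenvalues i| ≤ 1 / 2 := by
      rw [abs_mul, abs_of_nonneg h1]
      exact (mul_le_mul_of_nonneg_left (eigenvalues_le_opNorm hQ.isHermitian i)
        (abs_nonneg t)).trans ht.le
    have h3 : 1 / 2 ≤ 1 + t * hQ.isHermitian.eigenvalues i := by linarith [(abs_le.1 h2).1]
    have h4 : hQ.isHermitian.eigenvalues i / (1 + t * hQ.isHermitian.eigenvalues i) ^ 2
        ≤ 4 * hQ.isHermitian.eigenvalues i := by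
      have := hpos i
      rw [div_le_iff₀ (by positivity)]
      have h5 : (1 / 2 : ℝ) ^ 2 ≤ (1 + t * hQ.isHermitian.eigenvalues i) ^ 2 := by gcongr
      nlinarith
    have := mul_le_mul_of_nonneg_left h4 (sq_nonneg ((Uᵀ *ᵥ β) i))
    linarith
  have hc : (2 * √(β ⬝ᵥ (Q *ᵥ β)))⁻¹ ^ 2 = (4 * (β ⬝ᵥ (Q *ᵥ β)))⁻¹ := by
    rw [inv_pow, mul_pow, Real.sq_sqrt hB0]
    norm_num
  rw [hc]
  calc _ ≤ (4 * (β ⬝ᵥ (Q *ᵥ β)))⁻¹ * (4 * (β ⬝ᵥ (Q *ᵥ β))) := by gcongr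
    _ ≤ 1 := inv_mul_le_one

/-- The event of the local law for the perturbed problem, in terms of the original samples. -/
def perturbedEvent (𝒟 : Measure (Fin P → ℝ)) (β : Fin P → ℝ) (N : ℕ) (S : Set ℝ) (t r : ℝ) :
    Set (Fin N → Fin P → ℝ) :=
  {X | (fun i => invSqrt (1 + t • secondMoment 𝒟) *ᵥ X i) ∈
    localMPEvent (whitened 𝒟 t) N S (lawVector 𝒟 β t) r}

/-- Conjugating the resolvents by `S = (1 + tΣ)^(-1/2)` removes all square roots: the population
side becomes `(1 + (t + u)Σ)⁻¹`. The normalization of the vector returns as the factor `4 βᵀ Σ β`.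
-/
theorem perturbedEvent_bounds (h𝒟 : ∀ j, MemLp (fun x : Fin P → ℝ => x j) 2 𝒟) {β : Fin P → ℝ}
    {N : ℕ} {S : Set ℝ} {t r l : ℝ} (ht : |t| * opNorm (secondMoment 𝒟) < 1 / 2)
    (hB : 0 < β ⬝ᵥ (secondMoment 𝒟 *ᵥ β)) {X : Fin N → Fin P → ℝ}
    (hX : X ∈ perturbedEvent 𝒟 β N S t r) (hl : 0 < l) (hlS : l ∈ S) :
    |dualReg 𝒟 N t l - sampleStieltjes (fun i => invSqrt (1 + t • secondMoment 𝒟) *ᵥ X i) l|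
        ≤ r * mpScale (whitened 𝒟 t) N l ∧
      |popBias (secondMoment 𝒟) β (t + dualReg 𝒟 N t l) -
          β ⬝ᵥ ((l • (l • (1 + t • secondMoment 𝒟) + sampleSecondMoment X)⁻¹) *ᵥ β)|
        ≤ 4 * (β ⬝ᵥ (secondMoment 𝒟 *ᵥ β)) * (r * mpScale (whitened 𝒟 t) N l) := by
  obtain ⟨h1, h2⟩ := hX l hlS
  refine ⟨h1, ?_⟩
  have hQ := secondMoment_posSemidef 𝒟 h𝒟
  set Q := secondMoment 𝒟 with hQdef
  set S := invSqrt (1 + t • Q) with hS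
  have hSt : Sᵀ = S := invSqrt_transpose _
  have hSA : S * S * (1 + t • Q) = 1 := invSqrt_mul_self_mul (posDef_one_add_smul hQ ht)
  set k := effectiveReg (whitened 𝒟 t) N l with hk
  have hk0 : 0 < k := (isEffectiveReg_effectiveReg (memLp_whitened h𝒟 t) hl).1
  set B := β ⬝ᵥ (Q *ᵥ β) with hBdef
  have hc : (2 * √B)⁻¹ ^ 2 = (4 * B)⁻¹ := by
    rw [inv_pow, mul_pow, Real.sq_sqrt hB.le]
    norm_num
  have hd : dualReg 𝒟 N t l = 1 / k := rfl
  have e1 : S * (k • (k • 1 + S * Q * S)⁻¹) * S = (1 + (t + dualReg 𝒟 N t l) • Q)⁻¹ := by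
    rw [Matrix.mul_smul, Matrix.smul_mul, conj_smul_inv_conj hSA]
    have e : k • (1 + t • Q) + Q = k • (1 + (t + dualReg 𝒟 N t l) • Q) := by
      rw [hd, add_smul, smul_add, smul_add, smul_add, smul_smul k (1 / k), mul_one_div_cancel hk0.ne',
        one_smul, add_assoc]
    rw [e]
    refine smul_inv_smul ?_ hk0.ne'
    have h3 : (1 + t • Q + dualReg 𝒟 N t l • Q).PosDef :=
      (posDef_one_add_smul hQ ht).add_posSemidef (hQ.smul (dualReg_pos h𝒟 N t hl).le)
    rw [add_smul, ← add_assoc]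
    exact h3.det_pos.ne'.isUnit
  have e2 : S * (l • (l • 1 + S * sampleSecondMoment X * S)⁻¹) * S
      = l • (l • (1 + t • Q) + sampleSecondMoment X)⁻¹ := by
    rw [Matrix.mul_smul, Matrix.smul_mul, conj_smul_inv_conj hSA]
  rw [secondMoment_whitened h𝒟, sampleSecondMoment_mulVec, ← hQdef, ← hS, hSt, lawVector, ← hQdef,
    ← hBdef, ← hS, smul_mulVec_quadratic hSt, smul_mulVec_quadratic hSt, e1, e2, hc, ← mul_sub,
    abs_mul, abs_of_pos (show 0 < (4 * B)⁻¹ by positivity), inv_mul_le_iff₀ (by positivity)] at h2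
  exact h2

/-- On the events of the local law for the perturbations `t` and `0` the profile satisfies the
estimates of the local law at `t`. -/
theorem lawAt_of_mem (h𝒟 : ∀ j, MemLp (fun x : Fin P → ℝ => x j) 2 𝒟) {β : Fin P → ℝ} {N : ℕ}
    {X : Fin N → Fin P → ℝ} {lam t r σ : ℝ} (hlam : 0 < lam) (hr : 0 < r) (hσ : 0 < σ)
    (hσ2 : σ ^ 2 * (lam * dualReg 𝒟 N 0 lam) = 1)
    (ht : |t| * opNorm (secondMoment 𝒟) < 1 / 2)
    (htl : |t| ≤ lam * dualReg 𝒟 N 0 lam ^ 2 / 32)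
    (hB : 0 < β ⬝ᵥ (secondMoment 𝒟 *ᵥ β)) {p : RidgeProfile P} (hplam : p.lam = lam)
    (hps : p.stieltjes t = sampleStieltjes (fun i => invSqrt (1 + t • secondMoment 𝒟) *ᵥ X i) lam)
    (hpb : p.bias t =
      β ⬝ᵥ ((lam • (lam • (1 + t • secondMoment 𝒟) + sampleSecondMoment X)⁻¹) *ᵥ β))
    (hpp : ∀ l : ℝ, 0 < l → p.path l = β ⬝ᵥ ((l • (l • 1 + sampleSecondMoment X)⁻¹) *ᵥ β))
    (hpr : ∑ i, p.r i = β ⬝ᵥ β)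
    (hXt : X ∈ perturbedEvent 𝒟 β N (Set.Ioo (1 / 2 * lam) (3 / 2 * lam)) t r)
    (hX0 : X ∈ perturbedEvent 𝒟 β N (Set.Ioo (1 / 2 * lam) (3 / 2 * lam)) 0 r) :
    p.LawAt (dualReg 𝒟 N 0 lam) (3 * r * dualReg 𝒟 N 0 lam * σ)
      (12 * (β ⬝ᵥ (secondMoment 𝒟 *ᵥ β)) * r * dualReg 𝒟 N 0 lam * σ)
      (β ⬝ᵥ (secondMoment 𝒟 *ᵥ β)) t := by
  have hQ := secondMoment_posSemidef 𝒟 h𝒟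
  have h00 : |(0 : ℝ)| * opNorm (secondMoment 𝒟) < 1 / 2 := by simp
  have hlS : lam ∈ Set.Ioo (1 / 2 * lam) (3 / 2 * lam) := ⟨by linarith, by linarith⟩
  obtain ⟨hu1, hu2⟩ := dualReg_bounds h𝒟 (N := N) ht hlam
  have hu := dualReg_pos h𝒟 N t hlam
  have hu0 := dualReg_pos h𝒟 N 0 hlam
  obtain ⟨hlu, -⟩ := mul_dualReg_le h𝒟 (N := N) hlam
  obtain ⟨h1, h2⟩ := perturbedEvent_bounds h𝒟 ht hB hXt hlam hlS
  have hzero := dualReg_zero_eq h𝒟 (N := N) ht hlam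
  -- `mpScale` is at most `√(u / lam)`, while `u₀ * σ = √(u₀ / lam)`. The constant `3` leaves room
  -- for the smaller regularization `l ≥ lam / 2` below.
  have hscale : mpScale (whitened 𝒟 t) N lam ≤ 3 * dualReg 𝒟 N 0 lam * σ := by
    refine mpScale_whitened_le h𝒟 hlam (by positivity) ?_
    calc dualReg 𝒟 N t lam ≤ 2 * dualReg 𝒟 N 0 lam := hu2
      _ ≤ 9 * dualReg 𝒟 N 0 lam * (σ ^ 2 * (lam * dualReg 𝒟 N 0 lam)) := by
        rw [hσ2]
        linarith
      _ = _ := by ring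
  set u := dualReg 𝒟 N t lam with hudef
  set u₀ := dualReg 𝒟 N 0 lam with hu0def
  set B := β ⬝ᵥ (secondMoment 𝒟 *ᵥ β) with hBdef
  have htu : |t| ≤ u₀ / 32 := by
    have : lam * u₀ ^ 2 ≤ u₀ := by
      calc lam * u₀ ^ 2 = lam * u₀ * u₀ := by ring
        _ ≤ 1 * u₀ := by gcongr
        _ = u₀ := one_mul _
    linarith
  have htt := abs_le.1 htu
  have hw1 : 15 / 32 * u₀ ≤ t + u := by linarith
  have hw : 0 < t + u := by linarith
  -- The shifted regularization stays inside the interval on which the law is assumed; here the law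
  -- is needed at points other than `lam`.
  have hshift : |t / (u * (t + u))| ≤ lam / 4 := by
    rw [abs_div, abs_of_pos (mul_pos hu hw), div_le_iff₀ (by positivity)]
    have h3 : u₀ / 2 * (15 / 32 * u₀) ≤ u * (t + u) := by gcongr
    have h4 : lam / 4 * (u₀ / 2 * (15 / 32 * u₀)) ≤ lam / 4 * (u * (t + u)) := by gcongr
    have h5 : lam * u₀ ^ 2 / 32 ≤ lam / 4 * (u₀ / 2 * (15 / 32 * u₀)) := by
      have : 0 < lam * u₀ ^ 2 := by positivity
      linarith
    linarith
  have hsh := abs_le.1 hshift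
  set l := lam - t / (u * (t + u)) with hl
  have hlS' : l ∈ Set.Ioo (1 / 2 * lam) (3 / 2 * lam) := ⟨by linarith, by linarith⟩
  have hl0 : 0 < l := by linarith
  obtain ⟨-, h4⟩ := perturbedEvent_bounds h𝒟 h00 hB hX0 hl0 hlS'
  have hz := hzero hw hl0
  have hscale' : mpScale (whitened 𝒟 0) N l ≤ 3 * u₀ * σ := by
    refine mpScale_whitened_le h𝒟 hl0 (by positivity) ?_
    rw [hz]
    have h5 : (3 * u₀ * σ) ^ 2 * lam = 9 * u₀ := by
      calc _ = 9 * u₀ * (σ ^ 2 * (lam * u₀)) := by ring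
        _ = _ := by rw [hσ2, mul_one]
    have h6 : (3 * u₀ * σ) ^ 2 * (1 / 2 * lam) ≤ (3 * u₀ * σ) ^ 2 * l := by
      gcongr
      exact hlS'.1.le
    linarith
  rw [zero_add, hz, zero_smul, add_zero] at h4
  have hpop := popBias_bounds hQ β hw.le
  refine ⟨u, popBias (secondMoment 𝒟) β (t + u), hu1, hu2, ?_, ?_, ?_, ?_, ?_⟩
  · rw [hps]
    refine h1.trans ?_
    calc r * mpScale (whitened 𝒟 t) N lam ≤ r * (3 * u₀ * σ) := by gcongr
      _ = _ := by ring
  · rw [hpb]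
    refine h2.trans ?_
    calc 4 * B * (r * mpScale (whitened 𝒟 t) N lam) ≤ 4 * B * (r * (3 * u₀ * σ)) := by gcongr
      _ = _ := by ring
  · rw [hplam, ← hl, hpp l hl0]
    refine h4.trans ?_
    calc 4 * B * (r * mpScale (whitened 𝒟 0) N l) ≤ 4 * B * (r * (3 * u₀ * σ)) := by gcongr
      _ = _ := by ring
  · rw [hpr]
    exact hpop.1
  · rw [hpr]
    exact hpop.2

/-- The scale of the perturbations. -/
noncomputable def perturbationScale (𝒟 : Measure (Fin P → ℝ)) (N : ℕ) (lam : ℝ) : ℝ :=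
  min (lam * dualReg 𝒟 N 0 lam ^ 2) (1 / opNorm (secondMoment 𝒟)) / 32

theorem perturbationScale_spec (h𝒟 : ∀ j, MemLp (fun x : Fin P → ℝ => x j) 2 𝒟) {N : ℕ} {lam : ℝ}
    (hlam : 0 < lam) (ha : 0 < opNorm (secondMoment 𝒟)) :
    0 < perturbationScale 𝒟 N lam ∧
      ∀ t, |t| ≤ perturbationScale 𝒟 N lam → |t| * opNorm (secondMoment 𝒟) < 1 / 2 ∧
        |t| ≤ lam * dualReg 𝒟 N 0 lam ^ 2 / 32 := by
  have hu0 := dualReg_pos h𝒟 N 0 hlam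
  have h1 : 0 < min (lam * dualReg 𝒟 N 0 lam ^ 2) (1 / opNorm (secondMoment 𝒟)) :=
    lt_min (by positivity) (by positivity)
  refine ⟨by rw [perturbationScale]; positivity, fun t ht => ⟨?_, ?_⟩⟩
  · have h2 : |t| ≤ 1 / opNorm (secondMoment 𝒟) / 32 := by
      refine ht.trans ?_
      rw [perturbationScale]
      gcongr
      exact min_le_right _ _
    calc _ ≤ 1 / opNorm (secondMoment 𝒟) / 32 * opNorm (secondMoment 𝒟) := by gcongr
      _ = 1 / 32 := by field_simp
      _ < 1 / 2 := by norm_num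
  · refine ht.trans ?_
    rw [perturbationScale]
    gcongr
    exact min_le_left _ _

/-- The nodes at which the local law is used. -/
noncomputable def perturbationNode (𝒟 : Measure (Fin P → ℝ)) (N : ℕ) (lam η : ℝ) (K j : ℕ) : ℝ :=
  if j ≤ K then j * (η * perturbationScale 𝒟 N lam / (4 * (K + 1)))
  -- The node for the a priori bound on the risk, used with `j = K + 1`.
  else -perturbationScale 𝒟 N lam

theorem abs_perturbationNode_le {N : ℕ} {lam η : ℝ} (hρ : 0 < perturbationScale 𝒟 N lam)
    (hη : 0 < η) (hη1 : η ≤ 1) (K j : ℕ) :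
    |perturbationNode 𝒟 N lam η K j| ≤ perturbationScale 𝒟 N lam := by
  rw [perturbationNode]
  split_ifs with hj
  · have hj' : (j : ℝ) ≤ K + 1 := by exact_mod_cast hj.trans (Nat.le_succ K)
    rw [abs_of_nonneg (by positivity)]
    calc (j : ℝ) * (η * perturbationScale 𝒟 N lam / (4 * (K + 1)))
        ≤ (K + 1) * (1 * perturbationScale 𝒟 N lam / (4 * (K + 1))) := by gcongr
      _ = perturbationScale 𝒟 N lam / 4 := by field_simp
      _ ≤ perturbationScale 𝒟 N lam := by linarith
  · rw [abs_neg, abs_of_pos hρ]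

/-- The deterministic part of the theorem. -/
theorem exists_abs_gcv_sub_generalizationRisk_le (K : ℕ) (hK : 1 ≤ K) : ∃ C : ℝ, 0 < C ∧
    ∀ {P : ℕ} (𝒟 : Measure (Fin P → ℝ)), (∀ j, MemLp (fun x : Fin P → ℝ => x j) 2 𝒟) →
    ∀ (β : Fin P → ℝ) (N : ℕ) (X : Fin N → Fin P → ℝ) (lam r η : ℝ), 0 < N → 0 < lam → 0 < r →
      0 < η → η ≤ 1 → 0 < opNorm (secondMoment 𝒟) → 0 < β ⬝ᵥ (secondMoment 𝒟 *ᵥ β) →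
      (∀ j ≤ K + 1, X ∈ perturbedEvent 𝒟 β N (Set.Ioo (1 / 2 * lam) (3 / 2 * lam))
        (perturbationNode 𝒟 N lam η K j) r) →
      1 / sampleStieltjes X lam ≤ 32 * (lam + (secondMoment 𝒟).trace / N) →
      |gcv β lam X - generalizationRisk 𝒟 β (ridgeEstimator β lam X)| ≤
        C * (r / η + η ^ K + N * r ^ 3) * (β ⬝ᵥ (secondMoment 𝒟 *ᵥ β)) *
          (opNorm (secondMoment 𝒟) / lam + √(1 + (secondMoment 𝒟).trace / (N * lam)) ^ 3) := by
  obtain ⟨C, hC, h⟩ := RidgeProfile.exists_abs_gcv_sub_risk_le_of_lawAt K hK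
  refine ⟨C, hC, ?_⟩
  intro P 𝒟 h𝒟 β N X lam r η hN hlam hr hη hη1 ha hB hev hst
  have hN' : (0 : ℝ) < N := by exact_mod_cast hN
  have hQ := secondMoment_posSemidef 𝒟 h𝒟
  obtain ⟨p, hpa, hplam, hps, hps0, hpb, hpp, hpr, hprisk, hpgcv, hpN⟩ :=
    exists_ridgeProfile X β hQ ha hN hlam
  obtain ⟨hρ, hρt⟩ := perturbationScale_spec h𝒟 (N := N) hlam ha
  have hu0 := dualReg_pos h𝒟 N 0 hlam
  obtain ⟨hlu, hlu2⟩ := mul_dualReg_le h𝒟 (N := N) hlam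
  have hX0 : X ∈ perturbedEvent 𝒟 β N (Set.Ioo (1 / 2 * lam) (3 / 2 * lam)) 0 r := by
    have := hev 0 (Nat.zero_le _)
    simpa [perturbationNode] using this
  set σ := √(1 / (lam * dualReg 𝒟 N 0 lam)) with hσdef
  have hσ : 0 < σ := Real.sqrt_pos.2 (by positivity)
  have hσ2 : σ ^ 2 * (lam * dualReg 𝒟 N 0 lam) = 1 := by
    rw [hσdef, Real.sq_sqrt (by positivity)]
    field_simp
  have htr : 0 ≤ (secondMoment 𝒟).trace := hQ.trace_nonneg
  have hY : 1 + (secondMoment 𝒟).trace / (N * lam)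
      = (lam + (secondMoment 𝒟).trace / N) / lam := by field_simp
  set Y := √(1 + (secondMoment 𝒟).trace / (N * lam)) with hYdef
  have hY2 : lam * Y ^ 2 = lam + (secondMoment 𝒟).trace / N := by
    rw [hYdef, Real.sq_sqrt (by positivity), hY]
    field_simp
  have hσY : σ ≤ Y := by
    refine Real.sqrt_le_sqrt ?_
    rw [hY, div_le_div_iff₀ (by positivity) hlam]
    calc 1 * lam ≤ dualReg 𝒟 N 0 lam * (lam + (secondMoment 𝒟).trace / N) * lam := by gcongr
      _ = _ := by ring
  have hlaw : ∀ j ≤ K + 1, p.LawAt (dualReg 𝒟 N 0 lam) (3 * r * dualReg 𝒟 N 0 lam * σ)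
      (12 * (β ⬝ᵥ (secondMoment 𝒟 *ᵥ β)) * r * dualReg 𝒟 N 0 lam * σ)
      (β ⬝ᵥ (secondMoment 𝒟 *ᵥ β)) (perturbationNode 𝒟 N lam η K j) := by
    intro j hj
    obtain ⟨h1, h2⟩ := hρt _ (abs_perturbationNode_le hρ hη hη1 K j)
    exact lawAt_of_mem h𝒟 hlam hr hσ hσ2 h1 h2 hB hplam (hps _ h1) (hpb _ h1) hpp hpr
      (hev j hj) hX0
  have h00 : |(0 : ℝ)| * opNorm (secondMoment 𝒟) < 1 / 2 := by simp
  have hlS : lam ∈ Set.Ioo (1 / 2 * lam) (3 / 2 * lam) := ⟨by linarith, by linarith⟩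
  obtain ⟨h1, h2⟩ := perturbedEvent_bounds h𝒟 h00 hB hX0 hlam hlS
  have hscale : mpScale (whitened 𝒟 0) N lam ≤ 3 * dualReg 𝒟 N 0 lam * σ := by
    refine mpScale_whitened_le h𝒟 hlam (by positivity) ?_
    calc dualReg 𝒟 N 0 lam ≤ 9 * dualReg 𝒟 N 0 lam * (σ ^ 2 * (lam * dualReg 𝒟 N 0 lam)) := by
          rw [hσ2]
          linarith
      _ = _ := by ring
  have h3 : |dualReg 𝒟 N 0 lam - p.stieltjes 0| ≤ 3 * r * dualReg 𝒟 N 0 lam * σ := by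
    rw [hps 0 h00]
    refine h1.trans ?_
    calc _ ≤ r * (3 * dualReg 𝒟 N 0 lam * σ) := by gcongr
      _ = _ := by ring
  have h4 : ∑ i, p.r i - p.path p.lam ≤ dualReg 𝒟 N 0 lam * (β ⬝ᵥ (secondMoment 𝒟 *ᵥ β)) +
      12 * (β ⬝ᵥ (secondMoment 𝒟 *ᵥ β)) * r * dualReg 𝒟 N 0 lam * σ := by
    have h5 := (popBias_bounds hQ β hu0.le).1
    have h6 := (abs_le.1 h2).2
    rw [zero_smul, add_zero, zero_add, ← hpp lam hlam] at h6
    have h7 : 4 * (β ⬝ᵥ (secondMoment 𝒟 *ᵥ β)) * (r * mpScale (whitened 𝒟 0) N lam) ≤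
        12 * (β ⬝ᵥ (secondMoment 𝒟 *ᵥ β)) * r * dualReg 𝒟 N 0 lam * σ := by
      calc _ ≤ 4 * (β ⬝ᵥ (secondMoment 𝒟 *ᵥ β)) * (r * (3 * dualReg 𝒟 N 0 lam * σ)) := by gcongr
        _ = _ := by ring
    rw [hpr, hplam]
    linarith
  have key := h p (dualReg 𝒟 N 0 lam) (β ⬝ᵥ (secondMoment 𝒟 *ᵥ β)) (perturbationScale 𝒟 N lam) η σ
    Y r N hu0 (by rw [hplam]; exact hlu) hB hσ (by rw [hplam]; exact hσ2) hσY hr hN'.le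
    (by rw [hplam, hpa, perturbationScale]) hη hη1
    (fun j hj => by
      have := hlaw j (hj.trans (Nat.le_succ K))
      rwa [perturbationNode, if_pos hj] at this)
    (by
      have := hlaw (K + 1) le_rfl
      rwa [perturbationNode, if_neg (by omega)] at this)
    h3 h4 hpN (by rw [hps0, hplam, hY2]; exact hst)
  rw [generalizationRisk_eq h𝒟, ← hprisk, ← hpgcv]
  rw [hpa, hplam] at key
  calc _ ≤ _ := key
    _ = _ := by ring

end deterministic

/-! ### Probabilistic lemmas -/

/-- A rate `N ^ (-1/2 + ε)` for every `ε > 0` is a rate `N ^ (-1/2 + o(1))`. -/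
theorem hasHalfRate_of_forall {I : ℕ → Type*} {Ω : ℕ → Type*} [∀ N, MeasurableSpace (Ω N)]
    {μ : ∀ N, I N → Measure (Ω N)} {E : ∀ N, I N → ℝ → Set (Ω N)}
    (h : ∀ ε : ℝ, 0 < ε →
      WithHighProbability μ (fun N i => E N i ((N : ℝ) ^ (-(1 / 2 : ℝ) + ε)))) :
    HasHalfRate μ E := by
  classical
  have h' : ∀ k : ℕ, ∃ n : ℕ, ∀ N, n ≤ N → ∀ i : I N,
      μ N i (E N i ((N : ℝ) ^ (-(1 / 2 : ℝ) + 1 / ((k : ℝ) + 1))))ᶜ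
        ≤ ENNReal.ofReal ((N : ℝ) ^ (-((k : ℝ) + 1))) :=
    fun k => h (1 / ((k : ℝ) + 1)) (by positivity) ((k : ℝ) + 1) (by positivity)
  choose n hn using h'
  -- A diagonal argument: `κ N` is the largest `k ≤ N` whose threshold has been passed. It tends to
  -- infinity, so the exponent `1 / (k + 1)` and the confidence `k + 1` improve together.
  set κ : ℕ → ℕ := fun N => Nat.findGreatest (fun k => n k ≤ N) N with hκ
  have hκlim : Tendsto κ atTop atTop := by
    refine tendsto_atTop.2 fun m => ?_
    filter_upwards [eventually_ge_atTop (max m (n m))] with N hN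
    exact Nat.le_findGreatest ((le_max_left _ _).trans hN) ((le_max_right _ _).trans hN)
  refine ⟨1, one_pos, fun N => 1 / ((κ N : ℝ) + 1), ?_, fun D _ => ?_⟩
  · exact tendsto_one_div_add_atTop_nhds_zero_nat.comp hκlim
  · obtain ⟨N₁, hN₁⟩ := eventually_atTop.1 (hκlim.eventually_ge_atTop ⌈D⌉₊)
    refine ⟨max (max N₁ (n 0)) 1, fun N hN i => ?_⟩
    have hN1 : N₁ ≤ N := (le_max_left _ _).trans ((le_max_left _ _).trans hN)
    have hN0 : n 0 ≤ N := (le_max_right _ _).trans ((le_max_left _ _).trans hN)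
    have hNp : 1 ≤ N := (le_max_right _ _).trans hN
    have hspec : n (κ N) ≤ N :=
      Nat.findGreatest_spec (P := fun k => n k ≤ N) (Nat.zero_le N) hN0
    have hD : D ≤ (κ N : ℝ) + 1 := by
      have h1 : (⌈D⌉₊ : ℝ) ≤ κ N := by exact_mod_cast hN₁ N hN1
      linarith [Nat.le_ceil D]
    simp only [one_mul]
    refine (hn (κ N) N hspec i).trans (ENNReal.ofReal_le_ofReal ?_)
    exact Real.rpow_le_rpow_of_exponent_le (by exact_mod_cast hNp) (by linarith)

/-- For events that grow with the rate, a rate `N ^ (-1/2 + o(1))` is a rate `N ^ (-1/2 + ε)` for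
every `ε > 0`. -/
theorem HasHalfRate.withHighProbability {I : ℕ → Type*} {Ω : ℕ → Type*}
    [∀ N, MeasurableSpace (Ω N)] {μ : ∀ N, I N → Measure (Ω N)} {E : ∀ N, I N → ℝ → Set (Ω N)}
    (h : HasHalfRate μ E) (hE : ∀ N i r r', r ≤ r' → E N i r ⊆ E N i r') {ε : ℝ} (hε : 0 < ε) :
    WithHighProbability μ (fun N i => E N i ((N : ℝ) ^ (-(1 / 2 : ℝ) + ε))) := by
  obtain ⟨C, hC, o, ho, h⟩ := h
  intro D hD
  obtain ⟨N₀, hN₀⟩ := h D hD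
  have h1 : ∀ᶠ N : ℕ in atTop, C ≤ (N : ℝ) ^ (ε / 2) :=
    ((tendsto_rpow_atTop (half_pos hε)).comp tendsto_natCast_atTop_atTop).eventually_ge_atTop C
  have h2 : ∀ᶠ N in atTop, o N ≤ ε / 2 := ho.eventually_le_const (half_pos hε)
  obtain ⟨N₁, hN₁⟩ := eventually_atTop.1 (h1.and h2)
  refine ⟨max (max N₀ N₁) 1, fun N hN i => ?_⟩
  have hNp : 1 ≤ N := (le_max_right _ _).trans hN
  have hN' : (1 : ℝ) ≤ N := by exact_mod_cast hNp
  refine le_trans (measure_mono (Set.compl_subset_compl.2 (hE N i _ _ ?_)))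
    (hN₀ N ((le_max_left _ _).trans ((le_max_left _ _).trans hN)) i)
  obtain ⟨h3, h4⟩ := hN₁ N ((le_max_right _ _).trans ((le_max_left _ _).trans hN))
  calc C * (N : ℝ) ^ (-(1 / 2 : ℝ) + o N)
      ≤ (N : ℝ) ^ (ε / 2) * (N : ℝ) ^ (-(1 / 2 : ℝ) + ε / 2) := by gcongr
    _ = (N : ℝ) ^ (-(1 / 2 : ℝ) + ε) := by
      rw [← Real.rpow_add (by linarith)]
      congr 1
      ring

theorem mpScale_nonneg {P : ℕ} {𝒟 : Measure (Fin P → ℝ)}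
    (h𝒟 : ∀ j, MemLp (fun x : Fin P → ℝ => x j) 2 𝒟) {N : ℕ} {l : ℝ} (hl : 0 < l) :
    0 ≤ mpScale 𝒟 N l := by
  have := (isEffectiveReg_effectiveReg h𝒟 (N := N) hl).1
  rw [mpScale]
  positivity

theorem localMPEvent_mono {P : ℕ} {𝒟 : Measure (Fin P → ℝ)}
    (h𝒟 : ∀ j, MemLp (fun x : Fin P → ℝ => x j) 2 𝒟) {N : ℕ} {S : Set ℝ} (hS : ∀ l ∈ S, 0 < l)
    (v : Fin P → ℝ) {r r' : ℝ} (hr : r ≤ r') :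
    localMPEvent 𝒟 N S v r ⊆ localMPEvent 𝒟 N S v r' := by
  intro X hX l hl
  have h1 := mul_le_mul_of_nonneg_right hr (mpScale_nonneg h𝒟 (N := N) (hS l hl))
  exact ⟨(hX l hl).1.trans h1, (hX l hl).2.trans h1⟩

/-! ### Probability estimates for the samples. -/

section sample

variable {P : ℕ} {𝒟 : Measure (Fin P → ℝ)} [IsProbabilityMeasure 𝒟]

instance (N : ℕ) : IsProbabilityMeasure (sampleLaw 𝒟 N) := by
  unfold sampleLaw
  infer_instance

/-- Whitening the samples maps one product law to the other. Only an inequality is claimed, because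
it holds for sets not known to be measurable. -/
theorem sampleLaw_perturbedEvent_compl_le (β : Fin P → ℝ) (N : ℕ) (S : Set ℝ) (t r : ℝ) :
    sampleLaw 𝒟 N (perturbedEvent 𝒟 β N S t r)ᶜ
      ≤ sampleLaw (whitened 𝒟 t) N (localMPEvent (whitened 𝒟 t) N S (lawVector 𝒟 β t) r)ᶜ := by
  have hm : Measurable fun x : Fin P → ℝ => invSqrt (1 + t • secondMoment 𝒟) *ᵥ x :=
    measurable_mulVec _
  have : IsProbabilityMeasure (𝒟.map fun x => invSqrt (1 + t • secondMoment 𝒟) *ᵥ x) :=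
    Measure.isProbabilityMeasure_map hm.aemeasurable
  have e : sampleLaw (whitened 𝒟 t) N = (sampleLaw 𝒟 N).map
      (fun X i => invSqrt (1 + t • secondMoment 𝒟) *ᵥ X i) := by
    rw [sampleLaw, sampleLaw, whitened, linearImage]
    exact (Measure.pi_map_pi fun _ => hm.aemeasurable).symm
  rw [e]
  refine Measure.le_map_apply ?_ _
  exact (measurable_pi_lambda _ fun i => hm.comp (measurable_pi_apply i)).aemeasurable

/-- Markov's inequality with `E |x|² = tr Σ`. The `16` makes `(1/16)^(N/2) = 4^(-N)` beat the number
`2^N` of subsets of the sample. -/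
theorem measure_norm_sq_gt_le (h𝒟 : ∀ j, MemLp (fun x : Fin P → ℝ => x j) 2 𝒟)
    (htr : 0 < (secondMoment 𝒟).trace) :
    𝒟 {x | ¬ x ⬝ᵥ x ≤ 16 * (secondMoment 𝒟).trace} ≤ ENNReal.ofReal (1 / 16) := by
  have hint : ∀ j, Integrable (fun x : Fin P → ℝ => x j * x j) 𝒟 := fun j =>
    (h𝒟 j).integrable_mul (h𝒟 j)
  have h1 : ∫ x, x ⬝ᵥ x ∂𝒟 = (secondMoment 𝒟).trace := by
    simp only [dotProduct]
    rw [integral_finsetSum _ fun j _ => hint j]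
    rfl
  have h2 : Integrable (fun x : Fin P → ℝ => x ⬝ᵥ x) 𝒟 := by
    simp only [dotProduct]
    exact integrable_finsetSum _ fun j _ => hint j
  have h3 := mul_meas_ge_le_integral_of_nonneg (μ := 𝒟) (f := fun x : Fin P → ℝ => x ⬝ᵥ x)
    (Eventually.of_forall fun x => by simpa using dotProduct_star_self_nonneg x) h2
    (16 * (secondMoment 𝒟).trace)
  rw [h1] at h3
  have h4 : 𝒟.real {x | 16 * (secondMoment 𝒟).trace ≤ x ⬝ᵥ x} ≤ 1 / 16 := by
    nlinarith
  refine (measure_mono fun x hx => ?_).trans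
    ((ENNReal.le_ofReal_iff_toReal_le (measure_ne_top _ _) (by norm_num)).2 h4)
  exact (not_le.1 hx).le

/-- With overwhelming probability at least half of the samples have norm of the typical size. -/
theorem sampleLaw_many_large_le (h𝒟 : ∀ j, MemLp (fun x : Fin P → ℝ => x j) 2 𝒟)
    (htr : 0 < (secondMoment 𝒟).trace) (N : ℕ) :
    sampleLaw 𝒟 N {X | ¬ (N : ℝ) / 2 ≤
      (Finset.univ.filter fun i => X i ⬝ᵥ X i ≤ 16 * (secondMoment 𝒟).trace).card}
        ≤ ENNReal.ofReal ((1 / 2) ^ N) := by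
  classical
  set b : Set (Fin P → ℝ) := {x | ¬ x ⬝ᵥ x ≤ 16 * (secondMoment 𝒟).trace} with hb
  set 𝒯 : Finset (Finset (Fin N)) := Finset.univ.filter fun T => N ≤ 2 * T.card with h𝒯
  -- On failure, the indices of large samples form a set of at least `N / 2` elements; the union
  -- runs over all such sets.
  have hsub : {X : Fin N → Fin P → ℝ | ¬ (N : ℝ) / 2 ≤
      (Finset.univ.filter fun i => X i ⬝ᵥ X i ≤ 16 * (secondMoment 𝒟).trace).card} ⊆
      ⋃ T ∈ 𝒯, Set.univ.pi fun i => if i ∈ T then b else Set.univ := by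
    intro X hX
    set T := Finset.univ.filter fun i => ¬ X i ⬝ᵥ X i ≤ 16 * (secondMoment 𝒟).trace with hT
    have hcard := Finset.card_filter_add_card_filter_not (s := (Finset.univ : Finset (Fin N)))
      (fun i => X i ⬝ᵥ X i ≤ 16 * (secondMoment 𝒟).trace)
    rw [Finset.card_univ, Fintype.card_fin, ← hT] at hcard
    have hX' : ((Finset.univ.filter fun i => X i ⬝ᵥ X i ≤ 16 * (secondMoment 𝒟).trace).card : ℝ)
        < (N : ℝ) / 2 := not_le.1 hX
    have hX2 : 2 * (Finset.univ.filter fun i => X i ⬝ᵥ X i ≤ 16 * (secondMoment 𝒟).trace).card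
        < N := by
      have : (2 : ℝ) * (Finset.univ.filter fun i =>
        X i ⬝ᵥ X i ≤ 16 * (secondMoment 𝒟).trace).card < N := by linarith
      exact_mod_cast this
    refine Set.mem_biUnion (x := T) ?_ fun i _ => ?_
    · exact Finset.mem_coe.2 (Finset.mem_filter.2 ⟨Finset.mem_univ _, by omega⟩)
    · by_cases hi : i ∈ T
      · simp only [hi, if_true]
        exact (Finset.mem_filter.1 hi).2
      · simp [hi]
  have hp := measure_norm_sq_gt_le h𝒟 htr
  have hone : ∀ T ∈ 𝒯, sampleLaw 𝒟 N (Set.univ.pi fun i => if i ∈ T then b else Set.univ)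
      ≤ ENNReal.ofReal ((1 / 4) ^ N) := by
    intro T hT
    have hT' : N ≤ 2 * T.card := (Finset.mem_filter.1 hT).2
    rw [sampleLaw, Measure.pi_pi]
    have e : ∀ i : Fin N, 𝒟 (if i ∈ T then b else Set.univ) = if i ∈ T then 𝒟 b else 1 := by
      intro i
      split_ifs
      · rfl
      · exact measure_univ
    simp only [e]
    rw [Finset.prod_ite_mem, Finset.univ_inter, Finset.prod_const]
    calc 𝒟 b ^ T.card ≤ ENNReal.ofReal (1 / 16) ^ T.card := by gcongr
      _ = ENNReal.ofReal ((1 / 4) ^ (2 * T.card)) := by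
        rw [← ENNReal.ofReal_pow (by norm_num), pow_mul]
        norm_num
      _ ≤ _ := ENNReal.ofReal_le_ofReal
        (pow_le_pow_of_le_one (by norm_num) (by norm_num) hT')
  calc _ ≤ sampleLaw 𝒟 N (⋃ T ∈ 𝒯, Set.univ.pi fun i => if i ∈ T then b else Set.univ) :=
        measure_mono hsub
    _ ≤ ∑ T ∈ 𝒯, sampleLaw 𝒟 N (Set.univ.pi fun i => if i ∈ T then b else Set.univ) :=
        measure_biUnion_finset_le _ _
    _ ≤ ∑ T ∈ 𝒯, ENNReal.ofReal ((1 / 4) ^ N) := Finset.sum_le_sum hone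
    _ ≤ ∑ _T : Finset (Fin N), ENNReal.ofReal ((1 / 4) ^ N) :=
        Finset.sum_le_sum_of_subset (Finset.filter_subset _ _)
    _ = ENNReal.ofReal ((1 / 2) ^ N) := by
        rw [Finset.sum_const, Finset.card_univ, Fintype.card_finset, Fintype.card_fin, nsmul_eq_mul,
          ← ENNReal.ofReal_natCast, ← ENNReal.ofReal_mul (by positivity)]
        congr 1
        push_cast
        rw [← mul_pow]
        norm_num

/-- Without signal, cross-validation and risk both vanish almost surely. -/
theorem sampleLaw_gcv_ne_risk_eq_zero (h𝒟 : ∀ j, MemLp (fun x : Fin P → ℝ => x j) 2 𝒟)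
    {β : Fin P → ℝ} (hB : β ⬝ᵥ (secondMoment 𝒟 *ᵥ β) = 0) (N : ℕ) {lam : ℝ} (hlam : 0 < lam) :
    sampleLaw 𝒟 N {X | ¬ gcv β lam X = generalizationRisk 𝒟 β (ridgeEstimator β lam X)} = 0 := by
  have hrisk : generalizationRisk 𝒟 β 0 = 0 := by rw [generalizationRisk_eq h𝒟, sub_zero, hB]
  have hmem : MemLp (fun x : Fin P → ℝ => β ⬝ᵥ x) 2 𝒟 := by
    simp only [dotProduct]
    exact memLp_finsetSum _ fun k _ => (h𝒟 k).const_mul (β k)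
  have hae : ∀ᵐ x ∂𝒟, β ⬝ᵥ x = 0 := by
    have h1 : ∫ x, (β ⬝ᵥ x) ^ 2 ∂𝒟 = 0 := by
      rw [← hrisk, generalizationRisk]
      simp
    rw [integral_eq_zero_iff_of_nonneg (fun x => sq_nonneg _) hmem.integrable_sq] at h1
    filter_upwards [h1] with x hx
    simpa using hx
  have hnull : ∀ i : Fin N, sampleLaw 𝒟 N (Function.eval i ⁻¹' {x | ¬ β ⬝ᵥ x = 0}) = 0 := fun i =>
    Measure.pi_eval_preimage_null _ hae
  refine measure_mono_null (fun X hX => ?_) (measure_iUnion_null hnull)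
  by_contra hcon
  refine hX ?_
  have hX0 : ∀ i, β ⬝ᵥ X i = 0 := by
    intro i
    by_contra hi
    exact hcon (Set.mem_iUnion.2 ⟨i, hi⟩)
  have h1 : sampleSecondMoment X *ᵥ β = 0 := by
    refine dotProduct_eq_zero _ fun u => ?_
    rw [dotProduct_comm, sampleSecondMoment_bilin]
    simp [hX0]
  have h2 : ridgeEstimator β lam X = 0 := by
    rw [ridgeEstimator_eq β hlam, h1, mulVec_zero]
  rw [gcv, h2, hrisk, empiricalRisk]
  simp [hX0]

end sample

/-! ### The main theorem -/

theorem GCVErrorBound.mono {P : ℕ → ℕ} {𝒟 : ∀ N, Measure (Fin (P N) → ℝ)}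
    {β : ∀ N, Fin (P N) → ℝ} {lam B B' : ℕ → ℝ} {c : ℝ} (hc : 0 < c)
    (h : GCVErrorBound 𝒟 β lam B) (hB : ∀ᶠ N in atTop, B N ≤ c * B' N) :
    GCVErrorBound 𝒟 β lam B' := by
  obtain ⟨C, hC, o, ho, h⟩ := h
  refine ⟨C * c, by positivity, o, ho, fun D hD => ?_⟩
  obtain ⟨N₀, hN₀⟩ := h D hD
  obtain ⟨N₁, hN₁⟩ := eventually_atTop.1 hB
  refine ⟨max N₀ N₁, fun N hN i => ?_⟩
  refine le_trans (measure_mono (Set.compl_subset_compl.2 fun X hX => ?_))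
    (hN₀ N ((le_max_left _ _).trans hN) i)
  change |gcv (β N) (lam N) X
    - generalizationRisk (𝒟 N) (β N) (ridgeEstimator (β N) (lam N) X)| ≤ _ at hX
  refine Set.mem_ofPred.2 (hX.trans ?_)
  have h1 := hN₁ N ((le_max_right _ _).trans hN)
  have h2 : 0 ≤ C * (N : ℝ) ^ (-(1 / 2 : ℝ) + o N) := by positivity
  calc _ ≤ C * (N : ℝ) ^ (-(1 / 2 : ℝ) + o N) * (c * B' N) := by gcongr
    _ = _ := by ring

theorem sqrt_one_add_pow_three_le {x : ℝ} (hx : 0 ≤ x) :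
    √(1 + x) ^ 3 ≤ 4 * (1 + x ^ (3 / 2 : ℝ)) := by
  have h1 : x ^ (3 / 2 : ℝ) = √x ^ 3 := by
    rw [Real.sqrt_eq_rpow, ← Real.rpow_natCast, ← Real.rpow_mul hx]
    norm_num
  have hs : 0 ≤ √x := Real.sqrt_nonneg x
  have h2 : √(1 + x) ≤ 1 + √x := by
    rw [Real.sqrt_le_left (by positivity)]
    nlinarith [Real.sq_sqrt hx]
  rw [h1]
  calc √(1 + x) ^ 3 ≤ (1 + √x) ^ 3 := by gcongr
    -- For `s = √x` the difference of the two sides is `3 (1 + s)(1 - s)²`.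
    _ ≤ 4 * (1 + √x ^ 3) := by nlinarith [mul_nonneg (sq_nonneg (1 - √x)) (add_nonneg zero_le_one hs)]

variable {P : ℕ → ℕ} {𝒟 : ∀ N, Measure (Fin (P N) → ℝ)} [∀ N, IsProbabilityMeasure (𝒟 N)]

/-- The nodes depend on `N`, so the threshold must be uniform in `t`; this is what the uniformity in
the extended law provides. -/
theorem withHighProbability_perturbedEvent
    (h𝒟 : ∀ N j, MemLp (fun x : Fin (P N) → ℝ => x j) 2 (𝒟 N)) (β : ∀ N, Fin (P N) → ℝ)
    {lam : ℕ → ℝ} (hlam : ∀ N, 0 < lam N)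
    (hMP : ExtendedLocalMPLaw 𝒟 (fun N => Set.Ioo (1 / 2 * lam N) (3 / 2 * lam N)))
    {ε : ℝ} (hε : 0 < ε) :
    WithHighProbability (I := fun N => {t : ℝ // |t| * opNorm (secondMoment (𝒟 N)) < 1 / 2})
      (fun N _ => sampleLaw (𝒟 N) N) (fun N t => perturbedEvent (𝒟 N) (β N) N
        (Set.Ioo (1 / 2 * lam N) (3 / 2 * lam N)) t ((N : ℝ) ^ (-(1 / 2 : ℝ) + ε))) := by
  have h1 := (hMP (fun N t => lawVector (𝒟 N) (β N) t)
    (fun N t => lawVector_quadratic_le (h𝒟 N) (β N) t.2)).withHighProbability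
    (fun N t r r' hr => localMPEvent_mono (memLp_whitened (h𝒟 N) t)
      (fun l hl => (mul_pos one_half_pos (hlam N)).trans hl.1) _ hr) hε
  intro D hD
  obtain ⟨N₀, hN₀⟩ := h1 D hD
  exact ⟨N₀, fun N hN t => (sampleLaw_perturbedEvent_compl_le _ _ _ _ _).trans (hN₀ N hN t)⟩

/-- The union over the nodes is paid for by asking the law for the exponent `D + 1` instead of `D`.
-/
theorem eventually_failure_le (K : ℕ) (D : ℝ) : ∀ᶠ N : ℕ in atTop,
    (K : ℝ) * (N : ℝ) ^ (-(D + 1)) + (1 / 2) ^ N ≤ (N : ℝ) ^ (-D) := by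
  have h1 : ∀ᶠ N : ℕ in atTop, (2 * K : ℝ) ≤ N := eventually_ge_atTop (2 * K) |>.mono
    fun N hN => by exact_mod_cast hN
  have h2 : Tendsto (fun N : ℕ => (N : ℝ) ^ D * (1 / 2) ^ N) atTop (𝓝 0) := by
    have h3 : Tendsto (fun N : ℕ => (N : ℝ) ^ ⌈D⌉₊ * (1 / 2) ^ N) atTop (𝓝 0) :=
      tendsto_pow_const_mul_const_pow_of_abs_lt_one _ (by rw [abs_of_pos] <;> norm_num)
    refine squeeze_zero' (Eventually.of_forall fun N => by positivity) ?_ h3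
    filter_upwards [eventually_ge_atTop 1] with N hN
    gcongr
    rw [← Real.rpow_natCast]
    exact Real.rpow_le_rpow_of_exponent_le (by exact_mod_cast hN) (Nat.le_ceil D)
  filter_upwards [h1, h2.eventually_le_const (show (0 : ℝ) < 1 / 2 by norm_num),
    eventually_ge_atTop 1] with N hN1 hN2 hN3
  have hN : (0 : ℝ) < N := by exact_mod_cast hN3
  have hpos : 0 < (N : ℝ) ^ (-D) := by positivity
  have h4 : (K : ℝ) * (N : ℝ) ^ (-(D + 1)) ≤ 1 / 2 * (N : ℝ) ^ (-D) := by
    have e : (N : ℝ) ^ (-(D + 1)) = (N : ℝ) ^ (-D) / N := by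
      rw [neg_add, ← sub_eq_add_neg, Real.rpow_sub_one hN.ne']
    rw [e, mul_div_assoc', div_le_iff₀ hN]
    nlinarith
  have h5 : (1 / 2 : ℝ) ^ N ≤ 1 / 2 * (N : ℝ) ^ (-D) := by
    have e : (1 / 2 : ℝ) ^ N = (N : ℝ) ^ D * (1 / 2) ^ N * (N : ℝ) ^ (-D) := by
      rw [mul_right_comm, ← Real.rpow_add hN, add_neg_cancel, Real.rpow_zero, one_mul]
    rw [e]
    gcongr
  linarith

/-- The three error terms of the deterministic estimate have the right order. -/
theorem rate_le {N : ℕ} (hN : 1 ≤ N) {ε : ℝ} {K : ℕ} (hK : 1 ≤ ε * K) (hε : 0 < ε) :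
    (N : ℝ) ^ (-(1 / 2 : ℝ) + ε) / (N : ℝ) ^ (-ε) + ((N : ℝ) ^ (-ε)) ^ K
      + N * ((N : ℝ) ^ (-(1 / 2 : ℝ) + ε)) ^ 3 ≤ 3 * (N : ℝ) ^ (-(1 / 2 : ℝ) + 3 * ε) := by
  have hN1 : (1 : ℝ) ≤ N := by exact_mod_cast hN
  have hN0 : (0 : ℝ) < N := by linarith
  have h1 : (N : ℝ) ^ (-(1 / 2 : ℝ) + ε) / (N : ℝ) ^ (-ε) ≤ (N : ℝ) ^ (-(1 / 2 : ℝ) + 3 * ε) := by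
    rw [← Real.rpow_sub hN0]
    exact Real.rpow_le_rpow_of_exponent_le hN1 (by linarith)
  have h2 : ((N : ℝ) ^ (-ε)) ^ K ≤ (N : ℝ) ^ (-(1 / 2 : ℝ) + 3 * ε) := by
    rw [← Real.rpow_natCast, ← Real.rpow_mul hN0.le]
    exact Real.rpow_le_rpow_of_exponent_le hN1 (by linarith)
  have h3 : N * ((N : ℝ) ^ (-(1 / 2 : ℝ) + ε)) ^ 3 ≤ (N : ℝ) ^ (-(1 / 2 : ℝ) + 3 * ε) := by
    rw [← Real.rpow_natCast, ← Real.rpow_mul hN0.le]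
    nth_rewrite 1 [← Real.rpow_one (N : ℝ)]
    rw [← Real.rpow_add hN0]
    refine Real.rpow_le_rpow_of_exponent_le hN1 ?_
    push_cast
    linarith
  linarith

theorem gcvErrorBound_of_extendedLocalMPLaw
    (h𝒟 : ∀ N j, MemLp (fun x : Fin (P N) → ℝ => x j) 2 (𝒟 N)) (β : ∀ N, Fin (P N) → ℝ)
    {lam : ℕ → ℝ} (hlam : ∀ N, 0 < lam N)
    (hMP : ExtendedLocalMPLaw 𝒟 (fun N => Set.Ioo (1 / 2 * lam N) (3 / 2 * lam N))) :
    GCVErrorBound 𝒟 β lam (fun N => β N ⬝ᵥ (secondMoment (𝒟 N) *ᵥ β N) *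
      (1 + opNorm (secondMoment (𝒟 N)) / lam N +
        ((secondMoment (𝒟 N)).trace / (N * lam N)) ^ (3 / 2 : ℝ))) := by
  refine hasHalfRate_of_forall fun ε' hε' => ?_
  -- `rate_le` spends three `ε`; the fourth absorbs the constant `12 * C`. The choice of `K` below
  -- makes `η ^ K` at most `1 / N`.
  set ε := ε' / 4 with hεdef
  have hε : 0 < ε := by positivity
  obtain ⟨K, hK1, hK⟩ : ∃ K : ℕ, 1 ≤ K ∧ 1 ≤ ε * K := by
    obtain ⟨K, hK⟩ := exists_nat_ge (1 / ε)
    rw [div_le_iff₀ hε] at hK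
    refine ⟨K, Nat.one_le_iff_ne_zero.2 ?_, by linarith⟩
    rintro rfl
    norm_num at hK
  obtain ⟨C, hC, hdet⟩ := exists_abs_gcv_sub_generalizationRisk_le K hK1
  have hlaw := withHighProbability_perturbedEvent h𝒟 β hlam hMP hε
  intro D hD
  obtain ⟨N₀, hN₀⟩ := hlaw (D + 1) (by linarith)
  have hC' : ∀ᶠ N : ℕ in atTop, 12 * C ≤ (N : ℝ) ^ ε :=
    ((tendsto_rpow_atTop hε).comp tendsto_natCast_atTop_atTop).eventually_ge_atTop _
  obtain ⟨N₁, hN₁⟩ := eventually_atTop.1 (hC'.and (eventually_failure_le (K + 2) D))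
  refine ⟨max (max N₀ N₁) 1, fun N hN _ => ?_⟩
  have hNp : 1 ≤ N := (le_max_right _ _).trans hN
  have hN0 : N₀ ≤ N := (le_max_left _ _).trans ((le_max_left _ _).trans hN)
  obtain ⟨hNC, hNf⟩ := hN₁ N ((le_max_right _ _).trans ((le_max_left _ _).trans hN))
  have hN1 : (1 : ℝ) ≤ N := by exact_mod_cast hNp
  have hNpos : (0 : ℝ) < N := by linarith
  have hQ := secondMoment_posSemidef (𝒟 N) (h𝒟 N)
  have hBnn : 0 ≤ β N ⬝ᵥ (secondMoment (𝒟 N) *ᵥ β N) := by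
    simpa using hQ.dotProduct_mulVec_nonneg (β N)
  -- Without signal the bound is `0`, so equality is needed almost surely. With signal, `‖Σ‖` and
  -- `tr Σ` are positive, as the deterministic estimate and Markov's inequality require.
  rcases hBnn.eq_or_lt with hB | hB
  · refine le_trans (measure_mono fun X hX => ?_)
      ((sampleLaw_gcv_ne_risk_eq_zero (h𝒟 N) hB.symm N (hlam N)).le.trans zero_le)
    intro hcon
    refine hX ?_
    change |gcv (β N) (lam N) X - generalizationRisk (𝒟 N) (β N) (ridgeEstimator (β N) (lam N) X)|
      ≤ _ * (_ * _)
    rw [hcon, ← hB]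
    simp
  have ha : 0 < opNorm (secondMoment (𝒟 N)) := by
    refine (opNorm_nonneg _).lt_of_ne fun h0 => ?_
    have := dotProduct_mulVec_le_opNorm (secondMoment (𝒟 N)) (β N)
    rw [← h0, zero_mul] at this
    linarith
  have htr : 0 < (secondMoment (𝒟 N)).trace := by
    refine hQ.trace_nonneg.lt_of_ne fun h0 => ?_
    rw [hQ.trace_eq_zero_iff.1 h0.symm, zero_mulVec, dotProduct_zero] at hB
    exact lt_irrefl _ hB
  set r := (N : ℝ) ^ (-(1 / 2 : ℝ) + ε) with hr
  set η := (N : ℝ) ^ (-ε) with hη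
  have hr0 : 0 < r := by positivity
  have hη0 : 0 < η := by positivity
  have hη1 : η ≤ 1 := Real.rpow_le_one_of_one_le_of_nonpos hN1 (by linarith)
  obtain ⟨hρ, hρt⟩ := perturbationScale_spec (h𝒟 N) (N := N) (hlam N) ha
  set S := Set.Ioo (1 / 2 * lam N) (3 / 2 * lam N) with hS
  set node := perturbationNode (𝒟 N) N (lam N) η K with hnode
  set G : Set (Fin N → Fin (P N) → ℝ) := {X | (N : ℝ) / 2 ≤
    (Finset.univ.filter fun i => X i ⬝ᵥ X i ≤ 16 * (secondMoment (𝒟 N)).trace).card} with hG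
  have hsub : {X | |gcv (β N) (lam N) X
      - generalizationRisk (𝒟 N) (β N) (ridgeEstimator (β N) (lam N) X)| ≤
        (N : ℝ) ^ (-(1 / 2 : ℝ) + ε') * (β N ⬝ᵥ (secondMoment (𝒟 N) *ᵥ β N) *
      (1 + opNorm (secondMoment (𝒟 N)) / lam N +
        ((secondMoment (𝒟 N)).trace / (N * lam N)) ^ (3 / 2 : ℝ)))}ᶜ ⊆
      (⋃ j ∈ Finset.range (K + 2), (perturbedEvent (𝒟 N) (β N) N S (node j) r)ᶜ) ∪ Gᶜ := by
    intro X hX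
    by_contra hcon
    rw [Set.mem_union, not_or, Set.notMem_compl_iff] at hcon
    obtain ⟨hcon1, hXG⟩ := hcon
    have hXe : ∀ j ≤ K + 1, X ∈ perturbedEvent (𝒟 N) (β N) N S (node j) r := by
      intro j hj
      by_contra hj'
      exact hcon1 (Set.mem_biUnion (Finset.mem_coe.2 (Finset.mem_range.2 (by omega))) hj')
    refine hX ?_
    have hlamN := hlam N
    have hst : 1 / sampleStieltjes X (lam N)
        ≤ 32 * (lam N + (secondMoment (𝒟 N)).trace / N) := by
      refine (one_div_sampleStieltjes_le X hNp hlamN (by positivity) hXG).trans ?_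
      have h1 : 2 * (lam N + 16 * (secondMoment (𝒟 N)).trace / N)
        = 2 * lam N + 32 * ((secondMoment (𝒟 N)).trace / N) := by ring
      rw [h1]
      linarith
    refine (hdet (𝒟 N) (h𝒟 N) (β N) N X (lam N) r η hNp hlamN hr0 hη0 hη1 ha hB hXe hst).trans ?_
    have h2 := rate_le hNp hK hε
    have h3 := sqrt_one_add_pow_three_le (x := (secondMoment (𝒟 N)).trace / (N * lam N))
      (by positivity)
    have hal : 0 < opNorm (secondMoment (𝒟 N)) / lam N := by positivity
    have h4 : opNorm (secondMoment (𝒟 N)) / lam N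
        + √(1 + (secondMoment (𝒟 N)).trace / (N * lam N)) ^ 3 ≤
        4 * (1 + opNorm (secondMoment (𝒟 N)) / lam N +
          ((secondMoment (𝒟 N)).trace / (N * lam N)) ^ (3 / 2 : ℝ)) := by linarith
    have h5 : (N : ℝ) ^ (-(1 / 2 : ℝ) + ε') = (N : ℝ) ^ ε * (N : ℝ) ^ (-(1 / 2 : ℝ) + 3 * ε) := by
      rw [← Real.rpow_add hNpos]
      congr 1
      rw [hεdef]
      ring
    rw [h5]
    set T := 1 + opNorm (secondMoment (𝒟 N)) / lam N +
          ((secondMoment (𝒟 N)).trace / (N * lam N)) ^ (3 / 2 : ℝ) with hT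
    have hT0 : 0 ≤ T := by positivity
    set B := β N ⬝ᵥ (secondMoment (𝒟 N) *ᵥ β N) with hBdef
    calc C * (r / η + η ^ K + N * r ^ 3) * B * (opNorm (secondMoment (𝒟 N)) / lam N
        + √(1 + (secondMoment (𝒟 N)).trace / (N * lam N)) ^ 3)
        ≤ C * (3 * (N : ℝ) ^ (-(1 / 2 : ℝ) + 3 * ε)) * B * (4 * T) := by gcongr
      _ = 12 * C * (N : ℝ) ^ (-(1 / 2 : ℝ) + 3 * ε) * (B * T) := by ring
      _ ≤ _ := by gcongr
  have hprob : sampleLaw (𝒟 N) N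
      ((⋃ j ∈ Finset.range (K + 2), (perturbedEvent (𝒟 N) (β N) N S (node j) r)ᶜ) ∪ Gᶜ)
        ≤ ENNReal.ofReal ((N : ℝ) ^ (-D)) := by
    have h1 : sampleLaw (𝒟 N) N Gᶜ ≤ ENNReal.ofReal ((1 / 2) ^ N) :=
      sampleLaw_many_large_le (h𝒟 N) htr N
    have h2 : sampleLaw (𝒟 N) N
        (⋃ j ∈ Finset.range (K + 2), (perturbedEvent (𝒟 N) (β N) N S (node j) r)ᶜ)
        ≤ ENNReal.ofReal (((K + 2 : ℕ) : ℝ) * (N : ℝ) ^ (-(D + 1))) := by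
      refine (measure_biUnion_finset_le _ _).trans ?_
      refine (Finset.sum_le_sum fun j _ => hN₀ N hN0 ⟨node j,
        (hρt _ (abs_perturbationNode_le hρ hη0 hη1 K j)).1⟩).trans ?_
      rw [Finset.sum_const, Finset.card_range, nsmul_eq_mul, ENNReal.ofReal_mul (Nat.cast_nonneg _),
        ENNReal.ofReal_natCast]
    refine (measure_union_le _ _).trans ((add_le_add h2 h1).trans ?_)
    rw [← ENNReal.ofReal_add (by positivity) (by positivity)]
    exact ENNReal.ofReal_le_ofReal hNf
  exact (measure_mono hsub).trans hprob

end RidgeGCV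

open RidgeGCV in
theorem mainTheorem1 (P : ℕ → ℕ) (𝒟 : ∀ N, Measure (Fin (P N) → ℝ))
    [∀ N, IsProbabilityMeasure (𝒟 N)]
    (h𝒟 : ∀ N j, MemLp (fun x : Fin (P N) → ℝ => x j) 2 (𝒟 N))
    (β : ∀ N, Fin (P N) → ℝ) (lam : ℕ → ℝ) (hlam : ∀ N, 0 < lam N)
    (hMP : ExtendedLocalMPLaw 𝒟 (fun N => Set.Ioo (1 / 2 * lam N) (3 / 2 * lam N))) :
    GCVErrorBound 𝒟 β lam (fun N => β N ⬝ᵥ (secondMoment (𝒟 N) *ᵥ β N) *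
      (1 + opNorm (secondMoment (𝒟 N)) / lam N +
        ((secondMoment (𝒟 N)).trace / (N * lam N)) ^ (3 / 2 : ℝ))) ∧
    (lam =O[atTop] (fun N => opNorm (secondMoment (𝒟 N))) →
      GCVErrorBound 𝒟 β lam (fun N => β N ⬝ᵥ (secondMoment (𝒟 N) *ᵥ β N) *
        (opNorm (secondMoment (𝒟 N)) / lam N +
          ((secondMoment (𝒟 N)).trace / (N * lam N)) ^ (3 / 2 : ℝ)))) := by
  have h1 := gcvErrorBound_of_extendedLocalMPLaw h𝒟 β hlam hMP
  refine ⟨h1, fun hO => ?_⟩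
  obtain ⟨c, hc, hO⟩ := hO.exists_pos
  refine h1.mono (c := c + 1) (by positivity) ?_
  filter_upwards [hO.bound] with N hN
  have hQ := secondMoment_posSemidef (𝒟 N) (h𝒟 N)
  have hB : 0 ≤ β N ⬝ᵥ (secondMoment (𝒟 N) *ᵥ β N) := by
    simpa using hQ.dotProduct_mulVec_nonneg (β N)
  have hlamN := hlam N
  rw [Real.norm_of_nonneg hlamN.le, Real.norm_of_nonneg (opNorm_nonneg _)] at hN
  -- The term `1` of the first bound is absorbed by `‖Σ‖ / λ`.
  have h2 : 1 ≤ c * (opNorm (secondMoment (𝒟 N)) / lam N) := by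
    rw [mul_div_assoc', le_div_iff₀ hlamN, one_mul]
    exact hN
  have h3 : 0 ≤ ((secondMoment (𝒟 N)).trace / (N * lam N)) ^ (3 / 2 : ℝ) := by
    have := hQ.trace_nonneg
    positivity
  have h4 : 1 + opNorm (secondMoment (𝒟 N)) / lam N +
      ((secondMoment (𝒟 N)).trace / (N * lam N)) ^ (3 / 2 : ℝ) ≤
      (c + 1) * (opNorm (secondMoment (𝒟 N)) / lam N +
        ((secondMoment (𝒟 N)).trace / (N * lam N)) ^ (3 / 2 : ℝ)) := by
    have := mul_nonneg hc.le h3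
    linarith
  calc _ ≤ β N ⬝ᵥ (secondMoment (𝒟 N) *ᵥ β N) * ((c + 1) *
        (opNorm (secondMoment (𝒟 N)) / lam N +
          ((secondMoment (𝒟 N)).trace / (N * lam N)) ^ (3 / 2 : ℝ))) := by gcongr
    _ = _ := by ring
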